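/- Let $n\ge 2$, and let $\mathbb{R}^{n+1}_1$ be $\mathbb{R}^{n+1}$ with the Lorentzian product $\langle X,Y\rangle=X_1Y_1+\dots+X_nY_n-X_{n+1}Y_{n+1}$. Let $x:M^n\to\mathbb{R}^{n+1}_1$ be a smooth immersion of a connected smooth $n$-manifold (without boundary) which is space-like and complete, i.e. the induced metric $g$ is Riemannian and complete. Let $N$ be a smooth unit normal field along $x$ ($\langle N,N\rangle=-1$, $\langle N,dx\rangle=0$), let $h$ be the second fundamental form, defined by requiring that $h(v,w)N$ be the normal part of the second derivative of $x$, let $H=\operatorname{tr}_g h$ be the mean curvature, $S=|h|_g^2$, and $B=S-\frac{H^2}{n}$. Let $a\neq0$ be a constant. Suppose that $\langle x,x\rangle$ does not change sign on $M$ (that is, $\langle x,x\rangle\ge0$ everywhere or $\langle x,x\rangle\le 0$ everywhere), and let $\epsilon=\pm1$ be the sign of $a\langle x,x\rangle$, i.e. the common value of $\operatorname{Sgn}(a\langle x,x\rangle)$ at the points where $\langle x,x\rangle\ne0$ (such points always exist). Suppose that $x$ is a $\lambda$-hypersurface with weight $s=\epsilon a$, that is, $$H-\epsilon a\langle x,N\rangle=\lambda\quad\text{is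 constant on } M,$$ and that $$\int_{M}\bigl(|\nabla B|+|\mathcal{L}B|\bigr)\,e^{-\frac{\epsilon a\langle x,x\rangle}{2}}\,dV_M<+\infty,\qquad \mathcal{L}v=\Delta v-\epsilon a\langle x,\nabla v\rangle,$$ where $\nabla$, $\Delta$ and $dV_M$ are the gradient, the Laplacian and the volume measure of $g$. Then at least one of the following holds. (i) $x$ is totally umbilical, and it is isometric to one of the following two hypersurfaces of $\mathbb{R}^{n+1}_1$: the hyperbolic space $\mathbb{H}^n(c)=\{X:\langle X,X\rangle=1/c,\ X_{n+1}>0\}$ for some $c<0$ (its sectional curvature), or the Euclidean space $\mathbb{R}^n=\{X:X_{n+1}=0\}$. Here "isometric" means that $x$ is an embedding and that some isometry of $\mathbb{R}^{n+1}_1$ carries its image onto the given hypersurface. (ii) There is a point $p\in M$ at which $$\left(\sqrt{S-\frac{H^2}{n}}-|\lambda|\frac{n-2}{2\sqrt{n(n-1)}}\right)^2+\frac1n(H-\lambda)^2-\frac{n\lambda^2}{4(n-1)}+\epsilon a<0.$$ -/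

import Mathlib

open scoped Manifold ContDiff Matrix ENNReal Topology
open MeasureTheory Filter

noncomputable section

namespace SpacelikeHypersurface

/-- The vector space `ℝⁿ⁺¹` underlying the Lorentzian space `ℝⁿ⁺¹₁`; its Euclidean structure is
used only for the topology and the differential calculus. -/
abbrev LorentzSpace (n : ℕ) : Type := EuclideanSpace ℝ (Fin (n + 1))

/-- The Lorentzian product `⟨X, Y⟩ = X₁Y₁ + ⋯ + XₙYₙ - Xₙ₊₁Yₙ₊₁`. -/
def lorentz {n : ℕ} (X Y : LorentzSpace n) : ℝ :=
  (∑ i : Fin n, X i.castSucc * Y i.castSucc) - X (Fin.last n) * Y (Fin.last n)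

variable {n : ℕ} {M : Type*} [TopologicalSpace M] [ChartedSpace (EuclideanSpace ℝ (Fin n)) M]

/-- The metric induced on `M` by a map `x : M → ℝⁿ⁺¹₁`: `g_p(v, w) = ⟨dx_p v, dx_p w⟩`. -/
def inducedMetric (x : M → LorentzSpace n) (p : M) (v w : TangentSpace (𝓡 n) p) : ℝ :=
  lorentz (n := n) (mfderiv (𝓡 n) 𝓘(ℝ, LorentzSpace n) x p v)
    (mfderiv (𝓡 n) 𝓘(ℝ, LorentzSpace n) x p w)

/-- `x : Mⁿ → ℝⁿ⁺¹₁` is a smooth space-like immersion: the induced metric is positive definite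
(so that `dx` is injective at every point). -/
def IsSpacelikeImmersion (x : M → LorentzSpace n) : Prop :=
  ContMDiff (𝓡 n) 𝓘(ℝ, LorentzSpace n) ∞ x ∧
    ∀ (p : M) (v : TangentSpace (𝓡 n) p), v ≠ 0 → 0 < inducedMetric x p v v

/-- `N` is a smooth unit normal field along `x`: `⟨N, N⟩ = -1` and `⟨N, dx v⟩ = 0`. -/
def IsUnitNormal (x N : M → LorentzSpace n) : Prop :=
  ContMDiff (𝓡 n) 𝓘(ℝ, LorentzSpace n) ∞ N ∧
    ∀ p : M, lorentz (N p) (N p) = -1 ∧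
      ∀ v : TangentSpace (𝓡 n) p,
        lorentz (n := n) (N p) (mfderiv (𝓡 n) 𝓘(ℝ, LorentzSpace n) x p v) = 0

/-- The Riemannian distance of the induced metric: the infimum of the lengths of `C¹` paths, where
a tangent vector `v` has length `√g(v, v)`. -/
def inducedEDist (x : M → LorentzSpace n) (p q : M) : ℝ≥0∞ :=
  letI : ∀ r : M, ENorm (TangentSpace (𝓡 n) r) :=
    fun r => ⟨fun v => ENNReal.ofReal (Real.sqrt (inducedMetric x r v v))⟩
  Manifold.riemannianEDist (𝓡 n) p q

/-- The induced Riemannian metric is complete: sequences that are Cauchy for the Riemannian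
distance (which induces the topology of `M`) converge in `M`. -/
def IsCompleteHypersurface (x : M → LorentzSpace n) : Prop :=
  ∀ u : ℕ → M,
    (∀ δ : ℝ≥0∞, 0 < δ → ∃ K : ℕ, ∀ k ≥ K, ∀ l ≥ K, inducedEDist x (u k) (u l) < δ) →
      ∃ p : M, Tendsto u atTop (𝓝 p)

/-- The expression of `f` in the preferred chart at `c`. -/
def inChart {F : Type*} (c : M) (f : M → F) : EuclideanSpace ℝ (Fin n) → F :=
  f ∘ (extChartAt (𝓡 n) c).symm

/-- The partial derivative `∂ᵢ f` at `u`. -/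
def pderiv {F : Type*} [NormedAddCommGroup F] [NormedSpace ℝ F] (i : Fin n)
    (f : EuclideanSpace ℝ (Fin n) → F) (u : EuclideanSpace ℝ (Fin n)) : F :=
  fderiv ℝ f u (EuclideanSpace.single i 1)

/-- The matrix `g_ij = ⟨∂ᵢ x, ∂ⱼ x⟩` of the induced metric in the preferred chart at `c`, at the
point with coordinates `u`. -/
def metricMatrix (x : M → LorentzSpace n) (c : M) (u : EuclideanSpace ℝ (Fin n)) :
    Matrix (Fin n) (Fin n) ℝ :=
  Matrix.of fun i j => lorentz (pderiv i (inChart c x) u) (pderiv j (inChart c x) u)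

/-- The matrix of the second fundamental form `h` in the preferred chart at `c`. The normal part of
`∂ᵢ∂ⱼ x` is `h_ij N`, that is, `h_ij = -⟨∂ᵢ∂ⱼ x, N⟩` as `⟨N, N⟩ = -1`. -/
def secondFormMatrix (x N : M → LorentzSpace n) (c : M) (u : EuclideanSpace ℝ (Fin n)) :
    Matrix (Fin n) (Fin n) ℝ :=
  Matrix.of fun i j => -lorentz (pderiv i (pderiv j (inChart c x)) u) (inChart c N u)

/-- `(g_ij)` at `p`, in the preferred chart at `p`. -/
def metricAt (x : M → LorentzSpace n) (p : M) : Matrix (Fin n) (Fin n) ℝ :=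
  metricMatrix x p (extChartAt (𝓡 n) p p)

/-- `(h_ij)` at `p`, in the preferred chart at `p`. -/
def secondFormAt (x N : M → LorentzSpace n) (p : M) : Matrix (Fin n) (Fin n) ℝ :=
  secondFormMatrix x N p (extChartAt (𝓡 n) p p)

/-- The mean curvature `H = g^{ij} h_ij`, the trace of the second fundamental form. -/
def meanCurvature (x N : M → LorentzSpace n) (p : M) : ℝ :=
  ((metricAt x p)⁻¹ * secondFormAt x N p).trace

/-- The squared norm `S = g^{ik} g^{jl} h_ij h_kl` of the second fundamental form. -/
def secondFormNormSq (x N : M → LorentzSpace n) (p : M) : ℝ :=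
  ((metricAt x p)⁻¹ * secondFormAt x N p * (metricAt x p)⁻¹ * secondFormAt x N p).trace

/-- `B = S - H² / n`. -/
def umbilicityDefect (x N : M → LorentzSpace n) (p : M) : ℝ :=
  secondFormNormSq x N p - meanCurvature x N p ^ 2 / n

/-- The components `(∇f)^i = g^{ij} ∂ⱼ f` of the gradient in the preferred chart at `c`. -/
def gradientComponents (x : M → LorentzSpace n) (f : M → ℝ) (c : M)
    (u : EuclideanSpace ℝ (Fin n)) : Fin n → ℝ :=
  (metricMatrix x c u)⁻¹ *ᵥ fun j => pderiv j (inChart c f) u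

/-- The gradient `∇f` at `p`, as a vector of `ℝⁿ⁺¹₁` tangent to `x`:
`∇f = g^{ij} (∂ⱼ f) ∂ᵢ x`. -/
def inducedGradient (x : M → LorentzSpace n) (f : M → ℝ) (p : M) : LorentzSpace n :=
  ∑ i : Fin n, gradientComponents x f p (extChartAt (𝓡 n) p p) i •
    pderiv i (inChart p x) (extChartAt (𝓡 n) p p)

/-- The Laplacian of the induced metric,
`Δf = div ∇f = (det g)^{-1/2} ∂ᵢ ((det g)^{1/2} g^{ij} ∂ⱼ f)`. -/
def inducedLaplacian (x : M → LorentzSpace n) (f : M → ℝ) (p : M) : ℝ :=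
  (Real.sqrt (metricAt x p).det)⁻¹ *
    ∑ i : Fin n, pderiv i
      (fun u => Real.sqrt (metricMatrix x p u).det * gradientComponents x f p u i)
      (extChartAt (𝓡 n) p p)

/-- The operator `𝓛f = Δf - s ⟨x, ∇f⟩` for a constant `s`. -/
def driftLaplacian (x : M → LorentzSpace n) (s : ℝ) (f : M → ℝ) (p : M) : ℝ :=
  inducedLaplacian x f p - s * lorentz (x p) (inducedGradient x f p)

/-- The Riemannian volume of the domain of the preferred chart at `c`, viewed as a measure on `M`:
the density `√(det g)` with respect to Lebesgue measure in the chart. -/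
def chartVolume [MeasurableSpace M] (x : M → LorentzSpace n) (c : M) : Measure M :=
  ((volume.restrict (extChartAt (𝓡 n) c).target).withDensity
    fun u => ENNReal.ofReal (Real.sqrt (metricMatrix x c u).det)).map (extChartAt (𝓡 n) c).symm

/-- The Riemannian volume measure `dV_M` of the induced metric, the least measure that dominates
its restriction to each chart domain. These restrictions agree on overlaps and countably many chart
domains cover `M`, so on each chart domain it is `√(det g) du`. -/
def riemannianVolume [MeasurableSpace M] (x : M → LorentzSpace n) : Measure M :=
  ⨆ c : M, chartVolume x c

/-- `x` is totally umbilical: at each point, `h` is a multiple of the metric. -/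
def IsTotallyUmbilical (x N : M → LorentzSpace n) : Prop :=
  ∀ p : M, ∃ ρ : ℝ, secondFormAt x N p = ρ • metricAt x p

/-- The hyperbolic space `ℍⁿ(c) = {X : ⟨X, X⟩ = 1/c, Xₙ₊₁ > 0}` of sectional curvature `c < 0`. -/
def hyperbolicSpace (n : ℕ) (c : ℝ) : Set (LorentzSpace n) :=
  {X | lorentz X X = 1 / c ∧ 0 < X (Fin.last n)}

/-- The Euclidean space `ℝⁿ = {X : Xₙ₊₁ = 0}` in `ℝⁿ⁺¹₁`. -/
def euclideanHyperplane (n : ℕ) : Set (LorentzSpace n) :=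
  {X | X (Fin.last n) = 0}

/-- The immersed hypersurface `x` is isometric to the hypersurface `Q` of `ℝⁿ⁺¹₁`: `x` is an
embedding, and some isometry `Φ` of `ℝⁿ⁺¹₁` carries its image onto `Q`. Since the metric of `M` is
the pull-back of the Lorentzian product by `Φ ∘ x`, this map is then an isometry of `M` onto `Q`. -/
def IsIsometricToHypersurface (x : M → LorentzSpace n) (Q : Set (LorentzSpace n)) : Prop :=
  Topology.IsEmbedding x ∧
    ∃ Φ : LorentzSpace n ≃ᵃ[ℝ] LorentzSpace n,
      (∀ v w : LorentzSpace n, lorentz (Φ.linear v) (Φ.linear w) = lorentz v w) ∧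
        Φ '' Set.range x = Q

end SpacelikeHypersurface

end

open SpacelikeHypersurface

/-! Assume (ii) fails, so that the quantity `Q` in (ii) is nonnegative everywhere; (i) has to be
derived. Write `s = εa`. The position vector is not everywhere light-like, so `ε = ±1` and `s ≠ 0`.

Coordinates. Projection along a unit time-like vector `T` onto its orthogonal complement does not
shorten tangent vectors. Segments therefore lift to a complete space-like hypersurface, and the
projection is a diffeomorphism onto `ℝⁿ`: for every Lorentz frame, `M` is an entire graph
(`graphDiffeo`). If `T = N p`, the metric in these coordinates is Euclidean at `p` up to first
order. There `h`, `∇h` and the terms of `ΔB` are plain partial derivatives of the components of `N`,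
and no connection or curvature tensor is needed.

Simons formula and Okumura inequality. Differentiating `H = λ + s⟨x, N⟩` twice and commuting third
derivatives gives `𝓛B = 2(|∇h|² - |∇H|²/n + (S + s)B - λ(tr h³ - HS/n))` (`IsAdaptedGraph.simons`).
Okumura's bound on the cubes of the trace-free eigenvalues, with a completed square, shows that the
zeroth-order part is at least `2BQ` (`simons_reaction_ge`). Since `|∇h|² ≥ |∇H|²/n`, this gives `𝓛B
≥ 0`.

Integration. `exp(-s⟨x,x⟩/2)∇B` has integrable norm, and its divergence is the weight times `𝓛B`.
Metric balls are bounded in graph coordinates, by a Hopf–Rinow argument, so cutoffs of the distance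
function have compact support. Integrating by parts against them bounds the weighted integral of
`𝓛B` by a constant over `R`; hence `𝓛B = 0` (`driftLaplacian_eq_zero`).

Rigidity. Now `|∇h|² = |∇H|²/n`, which together with the Codazzi symmetry and `n ≥ 2` forces `∇h =
0`. So `H` is constant, and as `s ≠ 0` so is `c = ⟨x, N⟩`. The Hessian of `H` gives `h + c h² = 0`.
If `c = 0`, then `h = 0`. Otherwise let `W = ⟨x,x⟩ + c²` be the squared length of the tangential
part of `x`; where `W > 0`, the gradient of `√W` has length one. On a complete manifold a function
bounded below has points of slope less than one. This excludes `⟨x,x⟩ ≥ 0`, where `√W` is positive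
everywhere; if `⟨x,x⟩ ≤ 0`, then `-√W` is bounded below, so `W = 0` and `x = -cN`. In every case `B
= 0` (`umbilicityDefect_eq_zero_of_parallel`).

Classification. With `B = 0` and `H = nκ` constant, `N - κx` is constant. So `x` lies in a
space-like hyperplane if `κ = 0`, or on one sheet of a hyperboloid of curvature `-κ²` otherwise;
being an entire graph, it fills it. -/

namespace SpacelikeHypersurface

/-! ### Lorentzian linear algebra: the product, orthonormal frames and boosts. -/

section LorentzProduct

variable {n : ℕ}

theorem lorentz_comm (X Y : LorentzSpace n) : lorentz X Y = lorentz Y X := by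
  simp only [lorentz, mul_comm]

theorem lorentz_add_left (X Y Z : LorentzSpace n) :
    lorentz (X + Y) Z = lorentz X Z + lorentz Y Z := by
  simp only [lorentz, PiLp.add_apply, add_mul, Finset.sum_add_distrib]; ring

theorem lorentz_smul_left (c : ℝ) (X Z : LorentzSpace n) :
    lorentz (c • X) Z = c * lorentz X Z := by
  simp only [lorentz, PiLp.smul_apply, smul_eq_mul, mul_assoc, mul_sub, Finset.mul_sum]

/-- The Lorentzian product as a continuous bilinear form. -/
noncomputable def lorentzForm (n : ℕ) : LorentzSpace n →L[ℝ] LorentzSpace n →L[ℝ] ℝ :=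
  LinearMap.toContinuousLinearMap
    (LinearMap.toContinuousLinearMap.toLinearMap ∘ₗ
      (LinearMap.mk₂ ℝ (lorentz (n := n)) lorentz_add_left lorentz_smul_left
        (fun X Y Z => by rw [lorentz_comm, lorentz_add_left, lorentz_comm Y, lorentz_comm Z])
        (fun c X Y => by rw [lorentz_comm, lorentz_smul_left, lorentz_comm Y]; rfl)))

@[simp] theorem lorentzForm_apply (X Y : LorentzSpace n) : lorentzForm n X Y = lorentz X Y := rfl

theorem lorentz_add_right (X Y Z : LorentzSpace n) :
    lorentz X (Y + Z) = lorentz X Y + lorentz X Z := (lorentzForm n X).map_add Y Z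

theorem lorentz_smul_right (c : ℝ) (X Y : LorentzSpace n) :
    lorentz X (c • Y) = c * lorentz X Y := (lorentzForm n X).map_smul c Y

theorem lorentz_sub_right (X Y Z : LorentzSpace n) :
    lorentz X (Y - Z) = lorentz X Y - lorentz X Z := (lorentzForm n X).map_sub Y Z

theorem lorentz_sub_left (X Y Z : LorentzSpace n) :
    lorentz (X - Y) Z = lorentz X Z - lorentz Y Z := by
  rw [lorentz_comm, lorentz_sub_right, lorentz_comm X, lorentz_comm Y]

theorem lorentz_neg_right (X Y : LorentzSpace n) : lorentz X (-Y) = -lorentz X Y :=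
  (lorentzForm n X).map_neg Y

theorem lorentz_neg_left (X Y : LorentzSpace n) : lorentz (-X) Y = -lorentz X Y := by
  rw [lorentz_comm, lorentz_neg_right, lorentz_comm]

@[simp] theorem lorentz_zero_right (X : LorentzSpace n) : lorentz X 0 = 0 :=
  (lorentzForm n X).map_zero

@[simp] theorem lorentz_zero_left (X : LorentzSpace n) : lorentz 0 X = 0 := by
  rw [lorentz_comm, lorentz_zero_right]

theorem lorentz_sum_right {ι : Type*} (s : Finset ι) (X : LorentzSpace n)
    (Y : ι → LorentzSpace n) : lorentz X (∑ i ∈ s, Y i) = ∑ i ∈ s, lorentz X (Y i) :=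
  map_sum (lorentzForm n X) Y s

theorem lorentz_sum_left {ι : Type*} (s : Finset ι) (X : LorentzSpace n)
    (Y : ι → LorentzSpace n) : lorentz (∑ i ∈ s, Y i) X = ∑ i ∈ s, lorentz (Y i) X := by
  rw [lorentz_comm, lorentz_sum_right]; simp only [lorentz_comm]

theorem continuous_lorentz {A : Type*} [TopologicalSpace A] {f g : A → LorentzSpace n}
    (hf : Continuous f) (hg : Continuous g) : Continuous fun a => lorentz (f a) (g a) :=
  ((lorentzForm n).continuous.comp hf).clm_apply hg

/-- The `j`-th standard basis vector of `ℝⁿ⁺¹₁`. -/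
noncomputable abbrev stdVec (j : Fin (n + 1)) : LorentzSpace n := EuclideanSpace.single j 1

theorem lorentz_stdVec_castSucc (X : LorentzSpace n) (i : Fin n) :
    lorentz X (stdVec i.castSucc) = X i.castSucc := by
  rw [lorentz, Finset.sum_eq_single i]
  · simp [stdVec, (Fin.castSucc_ne_last i).symm]
  · intro j _ hj
    simp [stdVec, hj]
  · simp

theorem lorentz_stdVec_last (X : LorentzSpace n) :
    lorentz X (stdVec (Fin.last n)) = -X (Fin.last n) := by
  simp [lorentz, stdVec, Fin.castSucc_ne_last]

theorem eq_zero_of_lorentz_eq_zero {X : LorentzSpace n} (h : ∀ Y, lorentz X Y = 0) : X = 0 := by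
  ext j
  induction j using Fin.lastCases with
  | last =>
    have := h (stdVec (Fin.last n))
    rw [lorentz_stdVec_last] at this
    simpa using this
  | cast i =>
    have := h (stdVec i.castSucc)
    rw [lorentz_stdVec_castSucc] at this
    simpa using this

/-- A vector orthogonal to `n + 1` linearly independent vectors vanishes. -/
theorem eq_zero_of_orthogonal_linearIndependent {b : Fin (n + 1) → LorentzSpace n}
    (hb : LinearIndependent ℝ b) {X : LorentzSpace n} (h : ∀ i, lorentz X (b i) = 0) : X = 0 := by
  have hspan : Submodule.span ℝ (Set.range b) = ⊤ :=
    hb.span_eq_top_of_card_eq_finrank (by simp)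
  apply eq_zero_of_lorentz_eq_zero
  intro Y
  have hY : Y ∈ Submodule.span ℝ (Set.range b) := by rw [hspan]; trivial
  induction hY using Submodule.span_induction with
  | mem y hy => obtain ⟨i, rfl⟩ := hy; exact h i
  | zero => simp
  | add y z _ _ hy hz => rw [lorentz_add_right, hy, hz, add_zero]
  | smul c y _ hy => rw [lorentz_smul_right, hy, mul_zero]

end LorentzProduct

/-- A Lorentz orthonormal frame: `n` unit space-like vectors and a unit time-like one. -/
structure LorentzFrame (n : ℕ) where
  vec : Fin n → LorentzSpace n
  time : LorentzSpace n
  vec_vec : ∀ i j, lorentz (vec i) (vec j) = if i = j then 1 else 0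
  time_time : lorentz time time = -1
  vec_time : ∀ i, lorentz (vec i) time = 0

namespace LorentzFrame

variable {n : ℕ} (e : LorentzFrame n)

theorem linearIndependent :
    LinearIndependent ℝ (Fin.snoc e.vec e.time : Fin (n + 1) → LorentzSpace n) := by
  rw [Fintype.linearIndependent_iff]
  intro c hc
  rw [Fin.sum_univ_castSucc] at hc
  simp only [Fin.snoc_castSucc, Fin.snoc_last] at hc
  intro j
  induction j using Fin.lastCases with
  | last =>
    have := congrArg (fun v => lorentz v e.time) hc
    simpa [lorentz_add_left, lorentz_sum_left, lorentz_smul_left, e.vec_time, e.time_time]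
      using this
  | cast i =>
    have := congrArg (fun v => lorentz v (e.vec i)) hc
    simpa [lorentz_add_left, lorentz_sum_left, lorentz_smul_left, lorentz_comm e.time, e.vec_time,
      e.vec_vec] using this

theorem expansion (X : LorentzSpace n) :
    X = ∑ i, lorentz X (e.vec i) • e.vec i - lorentz X e.time • e.time := by
  rw [← sub_eq_zero]
  apply eq_zero_of_orthogonal_linearIndependent e.linearIndependent
  intro j
  induction j using Fin.lastCases with
  | last =>
    simp [lorentz_sub_left, lorentz_sum_left, lorentz_smul_left, e.vec_time, e.time_time]
  | cast i =>
    simp [lorentz_sub_left, lorentz_sum_left, lorentz_smul_left, lorentz_comm e.time, e.vec_time,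
      e.vec_vec]

theorem parseval (X Y : LorentzSpace n) :
    lorentz X Y = ∑ i, lorentz X (e.vec i) * lorentz Y (e.vec i)
      - lorentz X e.time * lorentz Y e.time := by
  conv_lhs => rw [e.expansion Y]
  simp only [lorentz_sub_right, lorentz_sum_right, lorentz_smul_right]
  congr 1
  · exact Finset.sum_congr rfl fun i _ => mul_comm _ _
  · exact mul_comm _ _

theorem ext_of_lorentz {X Y : LorentzSpace n} (h : ∀ i, lorentz X (e.vec i) = lorentz Y (e.vec i))
    (ht : lorentz X e.time = lorentz Y e.time) : X = Y := by
  rw [e.expansion X, e.expansion Y, ht]; simp only [h]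

/-- The space-like coordinates `(⟨X, e₁⟩, …, ⟨X, eₙ⟩)`. -/
noncomputable def proj : LorentzSpace n →L[ℝ] EuclideanSpace ℝ (Fin n) :=
  ((EuclideanSpace.equiv (Fin n) ℝ).symm : (Fin n → ℝ) →L[ℝ] EuclideanSpace ℝ (Fin n)) ∘L
    ContinuousLinearMap.pi fun i => (lorentzForm n).flip (e.vec i)

@[simp] theorem proj_apply (X : LorentzSpace n) (i : Fin n) : e.proj X i = lorentz X (e.vec i) :=
  rfl

/-- The Euclidean length of the projection dominates the Lorentzian one. Completeness enters through
this inequality: it makes the projection of a space-like hypersurface an immersion, and it bounds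
the lengths of lifted curves. -/
theorem norm_proj_sq (X : LorentzSpace n) :
    ‖e.proj X‖ ^ 2 = lorentz X X + lorentz X e.time ^ 2 := by
  rw [EuclideanSpace.norm_sq_eq, e.parseval X X]
  simp [sq]

/-- The standard frame. -/
noncomputable def std (n : ℕ) : LorentzFrame n where
  vec i := stdVec i.castSucc
  time := stdVec (Fin.last n)
  vec_vec i j := by
    rw [lorentz_stdVec_castSucc]
    simp [stdVec, Fin.castSucc_inj, eq_comm]
  time_time := by rw [lorentz_stdVec_last]; simp [stdVec]
  vec_time i := by
    rw [lorentz_stdVec_last]; simp [stdVec, (Fin.castSucc_ne_last i).symm]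

/-- The image of the standard frame under the boost that takes the last standard basis vector to
a unit time-like vector `T` with positive last coordinate. -/
noncomputable def boost (T : LorentzSpace n) (hT : lorentz T T = -1) (h0 : 0 < T (Fin.last n)) :
    LorentzFrame n where
  -- With `E` the last basis vector, the boost in the plane of `E` and `T` fixes the orthogonal
  -- complement of that plane; on `eᵢ` it adds the multiple `⟨eᵢ, T⟩ / (1 - ⟨E, T⟩)` of `E + T`.
  vec i := stdVec i.castSucc + (T i.castSucc / (1 + T (Fin.last n))) • (stdVec (Fin.last n) + T)
  time := T
  time_time := hT
  vec_vec i j := by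
    have h1 : 1 + T (Fin.last n) ≠ 0 := by positivity
    have hs := (std n).vec_vec i j
    simp only [std] at hs
    have hl : lorentz (stdVec (Fin.last n)) (stdVec (Fin.last n)) = -1 := (std n).time_time
    have hi := (std n).vec_time i
    have hj := (std n).vec_time j
    simp only [std] at hi hj
    simp only [lorentz_add_left, lorentz_smul_left, lorentz_add_right, lorentz_smul_right, hs, hi,
      hl, hT, lorentz_comm (stdVec _) T, lorentz_comm (stdVec (Fin.last n)) (stdVec (Fin.castSucc _)),
      hj, lorentz_stdVec_castSucc T, lorentz_stdVec_last T]
    field_simp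
    ring
  vec_time i := by
    have h1 : 1 + T (Fin.last n) ≠ 0 := by positivity
    simp only [lorentz_add_left, lorentz_smul_left, lorentz_comm (stdVec _) T,
      lorentz_stdVec_castSucc, lorentz_stdVec_last, hT]
    field_simp
    ring

/-- Applied to `T = N p`, this gives a frame adapted to the tangent space at `p`. A past-directed
`T` is treated through `-T`, which has the same orthogonal complement. -/
theorem exists_time_eq (T : LorentzSpace n) (hT : lorentz T T = -1) :
    ∃ e : LorentzFrame n, e.time = T := by
  rcases lt_trichotomy (T (Fin.last n)) 0 with h | h | h
  · have hT' : lorentz (-T) (-T) = -1 := by rw [lorentz_neg_left, lorentz_neg_right, neg_neg, hT]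
    let e' := boost (-T) hT' (by simpa using h)
    have ht : e'.time = -T := rfl
    refine ⟨⟨e'.vec, T, e'.vec_vec, hT, fun i => ?_⟩, rfl⟩
    have := e'.vec_time i
    rw [ht, lorentz_neg_right] at this
    linarith
  · exfalso
    rw [lorentz, h] at hT
    have : 0 ≤ ∑ i : Fin n, T i.castSucc * T i.castSucc :=
      Finset.sum_nonneg fun i _ => mul_self_nonneg _
    linarith
  · exact ⟨boost T hT h, rfl⟩

/-- The linear isometry that takes the frame to the standard frame. -/
noncomputable def toStd : LorentzSpace n ≃ₗ[ℝ] LorentzSpace n where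
  toFun X := ∑ i, lorentz X (e.vec i) • stdVec i.castSucc
    - lorentz X e.time • stdVec (Fin.last n)
  invFun X := ∑ i, X i.castSucc • e.vec i + X (Fin.last n) • e.time
  map_add' X Y := by
    simp only [lorentz_add_left, add_smul, Finset.sum_add_distrib]; abel
  map_smul' c X := by
    simp only [lorentz_smul_left, mul_smul, ← Finset.smul_sum, ← smul_sub, RingHom.id_apply]
  left_inv X := by
    conv_rhs => rw [e.expansion X]
    simp [stdVec, Fin.castSucc_ne_last, (Fin.castSucc_ne_last _).symm, Pi.single_apply,
      Fin.castSucc_inj, sub_eq_add_neg]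
  right_inv X := by
    ext j
    induction j using Fin.lastCases with
    | last =>
      simp [lorentz_add_left, lorentz_sum_left, lorentz_smul_left, e.vec_time, e.time_time,
        (Fin.castSucc_ne_last _).symm]
    | cast i =>
      simp [lorentz_add_left, lorentz_sum_left, lorentz_smul_left, lorentz_comm e.time,
        e.vec_vec, e.vec_time, Pi.single_apply, Fin.castSucc_ne_last]

theorem toStd_castSucc (X : LorentzSpace n) (i : Fin n) :
    e.toStd X i.castSucc = lorentz X (e.vec i) := by
  simp [toStd, stdVec, Pi.single_apply, Fin.castSucc_ne_last]

theorem toStd_last (X : LorentzSpace n) : e.toStd X (Fin.last n) = -lorentz X e.time := by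
  simp [toStd, stdVec, (Fin.castSucc_ne_last _).symm]

theorem lorentz_toStd (X Y : LorentzSpace n) : lorentz (e.toStd X) (e.toStd Y) = lorentz X Y := by
  rw [e.parseval X Y, lorentz]
  simp only [toStd_castSucc, toStd_last, neg_mul_neg]

end LorentzFrame

end SpacelikeHypersurface

namespace SpacelikeHypersurface

/-! ### Calculus of partial derivatives in `ℝⁿ`. -/

section PartialDerivatives

variable {n : ℕ} {F : Type*} [NormedAddCommGroup F] [NormedSpace ℝ F]
  {u : EuclideanSpace ℝ (Fin n)} {U : Set (EuclideanSpace ℝ (Fin n))}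

theorem pderiv_congr {f g : EuclideanSpace ℝ (Fin n) → F} (h : f =ᶠ[𝓝 u] g) (i : Fin n) :
    pderiv i f u = pderiv i g u := by
  rw [pderiv, pderiv, h.fderiv_eq]

theorem pderiv_const (c : F) (i : Fin n) : pderiv i (fun _ => c) u = 0 := by
  simp [pderiv]

theorem pderiv_add {f g : EuclideanSpace ℝ (Fin n) → F} (hf : DifferentiableAt ℝ f u)
    (hg : DifferentiableAt ℝ g u) (i : Fin n) :
    pderiv i (fun v => f v + g v) u = pderiv i f u + pderiv i g u := by
  rw [pderiv, fderiv_fun_add hf hg]; rfl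

theorem pderiv_sub {f g : EuclideanSpace ℝ (Fin n) → F} (hf : DifferentiableAt ℝ f u)
    (hg : DifferentiableAt ℝ g u) (i : Fin n) :
    pderiv i (fun v => f v - g v) u = pderiv i f u - pderiv i g u := by
  rw [pderiv, fderiv_fun_sub hf hg]; rfl

theorem pderiv_sum {ι : Type*} {s : Finset ι} {f : ι → EuclideanSpace ℝ (Fin n) → F}
    (hf : ∀ j ∈ s, DifferentiableAt ℝ (f j) u) (i : Fin n) :
    pderiv i (fun v => ∑ j ∈ s, f j v) u = ∑ j ∈ s, pderiv i (f j) u := by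
  rw [pderiv, fderiv_fun_sum hf]; simp [pderiv]

theorem pderiv_smul {c : EuclideanSpace ℝ (Fin n) → ℝ} {f : EuclideanSpace ℝ (Fin n) → F}
    (hc : DifferentiableAt ℝ c u) (hf : DifferentiableAt ℝ f u) (i : Fin n) :
    pderiv i (fun v => c v • f v) u = c u • pderiv i f u + pderiv i c u • f u := by
  rw [pderiv, fderiv_fun_smul hc hf]; simp [pderiv]

theorem pderiv_mul {f g : EuclideanSpace ℝ (Fin n) → ℝ} (hf : DifferentiableAt ℝ f u)
    (hg : DifferentiableAt ℝ g u) (i : Fin n) :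
    pderiv i (fun v => f v * g v) u = pderiv i f u * g u + f u * pderiv i g u := by
  rw [pderiv, fderiv_fun_mul hf hg]; simp [pderiv]; ring

theorem pderiv_lorentz {f g : EuclideanSpace ℝ (Fin n) → LorentzSpace n}
    (hf : DifferentiableAt ℝ f u) (hg : DifferentiableAt ℝ g u) (i : Fin n) :
    pderiv i (fun v => lorentz (f v) (g v)) u
      = lorentz (pderiv i f u) (g u) + lorentz (f u) (pderiv i g u) := by
  have h := (((lorentzForm n).hasFDerivAt.comp u hf.hasFDerivAt).clm_apply hg.hasFDerivAt)
  have h2 : HasFDerivAt (fun v => lorentz (f v) (g v)) _ u := h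
  rw [pderiv, h2.fderiv]
  simp [pderiv, add_comm]

theorem fderiv_eq_sum_pderiv (f : EuclideanSpace ℝ (Fin n) → F) (u v : EuclideanSpace ℝ (Fin n)) :
    fderiv ℝ f u v = ∑ i, v i • pderiv i f u := by
  have hv : v = ∑ i, v i • EuclideanSpace.single i (1 : ℝ) := by
    ext j; simp [Pi.single_apply]
  conv_lhs => rw [hv]
  simp [pderiv]

theorem _root_.ContDiffOn.pderiv_of_isOpen {f : EuclideanSpace ℝ (Fin n) → F}
    (hf : ContDiffOn ℝ ∞ f U) (hU : IsOpen U) (i : Fin n) : ContDiffOn ℝ ∞ (pderiv i f) U :=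
  (hf.fderiv_of_isOpen hU (by simp)).clm_apply contDiffOn_const

theorem _root_.ContDiff.pderiv {f : EuclideanSpace ℝ (Fin n) → F} (hf : ContDiff ℝ ∞ f)
    (i : Fin n) : ContDiff ℝ ∞ (pderiv i f) := by
  rw [← contDiffOn_univ] at hf ⊢
  exact hf.pderiv_of_isOpen isOpen_univ i

theorem _root_.ContDiffOn.differentiableAt_of_isOpen {f : EuclideanSpace ℝ (Fin n) → F}
    (hf : ContDiffOn ℝ ∞ f U) (hU : IsOpen U) (hu : u ∈ U) : DifferentiableAt ℝ f u :=
  (hf.contDiffAt (hU.mem_nhds hu)).differentiableAt (by simp)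

theorem pderiv_comm {f : EuclideanSpace ℝ (Fin n) → F} (hf : ContDiffAt ℝ ∞ f u) (i j : Fin n) :
    pderiv i (pderiv j f) u = pderiv j (pderiv i f) u := by
  have hsymm := (hf.isSymmSndFDerivAt (by simp; norm_cast))
  have hd : DifferentiableAt ℝ (fderiv ℝ f) u :=
    (hf.fderiv_right (m := 1) (by norm_cast)).differentiableAt (by simp)
  have key : ∀ k l : Fin n, pderiv k (pderiv l f) u
      = fderiv ℝ (fderiv ℝ f) u (EuclideanSpace.single k 1) (EuclideanSpace.single l 1) := by
    intro k l
    have : pderiv l f = fun v => (fderiv ℝ f v) (EuclideanSpace.single l 1) := rfl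
    rw [pderiv, this, fderiv_clm_apply hd (differentiableAt_const _)]
    simp
  rw [key, key, hsymm.eq]

theorem _root_.ContDiffOn.lorentz {f g : EuclideanSpace ℝ (Fin n) → LorentzSpace n}
    (hf : ContDiffOn ℝ ∞ f U) (hg : ContDiffOn ℝ ∞ g U) :
    ContDiffOn ℝ ∞ (fun v => lorentz (f v) (g v)) U :=
  ((lorentzForm n).contDiff.comp_contDiffOn hf).clm_apply hg

theorem _root_.ContDiff.lorentz {f g : EuclideanSpace ℝ (Fin n) → LorentzSpace n}
    (hf : ContDiff ℝ ∞ f) (hg : ContDiff ℝ ∞ g) :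
    ContDiff ℝ ∞ (fun v => lorentz (f v) (g v)) :=
  ((lorentzForm n).contDiff.comp hf).clm_apply hg

theorem contDiffOn_det {m : Type*} [Fintype m] [DecidableEq m]
    {A : EuclideanSpace ℝ (Fin n) → Matrix m m ℝ} (hA : ∀ i j, ContDiffOn ℝ ∞ (fun v => A v i j) U) :
    ContDiffOn ℝ ∞ (fun v => (A v).det) U := by
  simp only [Matrix.det_apply']
  exact ContDiffOn.sum fun σ _ => contDiffOn_const.mul (contDiffOn_prod fun i _ => hA _ _)

/-- Jacobi's formula for the derivative of a determinant. -/
theorem pderiv_det {m : Type*} [Fintype m] [DecidableEq m]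
    {A : EuclideanSpace ℝ (Fin n) → Matrix m m ℝ}
    (hA : ∀ i j, DifferentiableAt ℝ (fun v => A v i j) u) (h0 : IsUnit (A u).det) (k : Fin n) :
    pderiv k (fun v => (A v).det) u
      = (A u).det * ((A u)⁻¹ * Matrix.of fun i j => pderiv k (fun v => A v i j) u).trace := by
  -- Jacobi's formula at the identity: only the identity permutation contributes, since every other
  -- one moves at least two points and so leaves a vanishing factor in each term of the product
  -- rule.
  have hone : ∀ C : EuclideanSpace ℝ (Fin n) → Matrix m m ℝ, C u = 1 →
      (∀ i j, DifferentiableAt ℝ (fun v => C v i j) u) →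
      pderiv k (fun v => (C v).det) u = ∑ i, pderiv k (fun v => C v i i) u := by
    intro C hC hd
    have h1 : ∀ σ : Equiv.Perm m, HasFDerivAt (fun v => ∏ i, C v (σ i) i)
        (∑ i, (∏ j ∈ Finset.univ.erase i, C u (σ j) j) • fderiv ℝ (fun v => C v (σ i) i) u) u :=
      fun σ => HasFDerivAt.finsetProd fun i _ => (hd (σ i) i).hasFDerivAt
    have h2 : HasFDerivAt (fun v => ∑ σ : Equiv.Perm m, ((Equiv.Perm.sign σ : ℤ) : ℝ) *
        ∏ i, C v (σ i) i) _ u :=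
      HasFDerivAt.fun_sum fun σ _ => (h1 σ).const_mul ((Equiv.Perm.sign σ : ℤ) : ℝ)
    have h3 : (fun v => (C v).det) = fun v => ∑ σ : Equiv.Perm m,
        ((Equiv.Perm.sign σ : ℤ) : ℝ) * ∏ i, C v (σ i) i := by
      funext v; rw [Matrix.det_apply']
    have hC' : ∀ a b, C u a b = if a = b then 1 else 0 := fun a b => by rw [hC, Matrix.one_apply]
    rw [pderiv, h3, h2.fderiv]
    simp only [sum_apply, smul_apply, smul_eq_mul, hC']
    rw [Finset.sum_eq_single 1]
    · simp only [Equiv.Perm.sign_one, Equiv.Perm.one_apply, if_true,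
        Finset.prod_const_one, one_mul, Units.val_one, Int.cast_one]
      rfl
    · intro σ _ hσ
      rw [Finset.sum_eq_zero, mul_zero]
      intro i _
      obtain ⟨j, hji, hj⟩ : ∃ j, j ≠ i ∧ σ j ≠ j := by
        by_contra! hcon
        apply hσ
        ext j
        by_cases hji : j = i
        · subst hji
          by_contra hne
          have hj' : σ (σ j) = σ j := hcon _ hne
          exact hne (σ.injective hj')
        · exact hcon j hji
      rw [Finset.prod_eq_zero (i := j) (by simp [hji]) (if_neg hj), zero_mul]
    · simp
  have hC : ∀ i j, (fun v => ((A u)⁻¹ * A v) i j) = fun v => ∑ l, (A u)⁻¹ i l * A v l j := by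
    intro i j; funext v; rw [Matrix.mul_apply]
  have hCd : ∀ i j, DifferentiableAt ℝ (fun v => ((A u)⁻¹ * A v) i j) u := by
    intro i j
    rw [hC]
    exact DifferentiableAt.fun_sum fun l _ => (hA l j).const_mul _
  -- Reduction to the identity: `A(u)⁻¹ A(v)` equals `1` at `v = u`.
  have hdet : (fun v => (A v).det) = fun v => (A u).det * ((A u)⁻¹ * A v).det := by
    funext v
    rw [Matrix.det_mul, ← mul_assoc, ← Matrix.det_mul, Matrix.mul_nonsing_inv _ h0, Matrix.det_one,
      one_mul]
  have hdd : DifferentiableAt ℝ (fun v => ((A u)⁻¹ * A v).det) u := by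
    simp only [Matrix.det_apply']
    exact DifferentiableAt.fun_sum fun σ _ => (HasFDerivAt.finsetProd
      fun i _ => (hCd (σ i) i).hasFDerivAt).differentiableAt.const_mul _
  rw [hdet, pderiv_mul (differentiableAt_const _) hdd, pderiv_const, zero_mul, zero_add,
    hone _ (Matrix.nonsing_inv_mul _ h0) hCd, Matrix.trace]
  congr 1
  refine Finset.sum_congr rfl fun i _ => ?_
  rw [hC, pderiv_sum fun l _ => (hA l i).const_mul _, Matrix.diag_apply, Matrix.mul_apply]
  refine Finset.sum_congr rfl fun l _ => ?_
  rw [pderiv_mul (differentiableAt_const _) (hA l i), pderiv_const]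
  simp

end PartialDerivatives

end SpacelikeHypersurface

namespace SpacelikeHypersurface

/-! ### Parametrized space-like hypersurfaces: Weingarten formula and Laplacian of the position
vector. -/

section Patch

variable {n : ℕ}

/-- The matrix `⟨∂ᵢX, ∂ⱼX⟩` of a parametrized hypersurface. -/
noncomputable def patchMetric (X : EuclideanSpace ℝ (Fin n) → LorentzSpace n)
    (u : EuclideanSpace ℝ (Fin n)) : Matrix (Fin n) (Fin n) ℝ :=
  Matrix.of fun i j => lorentz (pderiv i X u) (pderiv j X u)

/-- The matrix `-⟨∂ᵢ∂ⱼX, N⟩` of the second fundamental form of a parametrized hypersurface. -/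
noncomputable def patchSecond (X N : EuclideanSpace ℝ (Fin n) → LorentzSpace n)
    (u : EuclideanSpace ℝ (Fin n)) : Matrix (Fin n) (Fin n) ℝ :=
  Matrix.of fun i j => -lorentz (pderiv i (pderiv j X) u) (N u)

/-- The components `g^{ij} ∂ⱼF` of the gradient on a parametrized hypersurface. -/
noncomputable def patchGrad (X : EuclideanSpace ℝ (Fin n) → LorentzSpace n)
    (F : EuclideanSpace ℝ (Fin n) → ℝ) (u : EuclideanSpace ℝ (Fin n)) : Fin n → ℝ :=
  (patchMetric X u)⁻¹ *ᵥ fun j => pderiv j F u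

/-- The density `√(det g)` of a parametrized hypersurface. -/
noncomputable def patchDensity (X : EuclideanSpace ℝ (Fin n) → LorentzSpace n)
    (u : EuclideanSpace ℝ (Fin n)) : ℝ :=
  Real.sqrt (patchMetric X u).det

/-- The Laplacian in divergence form of a parametrized hypersurface. -/
noncomputable def patchLaplacian (X : EuclideanSpace ℝ (Fin n) → LorentzSpace n)
    (F : EuclideanSpace ℝ (Fin n) → ℝ) (u : EuclideanSpace ℝ (Fin n)) : ℝ :=
  (patchDensity X u)⁻¹ * ∑ i, pderiv i (fun v => patchDensity X v * patchGrad X F v i) u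

/-- `X` is a smooth space-like parametrized hypersurface over `U` with unit normal `N`. -/
structure IsPatch (X N : EuclideanSpace ℝ (Fin n) → LorentzSpace n)
    (U : Set (EuclideanSpace ℝ (Fin n))) : Prop where
  isOpen : IsOpen U
  contDiffOn : ContDiffOn ℝ ∞ X U
  contDiffOn_normal : ContDiffOn ℝ ∞ N U
  pos : ∀ u ∈ U, ∀ v, v ≠ 0 → 0 < lorentz (fderiv ℝ X u v) (fderiv ℝ X u v)
  unit : ∀ u ∈ U, lorentz (N u) (N u) = -1
  orth : ∀ u ∈ U, ∀ v, lorentz (N u) (fderiv ℝ X u v) = 0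

namespace IsPatch

variable {X N : EuclideanSpace ℝ (Fin n) → LorentzSpace n}
  {U : Set (EuclideanSpace ℝ (Fin n))} {u : EuclideanSpace ℝ (Fin n)}

theorem patchMetric_isSymm : (patchMetric X u)ᵀ = patchMetric X u := by
  ext i j; simp [patchMetric, lorentz_comm]

variable (hP : IsPatch X N U)

include hP

theorem differentiableAt (hu : u ∈ U) : DifferentiableAt ℝ X u :=
  hP.contDiffOn.differentiableAt_of_isOpen hP.isOpen hu

theorem differentiableAt_normal (hu : u ∈ U) : DifferentiableAt ℝ N u :=
  hP.contDiffOn_normal.differentiableAt_of_isOpen hP.isOpen hu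

theorem differentiableAt_pderiv (hu : u ∈ U) (i : Fin n) : DifferentiableAt ℝ (pderiv i X) u :=
  (hP.contDiffOn.pderiv_of_isOpen hP.isOpen i).differentiableAt_of_isOpen hP.isOpen hu

theorem orth_pderiv (hu : u ∈ U) (i : Fin n) : lorentz (N u) (pderiv i X u) = 0 :=
  hP.orth u hu _

theorem posDef (hu : u ∈ U) : (patchMetric X u).PosDef := by
  refine Matrix.PosDef.of_dotProduct_mulVec_pos ?_ ?_
  · ext i j; simp [patchMetric, lorentz_comm]
  · intro v hv
    have := hP.pos u hu (WithLp.toLp 2 v) (by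
      intro h; apply hv; ext i; exact congrArg (fun w : EuclideanSpace ℝ (Fin n) => w i) h)
    rw [fderiv_eq_sum_pderiv] at this
    simp only [lorentz_sum_left, lorentz_sum_right, lorentz_smul_left, lorentz_smul_right,
      Finset.mul_sum] at this
    simp only [dotProduct, Matrix.mulVec, patchMetric, Finset.mul_sum, Matrix.of_apply, star_trivial]
    refine this.trans_eq (Finset.sum_congr rfl fun i _ => Finset.sum_congr rfl fun j _ => ?_)
    rw [lorentz_comm (pderiv j X u)]; ring

theorem det_pos (hu : u ∈ U) : 0 < (patchMetric X u).det := (hP.posDef hu).det_pos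

theorem isUnit_det (hu : u ∈ U) : IsUnit (patchMetric X u).det := (hP.det_pos hu).ne'.isUnit

theorem density_pos (hu : u ∈ U) : 0 < patchDensity X u := Real.sqrt_pos.2 (hP.det_pos hu)

/-- The vectors `∂ᵢX` and `N` form a basis, since a relation among the `∂ᵢX` would contradict
positivity of the metric. Vector identities are proved below by pairing with this basis. -/
theorem eq_zero_of_orthogonal (hu : u ∈ U) {w : LorentzSpace n} (hN : lorentz w (N u) = 0)
    (hX : ∀ i, lorentz w (pderiv i X u) = 0) : w = 0 := by
  have hli : LinearIndependent ℝ
      (Fin.snoc (fun i => pderiv i X u) (N u) : Fin (n + 1) → LorentzSpace n) := by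
    rw [Fintype.linearIndependent_iff]
    intro c hc
    rw [Fin.sum_univ_castSucc] at hc
    simp only [Fin.snoc_castSucc, Fin.snoc_last] at hc
    have hlast : c (Fin.last n) = 0 := by
      have := congrArg (fun v => lorentz (N u) v) hc
      simpa [lorentz_add_right, lorentz_sum_right, lorentz_smul_right, hP.orth_pderiv hu,
        hP.unit u hu] using this
    rw [hlast, zero_smul, add_zero] at hc
    have hz : (WithLp.toLp 2 fun i : Fin n => c i.castSucc : EuclideanSpace ℝ (Fin n)) = 0 := by
      by_contra hne
      have := hP.pos u hu _ hne
      rw [fderiv_eq_sum_pderiv] at this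
      simp only at this
      rw [hc] at this
      simp at this
    intro j
    induction j using Fin.lastCases with
    | last => exact hlast
    | cast i => exact congrArg (fun w : EuclideanSpace ℝ (Fin n) => w i) hz
  apply eq_zero_of_orthogonal_linearIndependent hli
  intro j
  induction j using Fin.lastCases with
  | last => simpa using hN
  | cast i => simpa using hX i

/-- The tangential part of `a`, in coordinates. -/
theorem tangent_projection (hu : u ∈ U) (a : LorentzSpace n) :
    ∑ j, ((patchMetric X u)⁻¹ *ᵥ fun k => lorentz (pderiv k X u) a) j • pderiv j X u
      = a + lorentz a (N u) • N u := by
  rw [← sub_eq_zero]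
  apply hP.eq_zero_of_orthogonal hu
  · simp only [lorentz_sub_left, lorentz_sum_left, lorentz_smul_left, lorentz_add_left,
      hP.unit u hu, lorentz_comm (pderiv _ X u) (N u), hP.orth_pderiv hu]
    simp
  · intro i
    simp only [lorentz_sub_left, lorentz_sum_left, lorentz_smul_left, lorentz_add_left,
      hP.orth_pderiv hu, mul_zero, add_zero]
    have h := congrFun (Matrix.mulVec_mulVec (fun k => lorentz (pderiv k X u) a)
      (patchMetric X u) (patchMetric X u)⁻¹) i
    rw [Matrix.mul_nonsing_inv _ (hP.isUnit_det hu), Matrix.one_mulVec] at h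
    rw [lorentz_comm a, ← h, sub_eq_zero]
    simp only [Matrix.mulVec, dotProduct, patchMetric, Matrix.of_apply]
    exact Finset.sum_congr rfl fun j _ => by rw [lorentz_comm (pderiv j X u), mul_comm]

theorem lorentz_pderiv_normal (hu : u ∈ U) (i : Fin n) : lorentz (pderiv i N u) (N u) = 0 := by
  have h : (fun v => lorentz (N v) (N v)) =ᶠ[𝓝 u] fun _ => (-1 : ℝ) := by
    filter_upwards [hP.isOpen.mem_nhds hu] with v hv using hP.unit v hv
  have h1 := pderiv_congr h i
  rw [pderiv_lorentz (hP.differentiableAt_normal hu) (hP.differentiableAt_normal hu),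
    pderiv_const, lorentz_comm (N u)] at h1
  linarith

/-- Differentiate `⟨N, ∂ⱼX⟩ = 0`; the sign in the definition of `h` makes `dN` equal to `+h`. -/
theorem lorentz_pderiv_normal_pderiv (hu : u ∈ U) (i j : Fin n) :
    lorentz (pderiv i N u) (pderiv j X u) = patchSecond X N u i j := by
  have h : (fun v => lorentz (N v) (pderiv j X v)) =ᶠ[𝓝 u] fun _ => (0 : ℝ) := by
    filter_upwards [hP.isOpen.mem_nhds hu] with v hv using hP.orth_pderiv hv j
  have h1 := pderiv_congr h i
  rw [pderiv_lorentz (hP.differentiableAt_normal hu) (hP.differentiableAt_pderiv hu j),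
    pderiv_const] at h1
  simp only [patchSecond, Matrix.of_apply]
  rw [lorentz_comm _ (N u)]
  linarith

theorem patchSecond_symm (hu : u ∈ U) (i j : Fin n) :
    patchSecond X N u i j = patchSecond X N u j i := by
  simp only [patchSecond, Matrix.of_apply]
  rw [pderiv_comm (hP.contDiffOn.contDiffAt (hP.isOpen.mem_nhds hu))]

/-- The Weingarten formula. -/
theorem weingarten (hu : u ∈ U) (i : Fin n) :
    pderiv i N u = ∑ k, ((patchMetric X u)⁻¹ * patchSecond X N u) k i • pderiv k X u := by
  have h := hP.tangent_projection hu (pderiv i N u)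
  rw [hP.lorentz_pderiv_normal hu, zero_smul, add_zero] at h
  rw [← h]
  refine Finset.sum_congr rfl fun k _ => ?_
  congr 1
  simp only [Matrix.mulVec, dotProduct, Matrix.mul_apply]
  refine Finset.sum_congr rfl fun j _ => ?_
  rw [lorentz_comm, hP.lorentz_pderiv_normal_pderiv hu, hP.patchSecond_symm hu]

theorem contDiffOn_metric (i j : Fin n) : ContDiffOn ℝ ∞ (fun v => patchMetric X v i j) U :=
  (hP.contDiffOn.pderiv_of_isOpen hP.isOpen i).lorentz
    (hP.contDiffOn.pderiv_of_isOpen hP.isOpen j)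

theorem contDiffOn_density : ContDiffOn ℝ ∞ (patchDensity X) U :=
  (contDiffOn_det fun i j => hP.contDiffOn_metric i j).sqrt fun _ hv => (hP.det_pos hv).ne'

theorem contDiffOn_inv (i j : Fin n) : ContDiffOn ℝ ∞ (fun v => (patchMetric X v)⁻¹ i j) U := by
  -- Cramer's rule writes the entries of the inverse as quotients of determinants, which are smooth.
  have h : (fun v => (patchMetric X v)⁻¹ i j) = fun v => ((patchMetric X v).det)⁻¹ *
      ((patchMetric X v).updateRow j (Pi.single i 1)).det := by
    funext v
    rw [Matrix.inv_def, Matrix.smul_apply, Matrix.adjugate_apply, Ring.inverse_eq_inv', smul_eq_mul]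
  rw [h]
  refine ContDiffOn.mul ((contDiffOn_det fun i j => hP.contDiffOn_metric i j).inv
    fun v hv => (hP.det_pos hv).ne') (contDiffOn_det fun k l => ?_)
  by_cases hk : k = j
  · subst hk; simp only [Matrix.updateRow_self]; exact contDiffOn_const
  · simp only [Matrix.updateRow_ne hk]; exact hP.contDiffOn_metric k l

theorem contDiffOn_densityInv (i j : Fin n) :
    ContDiffOn ℝ ∞ (fun v => patchDensity X v * (patchMetric X v)⁻¹ i j) U :=
  hP.contDiffOn_density.mul (hP.contDiffOn_inv i j)

/-- Jacobi's formula for `√(det g)`. The two terms of `∂ₖgᵢⱼ` have the same trace against `g⁻¹` by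
symmetry, and this factor `2` cancels the `1/2` of the square root. -/
theorem pderiv_density (hu : u ∈ U) (k : Fin n) :
    pderiv k (patchDensity X) u = patchDensity X u *
      ∑ i, ∑ j, (patchMetric X u)⁻¹ i j * lorentz (pderiv j X u) (pderiv k (pderiv i X) u) := by
  have hd : ∀ i j, DifferentiableAt ℝ (fun v => patchMetric X v i j) u := fun i j =>
    (hP.contDiffOn_metric i j).differentiableAt_of_isOpen hP.isOpen hu
  have hdet : DifferentiableAt ℝ (fun v => (patchMetric X v).det) u :=
    (contDiffOn_det fun i j => hP.contDiffOn_metric i j).differentiableAt_of_isOpen hP.isOpen hu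
  have hs := (hdet.hasFDerivAt.sqrt (hP.det_pos hu).ne')
  have h1 : pderiv k (patchDensity X) u
      = (1 / (2 * patchDensity X u)) * pderiv k (fun v => (patchMetric X v).det) u := by
    have hs' : HasFDerivAt (patchDensity X) _ u := hs
    rw [pderiv, hs'.fderiv]; rfl
  rw [h1, pderiv_det hd (hP.isUnit_det hu)]
  have hsq : (patchMetric X u).det = patchDensity X u * patchDensity X u :=
    (Real.mul_self_sqrt (hP.det_pos hu).le).symm
  have hpos := hP.density_pos hu
  have htr : ((patchMetric X u)⁻¹ *
      Matrix.of fun i j => pderiv k (fun v => patchMetric X v i j) u).trace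
      = 2 * ∑ i, ∑ j, (patchMetric X u)⁻¹ i j *
          lorentz (pderiv j X u) (pderiv k (pderiv i X) u) := by
    have hm : ∀ i j, pderiv k (fun v => patchMetric X v i j) u
        = lorentz (pderiv j X u) (pderiv k (pderiv i X) u)
          + lorentz (pderiv i X u) (pderiv k (pderiv j X) u) := by
      intro i j
      have : (fun v => patchMetric X v i j) = fun v => lorentz (pderiv i X v) (pderiv j X v) := rfl
      rw [this, pderiv_lorentz (hP.differentiableAt_pderiv hu i)
        (hP.differentiableAt_pderiv hu j), lorentz_comm (pderiv k _ u)]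
    have hsymm : ∀ i j, (patchMetric X u)⁻¹ i j = (patchMetric X u)⁻¹ j i := fun i j => by
      conv_rhs => rw [← patchMetric_isSymm, ← Matrix.transpose_nonsing_inv, Matrix.transpose_apply]
    simp only [Matrix.trace, Matrix.diag_apply, Matrix.mul_apply, Matrix.of_apply, hm, mul_add,
      Finset.sum_add_distrib, two_mul]
    congr 1
    rw [Finset.sum_comm]
    exact Finset.sum_congr rfl fun i _ => Finset.sum_congr rfl fun j _ => by rw [hsymm]
  rw [htr, hsq]
  field_simp

/-- The Laplacian of the position vector is `H N`. -/
theorem laplacian_position (hu : u ∈ U) :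
    ∑ i, pderiv i (fun v => ∑ j, (patchDensity X v * (patchMetric X v)⁻¹ i j) • pderiv j X v) u
      = (patchDensity X u * ((patchMetric X u)⁻¹ * patchSecond X N u).trace) • N u := by
  have hsymm : ∀ v i j, (patchMetric X v)⁻¹ i j = (patchMetric X v)⁻¹ j i := fun v i j => by
    conv_rhs => rw [← patchMetric_isSymm, ← Matrix.transpose_nonsing_inv, Matrix.transpose_apply]
  -- `V i = √g g^{ij} ∂ⱼX` is tangent, and `⟨V i, ∂ₖX⟩ = √g δᵢₖ`. Differentiating these relations
  -- determines the divergence of `V` without Christoffel symbols: pairing with `N` gives the trace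
  -- of `h`, and pairing with `∂ₖX` gives `∂ₖ√g` minus the same quantity.
  let V : Fin n → EuclideanSpace ℝ (Fin n) → LorentzSpace n := fun i v =>
    ∑ j, (patchDensity X v * (patchMetric X v)⁻¹ i j) • pderiv j X v
  have hV : ∀ i v, V i v = ∑ j, (patchDensity X v * (patchMetric X v)⁻¹ i j) • pderiv j X v :=
    fun _ _ => rfl
  change ∑ i, pderiv i (V i) u = _
  have hVd : ∀ i, DifferentiableAt ℝ (V i) u := fun i => DifferentiableAt.fun_sum fun j _ =>
    ((hP.contDiffOn_densityInv i j).differentiableAt_of_isOpen hP.isOpen hu).smul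
      (hP.differentiableAt_pderiv hu j)
  have hVN : ∀ i, ∀ v ∈ U, lorentz (V i v) (N v) = 0 := by
    intro i v hv
    simp only [hV, lorentz_sum_left, lorentz_smul_left, lorentz_comm (pderiv _ X v),
      hP.orth_pderiv hv, mul_zero, Finset.sum_const_zero]
  have hVX : ∀ i k, ∀ v ∈ U, lorentz (V i v) (pderiv k X v)
      = if i = k then patchDensity X v else 0 := by
    intro i k v hv
    have h := congrFun (congrFun (Matrix.nonsing_inv_mul _ (hP.isUnit_det hv)) i) k
    rw [Matrix.mul_apply, Matrix.one_apply] at h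
    simp only [hV, lorentz_sum_left, lorentz_smul_left, mul_assoc, ← Finset.mul_sum]
    simp only [patchMetric, Matrix.of_apply] at h ⊢
    rw [h]; split_ifs <;> simp
  rw [← sub_eq_zero]
  apply hP.eq_zero_of_orthogonal hu
  · have h1 : ∀ i, lorentz (pderiv i (V i) u) (N u) = -lorentz (V i u) (pderiv i N u) := by
      intro i
      have h : (fun v => lorentz (V i v) (N v)) =ᶠ[𝓝 u] fun _ => (0 : ℝ) := by
        filter_upwards [hP.isOpen.mem_nhds hu] with v hv using hVN i v hv
      have h2 := pderiv_congr h i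
      rw [pderiv_lorentz (hVd i) (hP.differentiableAt_normal hu), pderiv_const] at h2
      linarith
    rw [lorentz_sub_left, lorentz_sum_left, lorentz_smul_left, hP.unit u hu]
    simp only [h1]
    simp only [hV, lorentz_sum_left, lorentz_smul_left, lorentz_comm (pderiv _ X u),
      hP.lorentz_pderiv_normal_pderiv hu]
    simp only [Matrix.trace, Matrix.diag_apply, Matrix.mul_apply, Finset.mul_sum,
      Finset.sum_neg_distrib, Finset.sum_mul]
    rw [sub_eq_zero, ← Finset.sum_neg_distrib]
    refine Finset.sum_congr rfl fun i _ => ?_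
    rw [← Finset.sum_neg_distrib]
    refine Finset.sum_congr rfl fun j _ => ?_
    rw [hP.patchSecond_symm hu i j]; ring
  · intro k
    have h1 : ∀ i, lorentz (pderiv i (V i) u) (pderiv k X u)
        = (if i = k then pderiv k (patchDensity X) u else 0)
          - lorentz (V i u) (pderiv i (pderiv k X) u) := by
      intro i
      have h : (fun v => lorentz (V i v) (pderiv k X v))
          =ᶠ[𝓝 u] fun v => if i = k then patchDensity X v else 0 := by
        filter_upwards [hP.isOpen.mem_nhds hu] with v hv using hVX i k v hv
      have h2 := pderiv_congr h i
      rw [pderiv_lorentz (hVd i) (hP.differentiableAt_pderiv hu k)] at h2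
      have h3 : pderiv i (fun v => if i = k then patchDensity X v else 0) u
          = if i = k then pderiv k (patchDensity X) u else 0 := by
        split_ifs with hik
        · subst hik; rfl
        · exact pderiv_const _ _
      linarith
    rw [lorentz_sub_left, lorentz_sum_left, lorentz_smul_left, hP.orth_pderiv hu, mul_zero, sub_zero]
    simp only [h1, Finset.sum_sub_distrib]
    rw [Finset.sum_ite_eq' Finset.univ k, if_pos (Finset.mem_univ _), hP.pderiv_density hu,
      sub_eq_zero, Finset.mul_sum]
    refine Finset.sum_congr rfl fun i _ => ?_
    simp only [hV, lorentz_sum_left, lorentz_smul_left, Finset.mul_sum]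
    refine Finset.sum_congr rfl fun j _ => ?_
    rw [pderiv_comm (hP.contDiffOn.contDiffAt (hP.isOpen.mem_nhds hu)), mul_assoc]

end IsPatch

end Patch

end SpacelikeHypersurface

namespace SpacelikeHypersurface

/-! ### From an arbitrary parametrization to the space-like coordinates of a Lorentz frame. -/

section PatchFrame

variable {n : ℕ} (e : LorentzFrame n)

theorem pderiv_comp_proj {X : EuclideanSpace ℝ (Fin n) → LorentzSpace n}
    {G : EuclideanSpace ℝ (Fin n) → ℝ} {u : EuclideanSpace ℝ (Fin n)}
    (hX : DifferentiableAt ℝ X u) (hG : DifferentiableAt ℝ G (e.proj (X u))) (j : Fin n) :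
    pderiv j (fun v => G (e.proj (X v))) u
      = ∑ m, pderiv m G (e.proj (X u)) * lorentz (pderiv j X u) (e.vec m) := by
  have h : HasFDerivAt (fun v => G (e.proj (X v))) _ u :=
    hG.hasFDerivAt.comp u (e.proj.hasFDerivAt.comp u hX.hasFDerivAt)
  rw [pderiv, h.fderiv]
  simp only [ContinuousLinearMap.comp_apply]
  rw [fderiv_eq_sum_pderiv]
  exact Finset.sum_congr rfl fun m _ => by rw [smul_eq_mul, mul_comm]; rfl

namespace IsPatch

variable {X N : EuclideanSpace ℝ (Fin n) → LorentzSpace n}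
  {U : Set (EuclideanSpace ℝ (Fin n))} {u : EuclideanSpace ℝ (Fin n)}
  (hP : IsPatch X N U) {F G : EuclideanSpace ℝ (Fin n) → ℝ} (hG : ContDiff ℝ ∞ G)
  (hF : ∀ v ∈ U, F v = G (e.proj (X v)))

include hP

section Functions

include hG hF

theorem pderiv_eq_of_comp_proj (hu : u ∈ U) (j : Fin n) :
    pderiv j F u = ∑ m, pderiv m G (e.proj (X u)) * lorentz (pderiv j X u) (e.vec m) := by
  rw [← pderiv_comp_proj e (hP.differentiableAt hu) (hG.differentiable (by simp) _)]
  exact pderiv_congr (by filter_upwards [hP.isOpen.mem_nhds hu] with v hv using hF v hv) j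

theorem patchGrad_eq (hu : u ∈ U) (i : Fin n) :
    patchGrad X F u i = ∑ m, pderiv m G (e.proj (X u)) *
      ((patchMetric X u)⁻¹ *ᵥ fun k => lorentz (pderiv k X u) (e.vec m)) i := by
  simp only [patchGrad, Matrix.mulVec, dotProduct, hP.pderiv_eq_of_comp_proj e hG hF hu,
    Finset.mul_sum]
  rw [Finset.sum_comm]
  exact Finset.sum_congr rfl fun m _ => Finset.sum_congr rfl fun j _ => by ring

/-- Chain rule: the gradient of the coordinate `⟨x, eₘ⟩` is the tangential part of `eₘ`. -/
theorem gradient_eq (hu : u ∈ U) :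
    ∑ i, patchGrad X F u i • pderiv i X u = ∑ m, pderiv m G (e.proj (X u)) •
      (e.vec m + lorentz (N u) (e.vec m) • N u) := by
  simp only [hP.patchGrad_eq e hG hF hu, Finset.sum_smul, mul_smul]
  rw [Finset.sum_comm]
  refine Finset.sum_congr rfl fun m _ => ?_
  rw [← Finset.smul_sum, hP.tangent_projection hu, lorentz_comm (e.vec m)]

/-- Chain rule for `F = G ∘ z`, where `zₘ = ⟨x, eₘ⟩`, with `⟨∇zₗ, ∇zₘ⟩ = δₗₘ + νₗνₘ` and `Δzₘ =
Hνₘ`. Apart from `H`, which is treated separately, the right side no longer depends on the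
parametrization. -/
theorem laplacian_eq (hu : u ∈ U) :
    patchLaplacian X F u
      = ∑ m, ∑ l, ((if l = m then 1 else 0) + lorentz (N u) (e.vec l) * lorentz (N u) (e.vec m)) *
            pderiv l (pderiv m G) (e.proj (X u))
        + ((patchMetric X u)⁻¹ * patchSecond X N u).trace *
          ∑ m, lorentz (N u) (e.vec m) * pderiv m G (e.proj (X u)) := by
  let V : Fin n → EuclideanSpace ℝ (Fin n) → LorentzSpace n := fun i v =>
    ∑ j, (patchDensity X v * (patchMetric X v)⁻¹ i j) • pderiv j X v
  have hV : ∀ i v, V i v = ∑ j, (patchDensity X v * (patchMetric X v)⁻¹ i j) • pderiv j X v :=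
    fun _ _ => rfl
  have hlap : ∑ i, pderiv i (V i) u = _ := hP.laplacian_position hu
  have hVd : ∀ i, DifferentiableAt ℝ (V i) u := fun i => DifferentiableAt.fun_sum fun j _ =>
    ((hP.contDiffOn_densityInv i j).differentiableAt_of_isOpen hP.isOpen hu).smul
      (hP.differentiableAt_pderiv hu j)
  have hW : ∀ i, ∀ v ∈ U, patchDensity X v * patchGrad X F v i
      = ∑ m, pderiv m G (e.proj (X v)) * lorentz (V i v) (e.vec m) := by
    intro i v hv
    rw [hP.patchGrad_eq e hG hF hv, Finset.mul_sum]
    refine Finset.sum_congr rfl fun m _ => ?_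
    simp only [hV, lorentz_sum_left, lorentz_smul_left, Matrix.mulVec, dotProduct, Finset.mul_sum]
    exact Finset.sum_congr rfl fun j _ => by ring
  have hGm : ∀ m, ContDiff ℝ ∞ (pderiv m G) := fun m => hG.pderiv m
  have hc1 : ∀ m, DifferentiableAt ℝ (fun v => pderiv m G (e.proj (X v))) u := fun m =>
    DifferentiableAt.comp u ((hGm m).differentiable (by simp) _)
      (e.proj.differentiableAt.comp u (hP.differentiableAt hu))
  have hc2 : ∀ i m, DifferentiableAt ℝ (fun v => lorentz (V i v) (e.vec m)) u := fun i m =>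
    ((lorentzForm n).differentiableAt.comp u (hVd i)).clm_apply (differentiableAt_const _)
  have hterm : ∀ i, pderiv i (fun v => patchDensity X v * patchGrad X F v i) u
      = ∑ m, (∑ l, pderiv l (pderiv m G) (e.proj (X u)) * lorentz (pderiv i X u) (e.vec l)) *
            lorentz (V i u) (e.vec m)
        + ∑ m, pderiv m G (e.proj (X u)) * lorentz (pderiv i (V i) u) (e.vec m) := by
    intro i
    rw [pderiv_congr (by filter_upwards [hP.isOpen.mem_nhds hu] with v hv using hW i v hv) i,
      pderiv_sum fun m _ => (hc1 m).fun_mul (hc2 i m), ← Finset.sum_add_distrib]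
    refine Finset.sum_congr rfl fun m _ => ?_
    rw [pderiv_mul (hc1 m) (hc2 i m), pderiv_lorentz (hVd i) (differentiableAt_const _),
      pderiv_const, lorentz_zero_right, add_zero,
      pderiv_comp_proj e (hP.differentiableAt hu) ((hGm m).differentiable (by simp) _)]
  have hproj : ∀ l m, ∑ i, lorentz (pderiv i X u) (e.vec l) * lorentz (V i u) (e.vec m)
      = patchDensity X u * ((if l = m then 1 else 0)
        + lorentz (N u) (e.vec l) * lorentz (N u) (e.vec m)) := by
    intro l m
    have h := congrArg (fun w => lorentz w (e.vec l)) (hP.tangent_projection hu (e.vec m))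
    simp only [lorentz_sum_left, lorentz_smul_left, lorentz_add_left, e.vec_vec] at h
    rw [lorentz_comm (e.vec m) (N u), mul_comm (lorentz (N u) (e.vec m))] at h
    simp only [eq_comm (a := m) (b := l)] at h
    rw [← h, Finset.mul_sum]
    refine Finset.sum_congr rfl fun i _ => ?_
    simp only [hV, lorentz_sum_left, lorentz_smul_left, Matrix.mulVec, dotProduct, Finset.mul_sum,
      Finset.sum_mul]
    exact Finset.sum_congr rfl fun j _ => by ring
  have hpos := hP.density_pos hu
  rw [patchLaplacian, inv_mul_eq_iff_eq_mul₀ hpos.ne']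
  simp only [hterm, Finset.sum_add_distrib]
  rw [mul_add]
  congr 1
  · simp only [Finset.sum_mul]
    rw [Finset.sum_comm, Finset.mul_sum]
    refine Finset.sum_congr rfl fun m _ => ?_
    rw [Finset.sum_comm, Finset.mul_sum]
    refine Finset.sum_congr rfl fun l _ => ?_
    rw [← mul_assoc, ← hproj, Finset.sum_mul]
    exact Finset.sum_congr rfl fun i _ => by ring
  · rw [Finset.sum_comm]
    simp only [← Finset.mul_sum, ← lorentz_sum_left, hlap, lorentz_smul_left]
    simp only [Finset.mul_sum]
    exact Finset.sum_congr rfl fun m _ => by ring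

end Functions

section ShapeOperator

variable {N' : EuclideanSpace ℝ (Fin n) → LorentzSpace n} (hN' : ContDiff ℝ ∞ N')
  (hNN' : ∀ v ∈ U, N v = N' (e.proj (X v)))

include hN' hNN'

/-- The matrix `(⟨∂ⱼX, eₖ⟩)` is the Jacobian of the change to graph coordinates. It is invertible
because a space-like vector has nonzero projection. Projecting the Weingarten formula `dN = dX ∘ A`
shows that it conjugates the shape operator `A` to the derivative of the components `νₖ` of `N`. -/
theorem jacobian_conj (hu : u ∈ U) :
    IsUnit (Matrix.of fun k j => lorentz (pderiv j X u) (e.vec k)).det ∧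
    (Matrix.of fun k l => pderiv l (fun y => lorentz (N' y) (e.vec k)) (e.proj (X u))) *
        (Matrix.of fun k j => lorentz (pderiv j X u) (e.vec k))
      = (Matrix.of fun k j => lorentz (pderiv j X u) (e.vec k)) *
        ((patchMetric X u)⁻¹ * patchSecond X N u) := by
  constructor
  · rw [isUnit_iff_ne_zero]
    intro h0
    obtain ⟨v, hv, hv0⟩ := Matrix.exists_mulVec_eq_zero_iff.2 h0
    have hv' : (WithLp.toLp 2 v : EuclideanSpace ℝ (Fin n)) ≠ 0 := by
      intro h; apply hv; ext i; exact congrArg (fun w : EuclideanSpace ℝ (Fin n) => w i) h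
    have hpos := hP.pos u hu _ hv'
    have hn := e.norm_proj_sq (fderiv ℝ X u (WithLp.toLp 2 v))
    have hz : e.proj (fderiv ℝ X u (WithLp.toLp 2 v)) = 0 := by
      ext k
      have := congrFun hv0 k
      rw [LorentzFrame.proj_apply, fderiv_eq_sum_pderiv, lorentz_sum_left]
      simp only [Matrix.mulVec, dotProduct, Matrix.of_apply, Pi.zero_apply] at this
      simp only [lorentz_smul_left, PiLp.zero_apply]
      rw [← this]
      exact Finset.sum_congr rfl fun j _ => mul_comm _ _
    rw [hz] at hn
    simp only [norm_zero, ne_eq, OfNat.ofNat_ne_zero, not_false_eq_true, zero_pow] at hn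
    nlinarith [sq_nonneg (lorentz (fderiv ℝ X u (WithLp.toLp 2 v)) e.time)]
  · ext k j
    have hν : ContDiff ℝ ∞ (fun y => lorentz (N' y) (e.vec k)) := hN'.lorentz contDiff_const
    have h1 := hP.pderiv_eq_of_comp_proj e (F := fun v => lorentz (N v) (e.vec k)) hν
      (fun v hv => by rw [hNN' v hv]) hu j
    rw [pderiv_lorentz (hP.differentiableAt_normal hu) (differentiableAt_const _), pderiv_const,
      lorentz_zero_right, add_zero, hP.weingarten hu, lorentz_sum_left] at h1
    simp only [Matrix.mul_apply, Matrix.of_apply] at h1 ⊢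
    rw [← h1]
    refine Finset.sum_congr rfl fun m _ => ?_
    rw [lorentz_smul_left, mul_comm]

/-- Traces are invariant under the conjugation in `jacobian_conj`; the next lemma does the same for
the square. -/
theorem trace_shape (hu : u ∈ U) :
    ((patchMetric X u)⁻¹ * patchSecond X N u).trace
      = ∑ k, pderiv k (fun y => lorentz (N' y) (e.vec k)) (e.proj (X u)) := by
  obtain ⟨hJ, hc⟩ := hP.jacobian_conj e hN' hNN' hu
  set J := Matrix.of fun k j => lorentz (pderiv j X u) (e.vec k)
  set D := Matrix.of fun k l => pderiv l (fun y => lorentz (N' y) (e.vec k)) (e.proj (X u))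
  have h : D = J * ((patchMetric X u)⁻¹ * patchSecond X N u) * J⁻¹ := by
    rw [← hc, mul_assoc, Matrix.mul_nonsing_inv _ hJ, mul_one]
  have : D.trace = ((patchMetric X u)⁻¹ * patchSecond X N u).trace := by
    rw [h, Matrix.trace_mul_comm, ← mul_assoc, Matrix.nonsing_inv_mul _ hJ, one_mul]
  rw [← this]; rfl

theorem trace_shape_sq (hu : u ∈ U) :
    ((patchMetric X u)⁻¹ * patchSecond X N u * (patchMetric X u)⁻¹ * patchSecond X N u).trace
      = ∑ i, ∑ k, pderiv i (fun y => lorentz (N' y) (e.vec k)) (e.proj (X u)) *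
          pderiv k (fun y => lorentz (N' y) (e.vec i)) (e.proj (X u)) := by
  obtain ⟨hJ, hc⟩ := hP.jacobian_conj e hN' hNN' hu
  set J := Matrix.of fun k j => lorentz (pderiv j X u) (e.vec k)
  set D := Matrix.of fun k l => pderiv l (fun y => lorentz (N' y) (e.vec k)) (e.proj (X u)) with hD
  set A := (patchMetric X u)⁻¹ * patchSecond X N u with hA
  have h : D = J * A * J⁻¹ := by
    rw [← hc, mul_assoc, Matrix.mul_nonsing_inv _ hJ, mul_one]
  have h2 : (D * D).trace = (A * A).trace := by
    have : D * D = J * (A * A) * J⁻¹ := by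
      rw [h]
      calc J * A * J⁻¹ * (J * A * J⁻¹) = J * A * (J⁻¹ * J) * A * J⁻¹ := by simp only [mul_assoc]
        _ = _ := by rw [Matrix.nonsing_inv_mul _ hJ]; simp only [mul_assoc, mul_one]
    rw [this, Matrix.trace_mul_comm, ← mul_assoc, Matrix.nonsing_inv_mul _ hJ, one_mul]
  rw [mul_assoc A, ← hA, ← h2, Matrix.trace]
  simp only [Matrix.diag_apply, Matrix.mul_apply, hD, Matrix.of_apply]
  exact Finset.sum_congr rfl fun i _ => Finset.sum_congr rfl fun k _ => mul_comm _ _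

theorem patchSecond_eq_smul (hu : u ∈ U) {κ : ℝ}
    (hκ : ∀ k l, pderiv l (fun y => lorentz (N' y) (e.vec k)) (e.proj (X u))
      = if k = l then κ else 0) :
    patchSecond X N u = κ • patchMetric X u := by
  obtain ⟨hJ, hc⟩ := hP.jacobian_conj e hN' hNN' hu
  set J := Matrix.of fun k j => lorentz (pderiv j X u) (e.vec k)
  have hD : (Matrix.of fun k l => pderiv l (fun y => lorentz (N' y) (e.vec k)) (e.proj (X u)))
      = κ • (1 : Matrix (Fin n) (Fin n) ℝ) := by
    ext k l; simp [hκ, Matrix.one_apply]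
  rw [hD] at hc
  have h1 : (patchMetric X u)⁻¹ * patchSecond X N u = κ • 1 := by
    have := congrArg (fun A => J⁻¹ * A) hc
    simp only [← mul_assoc, Matrix.nonsing_inv_mul _ hJ, one_mul, Matrix.smul_mul,
      Matrix.mul_smul] at this
    exact this.symm
  have h2 := congrArg (fun A => patchMetric X u * A) h1
  simpa [← mul_assoc, Matrix.mul_nonsing_inv _ (hP.isUnit_det hu)] using h2

end ShapeOperator

end IsPatch

end PatchFrame

end SpacelikeHypersurface

namespace SpacelikeHypersurface

/-! ### Manifold charts as parametrizations; the projection as a local diffeomorphism. -/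

section Charts

variable {n : ℕ} {M : Type*} [TopologicalSpace M] [ChartedSpace (EuclideanSpace ℝ (Fin n)) M]
  [IsManifold (𝓡 n) ∞ M] {x N : M → LorentzSpace n}

theorem contDiffOn_inChart {F : Type*} [NormedAddCommGroup F] [NormedSpace ℝ F] {f : M → F}
    (hf : ContMDiff (𝓡 n) 𝓘(ℝ, F) ∞ f) (c : M) :
    ContDiffOn ℝ ∞ (inChart c f) (extChartAt (𝓡 n) c).target := by
  rw [← contMDiffOn_iff_contDiffOn]
  exact hf.comp_contMDiffOn (contMDiffOn_extChartAt_symm c)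

theorem fderiv_inChart {F : Type*} [NormedAddCommGroup F] [NormedSpace ℝ F] {f : M → F}
    (hf : ContMDiff (𝓡 n) 𝓘(ℝ, F) ∞ f) (c : M) {u : EuclideanSpace ℝ (Fin n)}
    (hu : u ∈ (extChartAt (𝓡 n) c).target) :
    fderiv ℝ (inChart c f) u = (mfderiv (𝓡 n) 𝓘(ℝ, F) f ((extChartAt (𝓡 n) c).symm u)).comp
      (mfderiv 𝓘(ℝ, EuclideanSpace ℝ (Fin n)) (𝓡 n) (extChartAt (𝓡 n) c).symm u) := by
  rw [← mfderiv_eq_fderiv]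
  refine mfderiv_comp u (hf.mdifferentiableAt (by simp)) ?_
  exact ((contMDiffOn_extChartAt_symm c).contMDiffAt
    ((isOpen_extChartAt_target c).mem_nhds hu)).mdifferentiableAt (n := ∞) (by simp)

theorem mfderiv_extChartAt_symm_injective (c : M) {u : EuclideanSpace ℝ (Fin n)}
    (hu : u ∈ (extChartAt (𝓡 n) c).target) :
    Function.Injective
      (mfderiv 𝓘(ℝ, EuclideanSpace ℝ (Fin n)) (𝓡 n) (extChartAt (𝓡 n) c).symm u) := by
  have h := mfderiv_extChartAt_comp_mfderivWithin_extChartAt_symm (I := 𝓡 n) hu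
  simp only [modelWithCornersSelf_coe, Set.range_id, mfderivWithin_univ] at h
  intro v w hvw
  have h' := fun v => congrArg (fun A => A v) h
  simp only [ContinuousLinearMap.comp_apply] at h'
  rw [← ContinuousLinearMap.id_apply (R₁ := ℝ) v, ← ContinuousLinearMap.id_apply (R₁ := ℝ) w]
  exact (h' v).symm.trans ((congrArg _ hvw).trans (h' w))

theorem lorentz_fderiv_inChart_pos (hx : IsSpacelikeImmersion x) (c : M)
    {u : EuclideanSpace ℝ (Fin n)} (hu : u ∈ (extChartAt (𝓡 n) c).target)
    {v : EuclideanSpace ℝ (Fin n)} (hv : v ≠ 0) :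
    0 < lorentz (fderiv ℝ (inChart c x) u v) (fderiv ℝ (inChart c x) u v) := by
  rw [fderiv_inChart hx.1 c hu]
  refine hx.2 _ _ fun h => hv (mfderiv_extChartAt_symm_injective c hu ?_)
  exact h.trans (map_zero _).symm

theorem isPatch_inChart (hx : IsSpacelikeImmersion x) (hN : IsUnitNormal x N) (c : M) :
    IsPatch (inChart c x) (inChart c N) (extChartAt (𝓡 n) c).target where
  isOpen := isOpen_extChartAt_target c
  contDiffOn := contDiffOn_inChart hx.1 c
  contDiffOn_normal := contDiffOn_inChart hN.1 c
  pos u hu v hv := lorentz_fderiv_inChart_pos hx c hu hv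
  unit u hu := (hN.2 _).1
  orth u hu v := by
    rw [fderiv_inChart hx.1 c hu]
    exact (hN.2 _).2 _

variable (e : LorentzFrame n)

/-- The differential of the projection is injective on space-like vectors, hence bijective by
equality of dimensions; the inverse function theorem applies. -/
theorem isLocalDiffeomorph_proj (hx : IsSpacelikeImmersion x) :
    IsLocalDiffeomorph (𝓡 n) 𝓘(ℝ, EuclideanSpace ℝ (Fin n)) ∞ fun p => e.proj (x p) := by
  intro p
  set φ := chartAt (EuclideanSpace ℝ (Fin n)) p with hφ
  set U := (extChartAt (𝓡 n) p).target with hU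
  have hUt : U = φ.target := by simp [hU, hφ]
  set θ : EuclideanSpace ℝ (Fin n) → EuclideanSpace ℝ (Fin n) := fun u => e.proj (inChart p x u)
    with hθ
  have hθs : ContDiffOn ℝ ∞ θ U := e.proj.contDiff.comp_contDiffOn (contDiffOn_inChart hx.1 p)
  have hUo : IsOpen U := isOpen_extChartAt_target p
  have hder : ∀ u ∈ U, ∃ A : EuclideanSpace ℝ (Fin n) ≃L[ℝ] EuclideanSpace ℝ (Fin n),
      HasFDerivAt θ (A : EuclideanSpace ℝ (Fin n) →L[ℝ] EuclideanSpace ℝ (Fin n)) u := by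
    intro u hu
    have hX : DifferentiableAt ℝ (inChart p x) u :=
      (contDiffOn_inChart hx.1 p).differentiableAt_of_isOpen hUo hu
    have hd : HasFDerivAt θ (e.proj.comp (fderiv ℝ (inChart p x) u)) u :=
      e.proj.hasFDerivAt.comp u hX.hasFDerivAt
    have hinj : Function.Injective (e.proj.comp (fderiv ℝ (inChart p x) u)) := by
      rw [injective_iff_map_eq_zero]
      intro v hv
      by_contra hne
      have hpos := lorentz_fderiv_inChart_pos hx p hu hne
      have hn := e.norm_proj_sq (fderiv ℝ (inChart p x) u v)
      rw [ContinuousLinearMap.comp_apply] at hv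
      rw [hv] at hn
      simp only [norm_zero, ne_eq, OfNat.ofNat_ne_zero, not_false_eq_true, zero_pow] at hn
      nlinarith [sq_nonneg (lorentz (fderiv ℝ (inChart p x) u v) e.time)]
    refine ⟨(LinearEquiv.ofInjectiveEndo _ hinj).toContinuousLinearEquiv, ?_⟩
    convert hd using 1
    ext v : 1
    rfl
  have hp : φ p ∈ U := by rw [hUt]; exact mem_chart_target _ p
  obtain ⟨A, hA⟩ := hder _ hp
  have hcd : ContDiffAt ℝ ∞ θ (φ p) := hθs.contDiffAt (hUo.mem_nhds hp)
  -- The local inverse is cut down to `U`, where the derivative of `θ` is invertible at every point,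
  -- so that the inverse is smooth on its whole target and not only at one point.
  set Θ := (hcd.toOpenPartialHomeomorph θ hA (by simp)).restrOpen U hUo with hΘ
  have hΘc : ∀ u, Θ u = θ u := fun u => rfl
  have hΘs : Θ.source ⊆ U := by simp [hΘ]
  refine ⟨{ toPartialEquiv := (φ.trans Θ).toPartialEquiv
            open_source := (φ.trans Θ).open_source
            open_target := (φ.trans Θ).open_target
            contMDiffOn_toFun := ?_
            contMDiffOn_invFun := ?_ }, ?_, ?_⟩
  · have h1 : ContMDiffOn 𝓘(ℝ, EuclideanSpace ℝ (Fin n)) 𝓘(ℝ, EuclideanSpace ℝ (Fin n)) ∞ Θ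
        Θ.source := contMDiffOn_iff_contDiffOn.2 (hθs.mono hΘs)
    exact h1.comp ((contMDiffOn_chart (I := 𝓡 n) (x := p)).mono Set.inter_subset_left)
      Set.inter_subset_right
  · have h1 : ContMDiffOn 𝓘(ℝ, EuclideanSpace ℝ (Fin n)) 𝓘(ℝ, EuclideanSpace ℝ (Fin n)) ∞ Θ.symm
        Θ.target := by
      rw [contMDiffOn_iff_contDiffOn]
      intro y hy
      have hyU : Θ.symm y ∈ U := hΘs (Θ.map_target hy)
      obtain ⟨A', hA'⟩ := hder _ hyU
      exact (Θ.contDiffAt_symm hy hA' (hθs.contDiffAt (hUo.mem_nhds hyU))).contDiffWithinAt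
    exact (contMDiffOn_chart_symm (I := 𝓡 n) (x := p)).comp (h1.mono Set.inter_subset_left)
      Set.inter_subset_right
  · change p ∈ (φ.trans Θ).source
    rw [OpenPartialHomeomorph.trans_source]
    refine ⟨mem_chart_source _ p, ?_, hp⟩
    exact hcd.mem_toOpenPartialHomeomorph_source hA (by simp)
  · intro q hq
    have hq' : q ∈ φ.source := hq.1
    change e.proj (x q) = θ (φ q)
    simp only [hθ, inChart, Function.comp]
    congr 2
    have : (extChartAt (𝓡 n) p).symm (φ q) = φ.symm (φ q) := by simp [hφ]
    rw [this, φ.left_inv hq']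

end Charts

end SpacelikeHypersurface

namespace SpacelikeHypersurface

/-! ### The Riemannian distance and curve lengths of the induced metric. -/

section InducedDistance

variable {n : ℕ} {M : Type*} [TopologicalSpace M] [ChartedSpace (EuclideanSpace ℝ (Fin n)) M]
  {x : M → LorentzSpace n}

/-- The norms of the induced metric on the tangent spaces. -/
noncomputable abbrev inducedENorm (x : M → LorentzSpace n) (r : M) : ENorm (TangentSpace (𝓡 n) r) :=
  ⟨fun v => ENNReal.ofReal (Real.sqrt (inducedMetric x r v v))⟩

theorem inducedMetric_smul (p : M) (c : ℝ) (v : TangentSpace (𝓡 n) p) :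
    inducedMetric x p (c • v) (c • v) = c ^ 2 * inducedMetric x p v v := by
  have h : mfderiv (𝓡 n) 𝓘(ℝ, LorentzSpace n) x p (c • v)
      = c • (show LorentzSpace n from mfderiv (𝓡 n) 𝓘(ℝ, LorentzSpace n) x p v) :=
    ContinuousLinearMap.map_smul _ c v
  rw [inducedMetric, h, lorentz_smul_left, lorentz_smul_right, inducedMetric]; ring

theorem inducedENorm_smulClass (r : M) :
    letI := inducedENorm x r
    ENormSMulClass ℝ (TangentSpace (𝓡 n) r) := by
  let _ := inducedENorm x r
  refine ⟨fun c v => ?_⟩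
  change ENNReal.ofReal _ = _ * ENNReal.ofReal _
  rw [inducedMetric_smul, Real.sqrt_mul (sq_nonneg c), Real.sqrt_sq_eq_abs,
    ENNReal.ofReal_mul (abs_nonneg c), ← Real.enorm_eq_ofReal_abs]

/-- The length of a curve for the induced metric. -/
noncomputable def curveLength (x : M → LorentzSpace n) (γ : ℝ → M) (a b : ℝ) : ℝ≥0∞ :=
  letI := inducedENorm x
  Manifold.pathELength (𝓡 n) γ a b

theorem curveLength_eq_lintegral (γ : ℝ → M) (a b : ℝ) :
    curveLength x γ a b = ∫⁻ t in Set.Ioo a b, ENNReal.ofReal (Real.sqrt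
      (inducedMetric x (γ t) (mfderiv 𝓘(ℝ, ℝ) (𝓡 n) γ t 1) (mfderiv 𝓘(ℝ, ℝ) (𝓡 n) γ t 1))) := by
  let _ := inducedENorm x
  exact Manifold.pathELength_eq_lintegral_mfderiv_Ioo

theorem curveLength_add {γ : ℝ → M} {a b c : ℝ} (h : a ≤ b) (h' : b ≤ c) :
    curveLength x γ a b + curveLength x γ b c = curveLength x γ a c := by
  let _ := inducedENorm x
  exact Manifold.pathELength_add h h'

theorem inducedEDist_le_curveLength {γ : ℝ → M} {a b : ℝ}
    (hγ : ContMDiffOn 𝓘(ℝ, ℝ) (𝓡 n) 1 γ (Set.Icc a b)) (hab : a ≤ b) :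
    inducedEDist x (γ a) (γ b) ≤ curveLength x γ a b := by
  let _ := inducedENorm x
  have _ := inducedENorm_smulClass (x := x)
  exact Manifold.riemannianEDist_le_pathELength hγ rfl rfl hab

theorem inducedEDist_self (p : M) : inducedEDist x p p = 0 := by
  let _ := inducedENorm x
  have _ := inducedENorm_smulClass (x := x)
  exact Manifold.riemannianEDist_self

theorem inducedEDist_comm (p q : M) : inducedEDist x p q = inducedEDist x q p := by
  let _ := inducedENorm x
  have _ := inducedENorm_smulClass (x := x)
  exact Manifold.riemannianEDist_comm

theorem inducedEDist_triangle (p q r : M) :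
    inducedEDist x p r ≤ inducedEDist x p q + inducedEDist x q r := by
  let _ := inducedENorm x
  have _ := inducedENorm_smulClass (x := x)
  exact Manifold.riemannianEDist_triangle

theorem exists_curve_of_inducedEDist_lt {p q : M} {r : ℝ≥0∞} (h : inducedEDist x p q < r) :
    ∃ γ : ℝ → M, γ 0 = p ∧ γ 1 = q ∧ ContMDiffOn 𝓘(ℝ, ℝ) (𝓡 n) 1 γ (Set.Icc 0 1) ∧
      curveLength x γ 0 1 < r := by
  let _ := inducedENorm x
  exact Manifold.exists_lt_of_riemannianEDist_lt h

theorem curveLength_le {γ : ℝ → M} {a b C : ℝ} (hC : 0 ≤ C)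
    (h : ∀ t ∈ Set.Ioo a b, inducedMetric x (γ t) (mfderiv 𝓘(ℝ, ℝ) (𝓡 n) γ t 1)
      (mfderiv 𝓘(ℝ, ℝ) (𝓡 n) γ t 1) ≤ C ^ 2) :
    curveLength x γ a b ≤ ENNReal.ofReal (C * (b - a)) := by
  rw [curveLength_eq_lintegral]
  calc _ ≤ ∫⁻ _ in Set.Ioo a b, ENNReal.ofReal C := by
        refine setLIntegral_mono' measurableSet_Ioo fun t ht => ?_
        exact ENNReal.ofReal_le_ofReal (Real.sqrt_le_iff.2 ⟨hC, h t ht⟩)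
    _ = _ := by
        rw [setLIntegral_const, Real.volume_Ioo, ENNReal.ofReal_mul hC]

end InducedDistance

/-! ### Completeness makes the hypersurface an entire graph. -/

section RayLifting

variable {n : ℕ} {M : Type*} [TopologicalSpace M] [ChartedSpace (EuclideanSpace ℝ (Fin n)) M]
  {x : M → LorentzSpace n} (e : LorentzFrame n)

theorem mfderiv_proj_comp_curve (hx : IsSpacelikeImmersion x) {γ : ℝ → M} {t : ℝ}
    (hγ : MDifferentiableAt 𝓘(ℝ, ℝ) (𝓡 n) γ t) :
    deriv (fun s => e.proj (x (γ s))) t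
      = e.proj (mfderiv (𝓡 n) 𝓘(ℝ, LorentzSpace n) x (γ t) (mfderiv 𝓘(ℝ, ℝ) (𝓡 n) γ t 1)) := by
  have hxd : MDifferentiableAt (𝓡 n) 𝓘(ℝ, LorentzSpace n) x (γ t) :=
    hx.1.mdifferentiableAt (by simp)
  have h1 : MDifferentiableAt 𝓘(ℝ, ℝ) 𝓘(ℝ, LorentzSpace n) (x ∘ γ) t := hxd.comp t hγ
  have h2 := mfderiv_comp t hxd hγ
  rw [mfderiv_eq_fderiv] at h2
  have h3 : HasFDerivAt (fun s => e.proj (x (γ s))) (e.proj.comp (fderiv ℝ (x ∘ γ) t)) t :=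
    e.proj.hasFDerivAt.comp t h1.differentiableAt.hasFDerivAt
  rw [← fderiv_apply_one_eq_deriv, h3.fderiv, h2]
  rfl

/-- A curve in `M` is at most as long as its projection. -/
theorem inducedMetric_le_norm_deriv_sq (hx : IsSpacelikeImmersion x) {γ : ℝ → M} {t : ℝ}
    (hγ : MDifferentiableAt 𝓘(ℝ, ℝ) (𝓡 n) γ t) :
    inducedMetric x (γ t) (mfderiv 𝓘(ℝ, ℝ) (𝓡 n) γ t 1) (mfderiv 𝓘(ℝ, ℝ) (𝓡 n) γ t 1)
      ≤ ‖deriv (fun s => e.proj (x (γ s))) t‖ ^ 2 := by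
  rw [mfderiv_proj_comp_curve e hx hγ]
  refine le_of_le_of_eq ?_ (e.norm_proj_sq _).symm
  exact le_add_of_nonneg_right (sq_nonneg _)

/-- `γ` lifts the segment `t ↦ z(p₀) + t v` over `[0, T]`, where `z` is the projection along a
time-like direction. -/
def IsRayLift (x : M → LorentzSpace n) (p₀ : M) (v : EuclideanSpace ℝ (Fin n)) (T : ℝ)
    (γ : ℝ → M) : Prop :=
  ContinuousOn γ (Set.Icc 0 T) ∧ γ 0 = p₀ ∧
    ∀ t ∈ Set.Icc 0 T, e.proj (x (γ t)) = e.proj (x p₀) + t • v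

variable {e} {p₀ : M} {v : EuclideanSpace ℝ (Fin n)}

omit [ChartedSpace (EuclideanSpace ℝ (Fin n)) M] in
theorem IsRayLift.mono {γ : ℝ → M} {T T' : ℝ} (h : IsRayLift e x p₀ v T γ) (hT : T' ≤ T) :
    IsRayLift e x p₀ v T' γ :=
  ⟨h.1.mono (Set.Icc_subset_Icc_right hT), h.2.1, fun t ht => h.2.2 t ⟨ht.1, ht.2.trans hT⟩⟩

variable [IsManifold (𝓡 n) ∞ M]

/-- Uniqueness of lifts through a locally injective map from a Hausdorff space. -/
theorem IsRayLift.eqOn [T2Space M] (hx : IsSpacelikeImmersion x) {γ γ' : ℝ → M} {T : ℝ}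
    (h : IsRayLift e x p₀ v T γ) (h' : IsRayLift e x p₀ v T γ') : Set.EqOn γ γ' (Set.Icc 0 T) := by
  by_cases hT : 0 ≤ T
  · refine (T2Space.isSeparatedMap fun p => e.proj (x p)).eqOn_of_comp_eqOn
      (isLocalDiffeomorph_proj e hx).isLocalHomeomorph.isLocallyInjective isPreconnected_Icc h.1 h'.1
      (fun t ht => ?_) (Set.left_mem_Icc.2 hT) (h.2.1.trans h'.2.1.symm)
    exact (h.2.2 t ht).trans (h'.2.2 t ht).symm
  · rw [Set.Icc_eq_empty hT]; exact Set.eqOn_empty _ _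

/-- Near each parameter, a continuous lift is the segment followed by a smooth local inverse of the
projection. -/
theorem IsRayLift.contMDiffOn (hx : IsSpacelikeImmersion x) {γ : ℝ → M} {T : ℝ}
    (h : IsRayLift e x p₀ v T γ) : ContMDiffOn 𝓘(ℝ, ℝ) (𝓡 n) 1 γ (Set.Icc 0 T) := by
  intro t ht
  have hl := isLocalDiffeomorph_proj e hx (γ t)
  have hc : ContMDiff 𝓘(ℝ, ℝ) 𝓘(ℝ, EuclideanSpace ℝ (Fin n)) 1
      fun s : ℝ => e.proj (x p₀) + s • v := by
    rw [contMDiff_iff_contDiff]; fun_prop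
  have hcomp : ContMDiffAt 𝓘(ℝ, ℝ) (𝓡 n) 1
      (fun s : ℝ => hl.localInverse (e.proj (x p₀) + s • v)) t := by
    refine ContMDiffAt.comp t ?_ hc.contMDiffAt
    rw [← h.2.2 t ht]
    exact hl.localInverse_contMDiffAt.of_le (by exact_mod_cast le_top)
  refine hcomp.contMDiffWithinAt.congr_of_eventuallyEq ?_ ?_
  · filter_upwards [(h.1 t ht).eventually (hl.localInverse.open_target.mem_nhds
      hl.localInverse_mem_target), self_mem_nhdsWithin] with s hs hs'
    rw [← h.2.2 s hs', hl.localInverse_left_inv hs]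
  · rw [← h.2.2 t ht, hl.localInverse_left_inv hl.localInverse_mem_target]

/-- A lift is `‖v‖`-Lipschitz for the induced distance, because the segment has speed `‖v‖`. -/
theorem IsRayLift.inducedEDist_le (hx : IsSpacelikeImmersion x) {γ : ℝ → M} {T : ℝ}
    (h : IsRayLift e x p₀ v T γ) {s t : ℝ} (hs : 0 ≤ s) (hst : s ≤ t) (ht : t ≤ T) :
    inducedEDist x (γ s) (γ t) ≤ ENNReal.ofReal (‖v‖ * (t - s)) := by
  have hsub : Set.Icc s t ⊆ Set.Icc 0 T := Set.Icc_subset_Icc hs ht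
  have hγ := h.contMDiffOn hx
  refine (inducedEDist_le_curveLength (hγ.mono hsub) hst).trans
    (curveLength_le (norm_nonneg v) fun r hr => ?_)
  have hmem : Set.Icc 0 T ∈ 𝓝 r := mem_of_superset (Icc_mem_nhds hr.1 hr.2) hsub
  have hd : MDifferentiableAt 𝓘(ℝ, ℝ) (𝓡 n) γ r :=
    (hγ.contMDiffAt hmem).mdifferentiableAt (by simp)
  refine (inducedMetric_le_norm_deriv_sq e hx hd).trans_eq ?_
  have heq : (fun s => e.proj (x (γ s))) =ᶠ[𝓝 r] fun s => e.proj (x p₀) + s • v := by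
    filter_upwards [hmem] with s hs using h.2.2 s hs
  rw [heq.deriv_eq]
  have : HasDerivAt (fun s : ℝ => e.proj (x p₀) + s • v) ((1 : ℝ) • v) r :=
    ((hasDerivAt_id r).smul_const v).const_add _
  rw [this.deriv, one_smul]

/-- A lift can be prolonged as long as the segment stays in the image of a local inverse. -/
theorem IsRayLift.extend (hx : IsSpacelikeImmersion x) {γ : ℝ → M} {T T' : ℝ}
    (h : IsRayLift e x p₀ v T γ) (hT : 0 ≤ T) {q : M}
    (hq : γ T ∈ (isLocalDiffeomorph_proj e hx q).localInverse.target)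
    (hseg : ∀ t ∈ Set.Icc T T', e.proj (x p₀) + t • v
      ∈ (isLocalDiffeomorph_proj e hx q).localInverse.source) :
    ∃ γ', IsRayLift e x p₀ v T' γ' := by
  set hl := isLocalDiffeomorph_proj e hx q
  refine ⟨fun t => if t ≤ T then γ t else hl.localInverse (e.proj (x p₀) + t • v), ?_, ?_, ?_⟩
  · have hcl : ContinuousOn (fun t : ℝ => hl.localInverse (e.proj (x p₀) + t • v))
        (Set.Icc T T') := by
      refine hl.localInverse_contMDiffOn.continuousOn.comp (by fun_prop) hseg
    refine ContinuousOn.if ?_ ?_ ?_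
    · intro t ht
      have ht' : t = T := by
        have := frontier_le_subset_eq continuous_id continuous_const ht.2
        exact this
      subst ht'
      rw [← h.2.2 t ⟨hT, le_rfl⟩, hl.localInverse_left_inv hq]
    · refine h.1.mono fun t ht => ⟨ht.1.1, ?_⟩
      have := closure_le_eq (f := fun t : ℝ => t) (g := fun _ => T) continuous_id continuous_const
      have h2 := ht.2
      rw [this] at h2
      exact h2
    · refine hcl.mono fun t ht => ⟨?_, ht.1.2⟩
      have h2 := ht.2
      simp only [not_le] at h2
      exact closure_lt_subset_le continuous_const continuous_id h2
  · simp only [hT, if_true]; exact h.2.1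
  · intro t ht
    by_cases htT : t ≤ T
    · simp only [htT, if_true]; exact h.2.2 t ⟨ht.1, htT⟩
    · simp only [htT, if_false]
      exact hl.localInverse_right_inv (hseg t ⟨(not_le.1 htT).le, ht.2⟩)

/-- Continuity method. Lifts over shorter intervals are Lipschitz, so completeness supplies a limit
point over the missing endpoint, and the local diffeomorphism there carries the lift further. -/
theorem exists_rayLift [T2Space M] (hx : IsSpacelikeImmersion x)
    (hcomplete : IsCompleteHypersurface x) (p₀ : M) (v : EuclideanSpace ℝ (Fin n)) :
    ∃ γ, IsRayLift e x p₀ v 1 γ := by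
  have hzero : ∃ γ, IsRayLift e x p₀ v 0 γ :=
    ⟨fun _ => p₀, continuousOn_const, rfl, fun t ht => by
      rw [le_antisymm ht.2 ht.1, zero_smul, add_zero]⟩
  have hnear : ∀ T : ℝ, 0 ≤ T → (∀ t, 0 ≤ t → t < T → ∃ γ, IsRayLift e x p₀ v t γ) →
      ∃ δ > 0, ∃ γ, IsRayLift e x p₀ v (T + δ) γ := by
    intro T hT hlt
    have hc : Continuous fun t : ℝ => e.proj (x p₀) + t • v := by fun_prop
    -- It is enough to find a point `q` over the endpoint that is approached by ends of lifts over
    -- intervals arbitrarily close to `[0, T]`.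
    suffices H : ∃ q : M, e.proj (x q) = e.proj (x p₀) + T • v ∧ ∀ δ > 0, ∀ W ∈ 𝓝 q,
        ∃ t γ, 0 ≤ t ∧ t ≤ T ∧ T - δ < t ∧ IsRayLift e x p₀ v t γ ∧ γ t ∈ W by
      obtain ⟨q, hzq, hq⟩ := H
      set hl := isLocalDiffeomorph_proj e hx q with hhl
      have hsrc : ∀ᶠ t in 𝓝 T, e.proj (x p₀) + t • v ∈ hl.localInverse.source := by
        refine hc.continuousAt.eventually (hl.localInverse.open_source.mem_nhds ?_)
        simp only [← hzq]
        exact hl.localInverse_mem_source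
      obtain ⟨δ, hδ, hball⟩ := Metric.eventually_nhds_iff.1 hsrc
      obtain ⟨t, γ, ht0, htT, htδ, hγ, hγW⟩ := hq δ hδ _
        (hl.localInverse.open_target.mem_nhds hl.localInverse_mem_target)
      refine ⟨δ / 2, by positivity, hγ.extend hx ht0 hγW fun r hr => hball ?_⟩
      rw [Real.dist_eq, abs_lt]
      constructor <;> linarith [hr.1, hr.2]
    rcases hT.eq_or_lt with rfl | hTpos
    · obtain ⟨γ, hγ⟩ := hzero
      refine ⟨p₀, by simp, fun δ hδ W hW => ⟨0, γ, le_rfl, le_rfl, by linarith, hγ, ?_⟩⟩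
      rw [hγ.2.1]; exact mem_of_mem_nhds hW
    -- Parameters `τ k < T` tending to `T`. By uniqueness the lifts over `[0, τ k]` agree on common
    -- intervals, so their endpoints are Cauchy.
    · set τ : ℕ → ℝ := fun k => T * (1 - 1 / ((k : ℝ) + 1)) with hτ
      have hfrac : ∀ k : ℕ, 0 < 1 / ((k : ℝ) + 1) ∧ 1 / ((k : ℝ) + 1) ≤ 1 := fun k =>
        ⟨by positivity, by rw [div_le_one (by positivity)]; linarith [k.cast_nonneg (α := ℝ)]⟩
      have hτ0 : ∀ k, 0 ≤ τ k := fun k => mul_nonneg hT (by linarith [(hfrac k).2])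
      have hτT : ∀ k, τ k < T := fun k => by
        have := mul_pos hTpos (hfrac k).1
        simp only [hτ]; linarith
      have hτlim : Tendsto τ atTop (𝓝 T) := by
        have := (tendsto_one_div_add_atTop_nhds_zero_nat (𝕜 := ℝ)).const_sub 1 |>.const_mul T
        simpa [hτ] using this
      choose Γ hΓ using fun k => hlt (τ k) (hτ0 k) (hτT k)
      have hmono : ∀ k l, τ k ≤ τ l →
          inducedEDist x (Γ k (τ k)) (Γ l (τ l)) ≤ ENNReal.ofReal (‖v‖ * (τ l - τ k)) := by
        intro k l hkl
        have := ((hΓ l).mono hkl).eqOn hx (hΓ k) ⟨hτ0 k, le_rfl⟩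
        rw [← this]
        exact (hΓ l).inducedEDist_le hx (hτ0 k) hkl le_rfl
      have hdist : ∀ k l, inducedEDist x (Γ k (τ k)) (Γ l (τ l))
          ≤ ENNReal.ofReal (‖v‖ * |τ l - τ k|) := by
        intro k l
        rcases le_total (τ k) (τ l) with hkl | hkl
        · rw [abs_of_nonneg (by linarith)]; exact hmono k l hkl
        · rw [abs_of_nonpos (by linarith), neg_sub, inducedEDist_comm]; exact hmono l k hkl
      obtain ⟨q, hq⟩ := hcomplete (fun k => Γ k (τ k)) (by
        intro δ hδ
        obtain ⟨η, hη0, hη⟩ : ∃ η : ℝ, 0 < η ∧ ENNReal.ofReal (‖v‖ * η) < δ := by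
          have hlim : Tendsto (fun η : ℝ => ENNReal.ofReal (‖v‖ * η)) (𝓝[>] 0) (𝓝 0) := by
            have : Continuous fun η : ℝ => ENNReal.ofReal (‖v‖ * η) :=
              ENNReal.continuous_ofReal.comp (by fun_prop)
            have h0 := this.tendsto 0
            simp only [mul_zero, ENNReal.ofReal_zero] at h0
            exact h0.mono_left nhdsWithin_le_nhds
          obtain ⟨η, h1, h2⟩ := ((hlim.eventually (gt_mem_nhds hδ)).and self_mem_nhdsWithin).exists
          exact ⟨η, h2, h1⟩
        obtain ⟨K, hK⟩ := Metric.cauchySeq_iff.1 hτlim.cauchySeq η hη0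
        refine ⟨K, fun k hk l hl => (hdist k l).trans_lt (lt_of_le_of_lt ?_ hη)⟩
        apply ENNReal.ofReal_le_ofReal
        have := hK l hl k hk
        rw [Real.dist_eq] at this
        gcongr)
      have hzc : Continuous fun p => e.proj (x p) := e.proj.continuous.comp hx.1.continuous
      refine ⟨q, ?_, ?_⟩
      · have h1 := (hzc.tendsto q).comp hq
        have h2 : Tendsto (fun k => e.proj (x p₀) + τ k • v) atTop (𝓝 (e.proj (x p₀) + T • v)) :=
          (hc.tendsto T).comp hτlim
        refine tendsto_nhds_unique h1 (h2.congr fun k => ?_)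
        exact ((hΓ k).2.2 _ ⟨hτ0 k, le_rfl⟩).symm
      · intro δ hδ W hW
        obtain ⟨k, hk1, hk2⟩ := ((hτlim.eventually (lt_mem_nhds (by linarith : T - δ < T))).and
          (hq.eventually hW)).exists
        exact ⟨τ k, Γ k, hτ0 k, (hτT k).le, hk1, hΓ k, hk2⟩
  -- If no lift reaches `1`, the admissible times are bounded and their supremum contradicts
  -- `hnear`.
  by_contra hno
  set A : Set ℝ := {T | 0 ≤ T ∧ ∃ γ, IsRayLift e x p₀ v T γ} with hA
  have hbdd : ∀ T ∈ A, T ≤ 1 := by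
    rintro T ⟨_, γ, hγ⟩
    by_contra hT
    exact hno ⟨γ, hγ.mono (not_le.1 hT).le⟩
  have h0A : (0 : ℝ) ∈ A := ⟨le_rfl, hzero⟩
  have hB : BddAbove A := ⟨1, hbdd⟩
  obtain ⟨δ, hδ, γ, hγ⟩ := hnear (sSup A) (le_csSup hB h0A) (by
    intro t _ ht
    obtain ⟨T, ⟨_, γ, hγ⟩, htT⟩ := exists_lt_of_lt_csSup ⟨0, h0A⟩ ht
    exact ⟨γ, hγ.mono htT.le⟩)
  have : sSup A + δ ∈ A := ⟨by linarith [le_csSup hB h0A], γ, hγ⟩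
  linarith [le_csSup hB this]

/-- The endpoints of the lifted segments from a base point form a continuous section `σ` of the
projection. Then `σ ∘ z` and the identity of the connected space `M` lift the same map `z` and agree
at the base point, so they coincide. -/
theorem proj_bijective [T2Space M] [ConnectedSpace M] (e : LorentzFrame n)
    (hx : IsSpacelikeImmersion x) (hcomplete : IsCompleteHypersurface x) :
    Function.Bijective fun p => e.proj (x p) := by
  obtain ⟨p₀⟩ := (inferInstance : Nonempty M)
  have hhomeo := (isLocalDiffeomorph_proj e hx).isLocalHomeomorph
  have hsep : IsSeparatedMap fun p => e.proj (x p) := T2Space.isSeparatedMap _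
  choose Γ hΓ using fun y => exists_rayLift (e := e) hx hcomplete p₀ (y - e.proj (x p₀))
  let f : C(unitInterval × EuclideanSpace ℝ (Fin n), EuclideanSpace ℝ (Fin n)) :=
    ⟨fun a => e.proj (x p₀) + (a.1 : ℝ) • (a.2 - e.proj (x p₀)), by fun_prop⟩
  -- Lifts of a homotopy through a local homeomorphism depend continuously on the parameter `y`.
  have hcont : Continuous fun a : unitInterval × EuclideanSpace ℝ (Fin n) => Γ a.2 a.1 := by
    refine hhomeo.continuous_lift hsep f ?_ ?_ ?_
    · funext a
      exact (hΓ a.2).2.2 a.1 a.1.2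
    · refine (continuous_const (y := p₀)).congr fun y => ?_
      exact ((hΓ y).2.1).symm
    · intro y
      exact (hΓ y).1.comp_continuous continuous_subtype_val fun t => t.2
  have hσc : Continuous fun y => Γ y 1 := hcont.comp (Continuous.prodMk_right (1 : unitInterval))
  have hσz : ∀ y, e.proj (x (Γ y 1)) = y := fun y => by
    rw [(hΓ y).2.2 1 (by simp)]; simp
  have hbase : Γ (e.proj (x p₀)) 1 = p₀ := by
    have hc : IsRayLift e x p₀ (e.proj (x p₀) - e.proj (x p₀)) 1 fun _ => p₀ :=
      ⟨continuousOn_const, rfl, fun t _ => by simp⟩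
    exact (hΓ _).eqOn hx hc (by simp)
  have hid : (fun p => Γ (e.proj (x p)) 1) = id :=
    hsep.eq_of_comp_eq hhomeo.isLocallyInjective
      (hσc.comp (e.proj.continuous.comp hx.1.continuous)) continuous_id
      (funext fun p => hσz _) p₀ hbase
  exact ⟨Function.LeftInverse.injective (g := fun y => Γ y 1) fun p => congrFun hid p,
    fun y => ⟨Γ y 1, hσz y⟩⟩

/-- A complete space-like hypersurface is an entire graph over the span of the space-like vectors
of every Lorentz frame. -/
noncomputable def graphDiffeo [T2Space M] [ConnectedSpace M] (e : LorentzFrame n)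
    (hx : IsSpacelikeImmersion x) (hcomplete : IsCompleteHypersurface x) :
    Diffeomorph (𝓡 n) 𝓘(ℝ, EuclideanSpace ℝ (Fin n)) M (EuclideanSpace ℝ (Fin n)) ∞ where
  toEquiv := Equiv.ofBijective _ (proj_bijective e hx hcomplete)
  contMDiff_toFun := (isLocalDiffeomorph_proj e hx).contMDiff
  contMDiff_invFun := by
    intro y
    obtain ⟨p, rfl⟩ := (proj_bijective e hx hcomplete).2 y
    have hl := isLocalDiffeomorph_proj e hx p
    refine hl.localInverse_contMDiffAt.congr_of_eventuallyEq ?_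
    filter_upwards [hl.localInverse.open_source.mem_nhds hl.localInverse_mem_source] with y hy
    apply (proj_bijective e hx hcomplete).1
    exact ((Equiv.ofBijective _ (proj_bijective e hx hcomplete)).right_inv y).trans
      (hl.localInverse_right_inv hy).symm

end RayLifting

end SpacelikeHypersurface

namespace SpacelikeHypersurface

/-! ### Global graph coordinates; `H`, `S`, gradient and Laplacian expressed in them. -/

section GraphCoordinates

variable {n : ℕ} {M : Type*} [TopologicalSpace M] [ChartedSpace (EuclideanSpace ℝ (Fin n)) M]
  [IsManifold (𝓡 n) ∞ M] [T2Space M] [ConnectedSpace M] {x N : M → LorentzSpace n}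
  (e : LorentzFrame n) (hx : IsSpacelikeImmersion x) (hN : IsUnitNormal x N)
  (hc : IsCompleteHypersurface x)

/-- The parametrization of a complete space-like hypersurface as an entire graph. -/
noncomputable def graphMap (y : EuclideanSpace ℝ (Fin n)) : M := (graphDiffeo e hx hc).symm y

@[simp] theorem proj_graphMap (y : EuclideanSpace ℝ (Fin n)) :
    e.proj (x (graphMap e hx hc y)) = y := (graphDiffeo e hx hc).apply_symm_apply y

@[simp] theorem graphMap_proj (p : M) : graphMap e hx hc (e.proj (x p)) = p :=
  (graphDiffeo e hx hc).symm_apply_apply p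

theorem lorentz_graphMap_vec (y : EuclideanSpace ℝ (Fin n)) (k : Fin n) :
    lorentz (x (graphMap e hx hc y)) (e.vec k) = y k :=
  congrArg (fun w : EuclideanSpace ℝ (Fin n) => w k) (proj_graphMap e hx hc y)

theorem contMDiff_graphMap : ContMDiff 𝓘(ℝ, EuclideanSpace ℝ (Fin n)) (𝓡 n) ∞
    (graphMap e hx hc) := (graphDiffeo e hx hc).symm.contMDiff

theorem continuous_graphMap : Continuous (graphMap e hx hc) :=
  (contMDiff_graphMap e hx hc).continuous

theorem contDiff_comp_graphMap {F : Type*} [NormedAddCommGroup F] [NormedSpace ℝ F] {f : M → F}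
    (hf : ContMDiff (𝓡 n) 𝓘(ℝ, F) ∞ f) : ContDiff ℝ ∞ fun y => f (graphMap e hx hc y) := by
  rw [← contMDiff_iff_contDiff]
  exact hf.comp (contMDiff_graphMap e hx hc)

theorem fderiv_comp_graphMap (y v : EuclideanSpace ℝ (Fin n)) :
    fderiv ℝ (fun y => x (graphMap e hx hc y)) y v
      = mfderiv (𝓡 n) 𝓘(ℝ, LorentzSpace n) x (graphMap e hx hc y)
        (mfderiv 𝓘(ℝ, EuclideanSpace ℝ (Fin n)) (𝓡 n) (graphMap e hx hc) y v) := by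
  have h := mfderiv_comp y (hx.1.mdifferentiableAt (by simp) (x := graphMap e hx hc y))
    ((contMDiff_graphMap e hx hc).mdifferentiableAt (by simp))
  rw [mfderiv_eq_fderiv] at h
  exact congrArg (fun A => A v) h

theorem proj_fderiv_graphMap (y v : EuclideanSpace ℝ (Fin n)) :
    e.proj (fderiv ℝ (fun y => x (graphMap e hx hc y)) y v) = v := by
  have hd : DifferentiableAt ℝ (fun y => x (graphMap e hx hc y)) y :=
    (contDiff_comp_graphMap e hx hc hx.1).differentiable (by simp) y
  have h1 : HasFDerivAt (fun y => e.proj (x (graphMap e hx hc y)))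
      (e.proj.comp (fderiv ℝ (fun y => x (graphMap e hx hc y)) y)) y :=
    e.proj.hasFDerivAt.comp y hd.hasFDerivAt
  simp only [proj_graphMap] at h1
  exact congrArg (fun A : EuclideanSpace ℝ (Fin n) →L[ℝ] EuclideanSpace ℝ (Fin n) => A v)
    (h1.unique (hasFDerivAt_id y))

include hN in
theorem isPatch_graph : IsPatch (fun y => x (graphMap e hx hc y))
    (fun y => N (graphMap e hx hc y)) Set.univ where
  isOpen := isOpen_univ
  contDiffOn := (contDiff_comp_graphMap e hx hc hx.1).contDiffOn
  contDiffOn_normal := (contDiff_comp_graphMap e hx hc hN.1).contDiffOn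
  pos y _ v hv := by
    rw [fderiv_comp_graphMap]
    refine hx.2 _ _ fun h => hv ?_
    rw [← proj_fderiv_graphMap e hx hc y v, fderiv_comp_graphMap]
    exact (congrArg _ ((congrArg _ h).trans (map_zero _))).trans (map_zero e.proj)
  unit y _ := (hN.2 _).1
  orth y _ v := by
    rw [fderiv_comp_graphMap]
    exact (hN.2 _).2 _

/-- `H`, `S`, `∇` and `Δ` are defined with the preferred chart at `p`, which changes with `p`. This
factorization feeds the chart expressions into the formulas for `F = G ∘ z`, and so gives one
formula valid on all of `M`. -/
theorem inChart_eq_comp_proj {F : Type*} (f : M → F) (p : M) (u : EuclideanSpace ℝ (Fin n)) :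
    inChart p f u = (fun y => f (graphMap e hx hc y)) (e.proj (inChart p x u)) := by
  simp [inChart]

include hN

theorem meanCurvature_eq (p : M) :
    meanCurvature x N p = ∑ k, pderiv k
      (fun y => lorentz (N (graphMap e hx hc y)) (e.vec k)) (e.proj (x p)) := by
  have h := (isPatch_inChart hx hN p).trace_shape e (contDiff_comp_graphMap e hx hc hN.1)
    (fun v _ => inChart_eq_comp_proj e hx hc N p v) (mem_extChartAt_target (I := 𝓡 n) p)
  have hp : inChart p x (extChartAt (𝓡 n) p p) = x p := by simp [inChart]
  rw [hp] at h
  exact h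

theorem secondFormNormSq_eq (p : M) :
    secondFormNormSq x N p = ∑ i, ∑ k,
      pderiv i (fun y => lorentz (N (graphMap e hx hc y)) (e.vec k)) (e.proj (x p)) *
      pderiv k (fun y => lorentz (N (graphMap e hx hc y)) (e.vec i)) (e.proj (x p)) := by
  have h := (isPatch_inChart hx hN p).trace_shape_sq e (contDiff_comp_graphMap e hx hc hN.1)
    (fun v _ => inChart_eq_comp_proj e hx hc N p v) (mem_extChartAt_target (I := 𝓡 n) p)
  have hp : inChart p x (extChartAt (𝓡 n) p p) = x p := by simp [inChart]
  rw [hp] at h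
  exact h

theorem secondFormAt_eq_smul {p : M} {κ : ℝ}
    (hκ : ∀ k l, pderiv l (fun y => lorentz (N (graphMap e hx hc y)) (e.vec k)) (e.proj (x p))
      = if k = l then κ else 0) :
    secondFormAt x N p = κ • metricAt x p := by
  have hp : inChart p x (extChartAt (𝓡 n) p p) = x p := by simp [inChart]
  exact (isPatch_inChart hx hN p).patchSecond_eq_smul e (contDiff_comp_graphMap e hx hc hN.1)
    (fun v _ => inChart_eq_comp_proj e hx hc N p v) (mem_extChartAt_target (I := 𝓡 n) p)
    (by rw [hp]; exact hκ)

theorem inducedGradient_eq {f : M → ℝ} (hf : ContDiff ℝ ∞ fun y => f (graphMap e hx hc y)) (p : M) :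
    inducedGradient x f p = ∑ m, pderiv m (fun y => f (graphMap e hx hc y)) (e.proj (x p)) •
      (e.vec m + lorentz (N p) (e.vec m) • N p) := by
  have h := (isPatch_inChart hx hN p).gradient_eq e hf
    (fun v _ => inChart_eq_comp_proj e hx hc f p v) (mem_extChartAt_target (I := 𝓡 n) p)
  have hp : inChart p x (extChartAt (𝓡 n) p p) = x p := by simp [inChart]
  have hp' : inChart p N (extChartAt (𝓡 n) p p) = N p := by simp [inChart]
  rw [hp, hp'] at h
  exact h

theorem inducedLaplacian_eq {f : M → ℝ} (hf : ContDiff ℝ ∞ fun y => f (graphMap e hx hc y))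
    (p : M) :
    inducedLaplacian x f p
      = ∑ m, ∑ l, ((if l = m then 1 else 0) + lorentz (N p) (e.vec l) * lorentz (N p) (e.vec m)) *
            pderiv l (pderiv m (fun y => f (graphMap e hx hc y))) (e.proj (x p))
        + meanCurvature x N p * ∑ m, lorentz (N p) (e.vec m) *
            pderiv m (fun y => f (graphMap e hx hc y)) (e.proj (x p)) := by
  have h := (isPatch_inChart hx hN p).laplacian_eq e hf
    (fun v _ => inChart_eq_comp_proj e hx hc f p v) (mem_extChartAt_target (I := 𝓡 n) p)
  have hp : inChart p x (extChartAt (𝓡 n) p p) = x p := by simp [inChart]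
  have hp' : inChart p N (extChartAt (𝓡 n) p p) = N p := by simp [inChart]
  rw [hp, hp'] at h
  exact h

theorem inducedGradient_graphMap {f : M → ℝ} (hf : ContDiff ℝ ∞ fun y => f (graphMap e hx hc y))
    (y : EuclideanSpace ℝ (Fin n)) :
    inducedGradient x f (graphMap e hx hc y)
      = ∑ i, patchGrad (fun y => x (graphMap e hx hc y)) (fun y => f (graphMap e hx hc y)) y i •
          pderiv i (fun y => x (graphMap e hx hc y)) y := by
  rw [inducedGradient_eq e hx hN hc hf,
    (isPatch_graph e hx hN hc).gradient_eq e hf (fun v _ => by simp) (Set.mem_univ y)]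

/-- The graph is itself a patch, and `laplacian_eq` gives the same right side for it as for the
preferred chart. So the Laplacian has divergence form in the global coordinates. -/
theorem inducedLaplacian_graphMap {f : M → ℝ} (hf : ContDiff ℝ ∞ fun y => f (graphMap e hx hc y))
    (y : EuclideanSpace ℝ (Fin n)) :
    inducedLaplacian x f (graphMap e hx hc y)
      = patchLaplacian (fun y => x (graphMap e hx hc y)) (fun y => f (graphMap e hx hc y)) y := by
  rw [inducedLaplacian_eq e hx hN hc hf,
    (isPatch_graph e hx hN hc).laplacian_eq e hf (fun v _ => by simp) (Set.mem_univ y),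
    (isPatch_graph e hx hN hc).trace_shape e (contDiff_comp_graphMap e hx hc hN.1)
      (fun v _ => by simp) (Set.mem_univ y), meanCurvature_eq e hx hN hc]

theorem contDiff_meanCurvature : ContDiff ℝ ∞ fun y => meanCurvature x N (graphMap e hx hc y) := by
  simp only [meanCurvature_eq e hx hN hc, proj_graphMap]
  exact ContDiff.sum fun k _ =>
    ((contDiff_comp_graphMap e hx hc hN.1).lorentz contDiff_const).pderiv k

theorem contDiff_umbilicityDefect :
    ContDiff ℝ ∞ fun y => umbilicityDefect x N (graphMap e hx hc y) := by
  have h : ContDiff ℝ ∞ fun y => secondFormNormSq x N (graphMap e hx hc y) := by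
    simp only [secondFormNormSq_eq e hx hN hc, proj_graphMap]
    exact ContDiff.sum fun i _ => ContDiff.sum fun k _ =>
      (((contDiff_comp_graphMap e hx hc hN.1).lorentz contDiff_const).pderiv i).mul
        (((contDiff_comp_graphMap e hx hc hN.1).lorentz contDiff_const).pderiv k)
  exact h.sub (((contDiff_meanCurvature e hx hN hc).pow 2).div_const _)

end GraphCoordinates

end SpacelikeHypersurface

namespace SpacelikeHypersurface

/-! ### Higher product rules, and commutation of third derivatives. -/

section Leibniz

variable {n : ℕ} {f g : EuclideanSpace ℝ (Fin n) → ℝ}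

theorem _root_.ContDiff.diffAt {F : Type*} [NormedAddCommGroup F] [NormedSpace ℝ F]
    {f : EuclideanSpace ℝ (Fin n) → F} (hf : ContDiff ℝ ∞ f) (y : EuclideanSpace ℝ (Fin n)) :
    DifferentiableAt ℝ f y := hf.differentiable (by simp) y

theorem pderiv_mul_fun (hf : ContDiff ℝ ∞ f) (hg : ContDiff ℝ ∞ g) (i : Fin n) :
    pderiv i (fun y => f y * g y) = fun y => pderiv i f y * g y + f y * pderiv i g y :=
  funext fun y => pderiv_mul (hf.diffAt y) (hg.diffAt y) i

theorem pderiv_add_fun (hf : ContDiff ℝ ∞ f) (hg : ContDiff ℝ ∞ g) (i : Fin n) :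
    pderiv i (fun y => f y + g y) = fun y => pderiv i f y + pderiv i g y :=
  funext fun y => pderiv_add (hf.diffAt y) (hg.diffAt y) i

theorem pderiv_sub_fun (hf : ContDiff ℝ ∞ f) (hg : ContDiff ℝ ∞ g) (i : Fin n) :
    pderiv i (fun y => f y - g y) = fun y => pderiv i f y - pderiv i g y :=
  funext fun y => pderiv_sub (hf.diffAt y) (hg.diffAt y) i

theorem pderiv_sum_fun {ι : Type*} {s : Finset ι} {f : ι → EuclideanSpace ℝ (Fin n) → ℝ}
    (hf : ∀ j, ContDiff ℝ ∞ (f j)) (i : Fin n) :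
    pderiv i (fun y => ∑ j ∈ s, f j y) = fun y => ∑ j ∈ s, pderiv i (f j) y :=
  funext fun y => pderiv_sum (fun j _ => (hf j).diffAt y) i

theorem pderiv_const_mul_fun (c : ℝ) (hf : ContDiff ℝ ∞ f) (i : Fin n) :
    pderiv i (fun y => c * f y) = fun y => c * pderiv i f y := by
  rw [pderiv_mul_fun contDiff_const hf]
  funext y; rw [pderiv_const]; ring

theorem pderiv_coord (m i : Fin n) (y : EuclideanSpace ℝ (Fin n)) :
    pderiv i (fun y : EuclideanSpace ℝ (Fin n) => y m) y = if i = m then 1 else 0 := by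
  have h : HasFDerivAt (fun y : EuclideanSpace ℝ (Fin n) => y m)
      (EuclideanSpace.proj m : EuclideanSpace ℝ (Fin n) →L[ℝ] ℝ) y :=
    (EuclideanSpace.proj m : EuclideanSpace ℝ (Fin n) →L[ℝ] ℝ).hasFDerivAt
  rw [pderiv, h.fderiv]
  simp [eq_comm]

theorem contDiff_coord (m : Fin n) : ContDiff ℝ ∞ fun y : EuclideanSpace ℝ (Fin n) => y m :=
  (EuclideanSpace.proj m : EuclideanSpace ℝ (Fin n) →L[ℝ] ℝ).contDiff

theorem pderiv_pderiv_mul (hf : ContDiff ℝ ∞ f) (hg : ContDiff ℝ ∞ g) (j i : Fin n) :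
    pderiv j (pderiv i (fun y => f y * g y)) = fun y =>
      pderiv j (pderiv i f) y * g y + pderiv i f y * pderiv j g y
        + (pderiv j f y * pderiv i g y + f y * pderiv j (pderiv i g) y) := by
  rw [pderiv_mul_fun hf hg, pderiv_add_fun ((hf.pderiv i).mul hg) (hf.mul (hg.pderiv i)),
    pderiv_mul_fun (hf.pderiv i) hg, pderiv_mul_fun hf (hg.pderiv i)]

theorem pderiv_pderiv_pderiv_mul (hf : ContDiff ℝ ∞ f) (hg : ContDiff ℝ ∞ g) (l j i : Fin n)
    (y : EuclideanSpace ℝ (Fin n)) :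
    pderiv l (pderiv j (pderiv i (fun y => f y * g y))) y =
      pderiv l (pderiv j (pderiv i f)) y * g y + pderiv j (pderiv i f) y * pderiv l g y
        + (pderiv l (pderiv i f) y * pderiv j g y + pderiv i f y * pderiv l (pderiv j g) y)
        + (pderiv l (pderiv j f) y * pderiv i g y + pderiv j f y * pderiv l (pderiv i g) y
          + (pderiv l f y * pderiv j (pderiv i g) y + f y * pderiv l (pderiv j (pderiv i g)) y)) := by
  have h1 := (hf.pderiv i).pderiv j
  have h2 := (hg.pderiv i).pderiv j
  rw [pderiv_pderiv_mul hf hg,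
    pderiv_add_fun ((h1.mul hg).add ((hf.pderiv i).mul (hg.pderiv j)))
      (((hf.pderiv j).mul (hg.pderiv i)).add (hf.mul h2)),
    pderiv_add_fun (h1.mul hg) ((hf.pderiv i).mul (hg.pderiv j)),
    pderiv_add_fun ((hf.pderiv j).mul (hg.pderiv i)) (hf.mul h2),
    pderiv_mul_fun h1 hg, pderiv_mul_fun (hf.pderiv i) (hg.pderiv j),
    pderiv_mul_fun (hf.pderiv j) (hg.pderiv i), pderiv_mul_fun hf h2]

theorem pderiv_swap (hf : ContDiff ℝ ∞ f) (i j : Fin n) :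
    pderiv i (pderiv j f) = pderiv j (pderiv i f) :=
  funext fun _ => pderiv_comm hf.contDiffAt i j

end Leibniz

/-- The commutation of third covariant derivatives, contracted with the second fundamental form. -/
theorem sum_mul_third_derivative {ι : Type*} [Fintype ι] {h W : ι → ι → ℝ} {q r : ι → ι → ι → ι → ℝ}
    (hs : ∀ i j, h i j = h j i) (hW : ∀ i j, W i j = W j i)
    (hr : ∀ i k l, r l l i k = r i k l l)
    (hq : ∀ l j i k, q l j i k = W j i * h l k + W l i * h j k + W l j * h i k + r l j i k) :
    ∑ i, ∑ k, h i k * ∑ l, q l l i k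
      = ∑ i, ∑ k, h i k * (∑ l, q i k l l + (∑ l, W l l) * h i k - (∑ l, h l l) * W i k) := by
  -- After contraction with the symmetric `h`, the cross terms on the two sides agree, and only the
  -- terms with the traces of `W` and `h` survive.
  have key : ∑ i, ∑ k, h i k * ∑ l, W l i * h l k = ∑ i, ∑ k, h i k * ∑ l, W l k * h l i := by
    rw [Finset.sum_comm]
    exact Finset.sum_congr rfl fun k _ => Finset.sum_congr rfl fun i _ => by rw [hs]
  have h1 : ∀ i k, ∑ l, q l l i k
      = 2 * ∑ l, W l i * h l k + (∑ l, W l l) * h i k + ∑ l, r i k l l := by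
    intro i k
    simp only [hq, hr, Finset.sum_add_distrib, Finset.sum_mul]
    ring
  have h2 : ∀ i k, ∑ l, q i k l l = ∑ l, W l k * h l i + ∑ l, W l i * h l k
      + (∑ l, h l l) * W i k + ∑ l, r i k l l := by
    intro i k
    simp only [hq, Finset.sum_add_distrib, Finset.sum_mul]
    congr 2
    · congr 1 <;> exact Finset.sum_congr rfl fun l _ => by rw [hW l, hs l]
    · exact Finset.sum_congr rfl fun l _ => mul_comm _ _
  have h3 : ∀ i k, h i k * ∑ l, q l l i k
      = h i k * (∑ l, q i k l l + (∑ l, W l l) * h i k - (∑ l, h l l) * W i k)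
        + (h i k * ∑ l, W l i * h l k - h i k * ∑ l, W l k * h l i) := by
    intro i k; rw [h1, h2]; ring
  simp only [h3, Finset.sum_add_distrib, Finset.sum_sub_distrib, key, sub_self, add_zero]

/-! ### The Simons-type formula at the centre of an adapted graph. -/

section Simons

variable {n : ℕ}

/-- The data of a space-like graph `y ↦ ∑ yₖeₖ + U T` at a point `y₀` where the unit normal is `T`:
`ν` and `V` are the components of the unit normal. -/
structure IsAdaptedGraph (ν : Fin n → EuclideanSpace ℝ (Fin n) → ℝ)
    (U V : EuclideanSpace ℝ (Fin n) → ℝ) (y₀ : EuclideanSpace ℝ (Fin n)) : Prop where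
  contDiff_nu : ∀ k, ContDiff ℝ ∞ (ν k)
  contDiff_U : ContDiff ℝ ∞ U
  contDiff_V : ContDiff ℝ ∞ V
  nu_eq : ∀ k y, ν k y = V y * pderiv k U y
  V_sq : ∀ y, V y * V y = 1 + ∑ k, ν k y * ν k y
  nu_zero : ∀ k, ν k y₀ = 0
  V_one : V y₀ = 1

namespace IsAdaptedGraph

variable {ν : Fin n → EuclideanSpace ℝ (Fin n) → ℝ} {U V : EuclideanSpace ℝ (Fin n) → ℝ}
  {y₀ : EuclideanSpace ℝ (Fin n)} (hA : IsAdaptedGraph ν U V y₀)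

include hA

theorem pderiv_U (k : Fin n) : pderiv k U y₀ = 0 := by
  have := hA.nu_eq k y₀
  rw [hA.nu_zero, hA.V_one, one_mul] at this
  exact this.symm

theorem nu_fun (k : Fin n) : ν k = fun y => V y * pderiv k U y := funext (hA.nu_eq k)

theorem pderiv_V (i : Fin n) : pderiv i V y₀ = 0 := by
  have h : (fun y => V y * V y) = fun y => 1 + ∑ k, ν k y * ν k y := funext hA.V_sq
  have h1 := congrFun (congrArg (pderiv i) h) y₀
  rw [pderiv_mul_fun hA.contDiff_V hA.contDiff_V,
    pderiv_add_fun contDiff_const (ContDiff.sum fun k _ => (hA.contDiff_nu k).mul (hA.contDiff_nu k)),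
    pderiv_sum_fun fun k => (hA.contDiff_nu k).mul (hA.contDiff_nu k)] at h1
  simp only [pderiv_mul_fun (hA.contDiff_nu _) (hA.contDiff_nu _), pderiv_const, hA.nu_zero,
    hA.V_one] at h1
  simp at h1
  linarith

/-- At `y₀` both `∂U` and `∂V` vanish and `V = 1`, so the product rule applied to `νₖ = V ∂ₖU` loses
its other terms. This identifies `h` with the Hessian of `U`. -/
theorem pderiv_nu (i k : Fin n) : pderiv i (ν k) y₀ = pderiv i (pderiv k U) y₀ := by
  rw [hA.nu_fun, pderiv_mul_fun hA.contDiff_V (hA.contDiff_U.pderiv k)]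
  simp only [hA.pderiv_U, hA.V_one]; ring

theorem pderiv_nu_symm (i k : Fin n) : pderiv i (ν k) y₀ = pderiv k (ν i) y₀ := by
  rw [hA.pderiv_nu, hA.pderiv_nu, pderiv_swap hA.contDiff_U]

/-- Differentiate `V² = 1 + |ν|²` twice: the Hessian of `V` at `y₀` is `h²`. -/
theorem pderiv_pderiv_V (j i : Fin n) :
    pderiv j (pderiv i V) y₀ = ∑ k, pderiv j (ν k) y₀ * pderiv i (ν k) y₀ := by
  have h : (fun y => V y * V y) = fun y => 1 + ∑ k, ν k y * ν k y := funext hA.V_sq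
  have hn := hA.contDiff_nu
  have h1 := congrFun (congrArg (fun f => pderiv j (pderiv i f)) h) y₀
  rw [pderiv_pderiv_mul hA.contDiff_V hA.contDiff_V,
    pderiv_add_fun contDiff_const (ContDiff.sum fun k _ => (hn k).mul (hn k)),
    pderiv_sum_fun fun k => (hn k).mul (hn k)] at h1
  simp only [pderiv_const, zero_add] at h1
  rw [pderiv_sum_fun fun k => ((hn k).mul (hn k)).pderiv i] at h1
  simp only [pderiv_pderiv_mul (hn _) (hn _), hA.pderiv_V, hA.V_one, hA.nu_zero] at h1
  have h2 : ∑ k, (pderiv j (pderiv i (ν k)) y₀ * 0 + pderiv i (ν k) y₀ * pderiv j (ν k) y₀ +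
      (pderiv j (ν k) y₀ * pderiv i (ν k) y₀ + 0 * pderiv j (pderiv i (ν k)) y₀))
      = 2 * ∑ k, pderiv j (ν k) y₀ * pderiv i (ν k) y₀ := by
    rw [Finset.mul_sum]; exact Finset.sum_congr rfl fun k _ => by ring
  rw [h2] at h1
  linarith

theorem pderiv_pderiv_nu (j i k : Fin n) :
    pderiv j (pderiv i (ν k)) y₀ = pderiv j (pderiv i (pderiv k U)) y₀ := by
  rw [hA.nu_fun, pderiv_pderiv_mul hA.contDiff_V (hA.contDiff_U.pderiv k)]
  simp only [hA.pderiv_U, hA.pderiv_V, hA.V_one]; ring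

/-- The Codazzi equation: with equality of mixed partials, `∇h` is totally symmetric. -/
theorem pderiv_pderiv_nu_swap (j i k : Fin n) :
    pderiv j (pderiv i (ν k)) y₀ = pderiv j (pderiv k (ν i)) y₀ := by
  rw [hA.pderiv_pderiv_nu, hA.pderiv_pderiv_nu, pderiv_swap hA.contDiff_U i k]

/-- The fourth derivatives of `U` are symmetric, so all the curvature terms in commuting derivatives
of `h` come from the products of `h` with the Hessian of `V`. -/
theorem pderiv_pderiv_pderiv_nu (l j i k : Fin n) :
    pderiv l (pderiv j (pderiv i (ν k))) y₀
      = pderiv j (pderiv i V) y₀ * pderiv l (ν k) y₀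
        + pderiv l (pderiv i V) y₀ * pderiv j (ν k) y₀
        + pderiv l (pderiv j V) y₀ * pderiv i (ν k) y₀
        + pderiv l (pderiv j (pderiv i (pderiv k U))) y₀ := by
  rw [hA.pderiv_nu, hA.pderiv_nu, hA.pderiv_nu, hA.nu_fun,
    pderiv_pderiv_pderiv_mul hA.contDiff_V (hA.contDiff_U.pderiv k)]
  simp only [hA.pderiv_U, hA.pderiv_V, hA.V_one]; ring

/-- The Hessian of the support function `⟨x, N⟩ = ∑ yₘνₘ - U V`. -/
theorem pderiv_pderiv_support (j i : Fin n) :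
    pderiv j (pderiv i (fun y : EuclideanSpace ℝ (Fin n) => ∑ m, y m * ν m y - U y * V y)) y₀
      = pderiv i (ν j) y₀ + ∑ m, y₀ m * pderiv j (pderiv i (ν m)) y₀
        - U y₀ * pderiv j (pderiv i V) y₀ := by
  have hn := hA.contDiff_nu
  have hU := hA.contDiff_U
  have hV := hA.contDiff_V
  -- In the first derivative `νᵢ - V ∂ᵢU` cancels at every point, not only at `y₀`: only `N` needs
  -- to be differentiated, since `∂ᵢx` is orthogonal to it.
  have h1 : pderiv i (fun y : EuclideanSpace ℝ (Fin n) => ∑ m, y m * ν m y - U y * V y)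
      = fun y => ∑ m, y m * pderiv i (ν m) y - U y * pderiv i V y := by
    rw [pderiv_sub_fun (ContDiff.sum fun m _ => (contDiff_coord m).mul (hn m)) (hU.mul hV),
      pderiv_sum_fun fun m => (contDiff_coord m).mul (hn m), pderiv_mul_fun hU hV]
    funext y
    simp only [pderiv_mul_fun (contDiff_coord _) (hn _), pderiv_coord, Finset.sum_add_distrib]
    simp only [ite_mul, one_mul, zero_mul, Finset.sum_ite_eq, Finset.mem_univ, if_true]
    rw [hA.nu_eq]; ring
  rw [h1, pderiv_sub_fun (ContDiff.sum fun m _ => (contDiff_coord m).mul ((hn m).pderiv i))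
      (hU.mul (hV.pderiv i)), pderiv_sum_fun fun m => (contDiff_coord m).mul ((hn m).pderiv i),
    pderiv_mul_fun hU (hV.pderiv i)]
  simp only [pderiv_mul_fun (contDiff_coord _) ((hn _).pderiv i), pderiv_coord,
    Finset.sum_add_distrib, hA.pderiv_U]
  simp only [ite_mul, one_mul, zero_mul, Finset.sum_ite_eq, Finset.mem_univ, if_true]
  ring

/-- The Hessian of the mean curvature of a `λ`-hypersurface. -/
theorem hessian_meanCurvature {s lam : ℝ}
    (hH : ∀ y, ∑ k, pderiv k (ν k) y = lam + s * (∑ m, y m * ν m y - U y * V y)) (j i : Fin n) :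
    ∑ k, pderiv j (pderiv i (pderiv k (ν k))) y₀
      = s * (pderiv j (ν i) y₀ + ∑ m, y₀ m * pderiv j (pderiv i (ν m)) y₀
        - U y₀ * ∑ k, pderiv j (ν k) y₀ * pderiv i (ν k) y₀) := by
  have hn := hA.contDiff_nu
  have hC : ContDiff ℝ ∞ fun y : EuclideanSpace ℝ (Fin n) => ∑ m, y m * ν m y - U y * V y :=
    (ContDiff.sum fun m _ => (contDiff_coord m).mul (hn m)).sub (hA.contDiff_U.mul hA.contDiff_V)
  have h := congrFun (congrArg (fun f => pderiv j (pderiv i f)) (funext hH)) y₀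
  rw [pderiv_sum_fun fun k => (hn k).pderiv k, pderiv_sum_fun fun k => ((hn k).pderiv k).pderiv i,
    pderiv_add_fun contDiff_const (contDiff_const.mul hC), pderiv_const_mul_fun s hC] at h
  simp only [pderiv_const, zero_add] at h
  rw [pderiv_const_mul_fun s (hC.pderiv i)] at h
  beta_reduce at h
  rw [hA.pderiv_pderiv_support, hA.pderiv_nu_symm i j,
    hA.pderiv_pderiv_V] at h
  exact h

/-- The Simons-type formula for `B = S - H²/n` on a `λ`-hypersurface. -/
theorem simons {s lam : ℝ}
    (hH : ∀ y, ∑ k, pderiv k (ν k) y = lam + s * (∑ m, y m * ν m y - U y * V y)) :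
    let h : Fin n → Fin n → ℝ := fun i k => pderiv i (ν k) y₀
    let t : Fin n → Fin n → Fin n → ℝ := fun i j k => pderiv i (pderiv j (ν k)) y₀
    let B : EuclideanSpace ℝ (Fin n) → ℝ := fun y =>
      ∑ i, ∑ k, pderiv i (ν k) y * pderiv k (ν i) y - (∑ k, pderiv k (ν k) y) ^ 2 / n
    ∑ l, pderiv l (pderiv l B) y₀ - s * ∑ m, y₀ m * pderiv m B y₀
      = 2 * (∑ l, ∑ i, ∑ k, t l i k ^ 2 - (∑ m, (∑ k, t m k k) ^ 2) / n
        + (∑ i, ∑ k, h i k ^ 2 + s) * (∑ i, ∑ k, h i k ^ 2 - (∑ k, h k k) ^ 2 / n)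
        - lam * (∑ i, ∑ k, h i k * ∑ m, h i m * h k m
          - (∑ k, h k k) * (∑ i, ∑ k, h i k ^ 2) / n)) := by
  intro h t B
  have hn := hA.contDiff_nu
  have hhs : ∀ i k, h i k = h k i := hA.pderiv_nu_symm
  have hts : ∀ i j k, t i j k = t i k j := hA.pderiv_pderiv_nu_swap
  set W : Fin n → Fin n → ℝ := fun i j => ∑ m, h i m * h j m with hW
  have hWs : ∀ i j, W i j = W j i := fun i j => Finset.sum_congr rfl fun m _ => mul_comm _ _
  set q : Fin n → Fin n → Fin n → Fin n → ℝ := fun l j i k =>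
    pderiv l (pderiv j (pderiv i (ν k))) y₀ with hq
  set Hf : EuclideanSpace ℝ (Fin n) → ℝ := fun y => ∑ k, pderiv k (ν k) y with hHf
  have hHc : ContDiff ℝ ∞ Hf := ContDiff.sum fun k _ => (hn k).pderiv k
  have hSc : ∀ i k, ContDiff ℝ ∞ fun y => pderiv i (ν k) y * pderiv k (ν i) y := fun i k =>
    ((hn k).pderiv i).mul ((hn i).pderiv k)
  have hSc' : ∀ i, ContDiff ℝ ∞ fun y => ∑ k, pderiv i (ν k) y * pderiv k (ν i) y := fun i =>
    ContDiff.sum fun k _ => hSc i k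
  have hBfun : B = fun y => ∑ i, ∑ k, pderiv i (ν k) y * pderiv k (ν i) y
      - (1 / (n : ℝ)) * (Hf y * Hf y) := by
    funext y; simp only [B, hHf]; ring
  have hHd : ∀ m, pderiv m Hf = fun y => ∑ k, pderiv m (pderiv k (ν k)) y := fun m =>
    pderiv_sum_fun (fun k => (hn k).pderiv k) m
  have hHdd : ∀ l, pderiv l (pderiv l Hf) y₀ = ∑ k, q l l k k := fun l => by
    rw [hHd, pderiv_sum_fun fun k => ((hn k).pderiv k).pderiv l]
  have hB1 : ∀ m, pderiv m B = fun y => ∑ i, ∑ k, pderiv m (fun y => pderiv i (ν k) y *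
      pderiv k (ν i) y) y - (1 / (n : ℝ)) * pderiv m (fun y => Hf y * Hf y) y := by
    intro m
    rw [hBfun, pderiv_sub_fun (ContDiff.sum fun i _ => hSc' i)
      (contDiff_const.mul (hHc.mul hHc)), pderiv_sum_fun hSc', pderiv_const_mul_fun _ (hHc.mul hHc)]
    funext y
    congr 1
    exact Finset.sum_congr rfl fun i _ => by rw [pderiv_sum_fun (hSc i)]
  have hB2 : ∀ m, pderiv m B y₀ = 2 * ∑ i, ∑ k, h i k * t i k m
      - (1 / (n : ℝ)) * (2 * (∑ k, h k k) * ∑ k, t m k k) := by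
    intro m
    rw [hB1, pderiv_mul_fun hHc hHc]
    simp only [pderiv_mul_fun ((hn _).pderiv _) ((hn _).pderiv _)]
    congr 1
    · rw [Finset.mul_sum]
      refine Finset.sum_congr rfl fun i _ => ?_
      rw [Finset.mul_sum]
      refine Finset.sum_congr rfl fun k _ => ?_
      change t m i k * h k i + h i k * t m k i = _
      have : t i k m = t m i k := by
        rw [hts i k m]
        exact congrFun (pderiv_swap (hn k) i m) y₀
      rw [this, hhs k i, hts m k i]; ring
    · rw [hHd]
      change 1 / (n : ℝ) * ((∑ k, t m k k) * (∑ k, h k k) + (∑ k, h k k) * ∑ k, t m k k) = _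
      ring
  have hB3 : ∀ l, pderiv l (pderiv l B) y₀
      = 2 * ∑ i, ∑ k, h i k * q l l i k + 2 * ∑ i, ∑ k, t l i k ^ 2
        - (1 / (n : ℝ)) * (2 * (∑ k, h k k) * ∑ k, q l l k k + 2 * (∑ k, t l k k) ^ 2) := by
    intro l
    have hc1 : ∀ i k, ContDiff ℝ ∞ (pderiv l fun y => pderiv i (ν k) y * pderiv k (ν i) y) :=
      fun i k => (hSc i k).pderiv l
    rw [hB1, pderiv_sub_fun (ContDiff.sum fun i _ => ContDiff.sum fun k _ => hc1 i k)
      (contDiff_const.mul ((hHc.mul hHc).pderiv l)),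
      pderiv_sum_fun (fun i => ContDiff.sum fun k _ => hc1 i k),
      pderiv_const_mul_fun _ ((hHc.mul hHc).pderiv l), pderiv_pderiv_mul hHc hHc]
    simp only [pderiv_sum_fun (hc1 _), pderiv_pderiv_mul ((hn _).pderiv _) ((hn _).pderiv _), hHdd]
    rw [hHd]
    congr 1
    · have hsw : ∑ i, ∑ k, h i k * q l l k i = ∑ i, ∑ k, h i k * q l l i k := by
        rw [Finset.sum_comm]
        exact Finset.sum_congr rfl fun k _ => Finset.sum_congr rfl fun i _ => by rw [hhs]
      have : ∀ i k, (pderiv l (pderiv l (pderiv i (ν k))) y₀ * pderiv k (ν i) y₀ +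
          pderiv l (pderiv i (ν k)) y₀ * pderiv l (pderiv k (ν i)) y₀ +
          (pderiv l (pderiv i (ν k)) y₀ * pderiv l (pderiv k (ν i)) y₀ +
          pderiv i (ν k) y₀ * pderiv l (pderiv l (pderiv k (ν i))) y₀))
          = h i k * q l l i k + h i k * q l l k i + 2 * t l i k ^ 2 := by
        intro i k
        change q l l i k * h k i + t l i k * t l k i + (t l i k * t l k i + h i k * q l l k i) = _
        rw [hhs k i, hts l k i]; ring
      simp only [this, Finset.sum_add_distrib, hsw, ← Finset.mul_sum]
      ring
    · change 1 / (n : ℝ) * ((∑ k, q l l k k) * (∑ k, h k k) + (∑ k, t l k k) * (∑ k, t l k k)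
        + ((∑ k, t l k k) * (∑ k, t l k k) + (∑ k, h k k) * ∑ k, q l l k k)) = _
      ring
  have hqW : ∀ l j i k, q l j i k = W j i * h l k + W l i * h j k + W l j * h i k
      + pderiv l (pderiv j (pderiv i (pderiv k U))) y₀ := by
    intro l j i k
    simp only [hq, hA.pderiv_pderiv_pderiv_nu, hA.pderiv_pderiv_V]
    rfl
  have hU := hA.contDiff_U
  have hr : ∀ i k l, pderiv l (pderiv l (pderiv i (pderiv k U))) y₀
      = pderiv i (pderiv k (pderiv l (pderiv l U))) y₀ := by
    intro i k l
    rw [pderiv_swap (hU.pderiv k) l i, pderiv_swap ((hU.pderiv k).pderiv l) l i,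
      pderiv_swap hU l k, pderiv_swap (hU.pderiv l) l k]
  have hcomm := sum_mul_third_derivative hhs hWs hr hqW
  have hess : ∀ i k, ∑ l, q i k l l = s * (h i k + ∑ m, y₀ m * t i k m - U y₀ * W i k) :=
    fun i k => hA.hessian_meanCurvature hH i k
  have hWtr : ∑ l, W l l = ∑ i, ∑ k, h i k ^ 2 := by
    simp only [hW, sq]
  -- The `λ`-equation at `y₀`, where `ν = 0` and `V = 1`, so that `⟨x, N⟩ = -U`.
  have hHval : ∑ k, h k k = lam - s * U y₀ := by
    have := hH y₀
    simp only [hA.nu_zero, mul_zero, Finset.sum_const_zero, hA.V_one] at this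
    rw [show ∑ k, h k k = ∑ k, pderiv k (ν k) y₀ from rfl, this]; ring
  set S := ∑ i, ∑ k, h i k ^ 2 with hS
  set H := ∑ k, h k k with hHdef
  -- `P` collects the terms with `∇h` along the tangential part of `x`. These, and the analogous
  -- terms with `∇H`, cancel against the drift term of `𝓛`.
  set P := ∑ m, y₀ m * ∑ i, ∑ k, h i k * t i k m with hP
  set Q := ∑ i, ∑ k, h i k * W i k with hQ
  have e1 : ∑ i, ∑ k, h i k * ∑ l, q l l i k = s * (S + P - U y₀ * Q) + S * S - H * Q := by
    rw [hcomm]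
    have : ∀ i k, h i k * (∑ l, q i k l l + (∑ l, W l l) * h i k - H * W i k)
        = (s + S) * h i k ^ 2 + s * (h i k * ∑ m, y₀ m * t i k m)
          - (s * U y₀ + H) * (h i k * W i k) := by
      intro i k; rw [hess, hWtr]; ring
    have hPsum : ∑ i, ∑ k, h i k * ∑ m, y₀ m * t i k m = P := by
      simp only [hP, Finset.mul_sum]
      rw [Finset.sum_comm' (t' := Finset.univ) (s' := fun _ => Finset.univ) (by simp)]
      rw [Finset.sum_comm]
      conv_rhs => rw [Finset.sum_comm]
      refine Finset.sum_congr rfl fun i _ => ?_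
      rw [Finset.sum_comm]
      refine Finset.sum_congr rfl fun k _ => Finset.sum_congr rfl fun m _ => by ring
    simp only [this, Finset.sum_add_distrib, Finset.sum_sub_distrib, ← Finset.mul_sum]
    rw [hPsum]; ring
  have e2 : ∑ l, ∑ k, q l l k k = s * (H + ∑ m, y₀ m * ∑ k, t m k k - U y₀ * S) := by
    simp only [hess, ← Finset.mul_sum, Finset.sum_add_distrib, Finset.sum_sub_distrib, hWtr]
    congr 3
    rw [Finset.sum_comm]
    refine Finset.sum_congr rfl fun m _ => ?_
    rw [← Finset.mul_sum]
    congr 1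
    refine Finset.sum_congr rfl fun l _ => ?_
    rw [hts l l m]
    exact congrFun (pderiv_swap (hn l) l m) y₀
  have e3 : ∑ l, ∑ i, ∑ k, h i k * q l l i k = ∑ i, ∑ k, h i k * ∑ l, q l l i k := by
    rw [Finset.sum_comm]
    refine Finset.sum_congr rfl fun i _ => ?_
    rw [Finset.sum_comm]
    exact Finset.sum_congr rfl fun k _ => by rw [Finset.mul_sum]
  have e4 : ∑ m, y₀ m * pderiv m B y₀
      = 2 * P - (1 / (n : ℝ)) * (2 * H * ∑ m, y₀ m * ∑ k, t m k k) := by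
    simp only [hB2, mul_sub, Finset.sum_sub_distrib]
    congr 1
    · rw [hP, Finset.mul_sum]; exact Finset.sum_congr rfl fun m _ => by ring
    · have hT : ∀ (c : ℝ) (T : Fin n → ℝ), ∑ m, y₀ m * ((1 / (n : ℝ)) * (c * T m))
          = (1 / (n : ℝ)) * (c * ∑ m, y₀ m * T m) := by
        intro c T
        simp only [Finset.mul_sum]
        exact Finset.sum_congr rfl fun m _ => by ring
      exact hT _ _
  rw [e4]
  simp only [hB3, Finset.sum_sub_distrib, Finset.sum_add_distrib, ← Finset.mul_sum]
  rw [e3, e1, e2]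
  -- By `H + sU = λ`, the two cubic terms `-sU tr h³` and `-H tr h³` combine into `-λ tr h³`.
  rw [hHval]
  ring

end IsAdaptedGraph

end Simons

end SpacelikeHypersurface

namespace SpacelikeHypersurface

/-! ### Algebraic inequalities for the trace-free second fundamental form. -/

section Okumura

/-- Okumura's inequality for the sum of the cubes of real numbers with vanishing sum. -/
theorem sum_cube_le {n : ℕ} (hn : 2 ≤ n) {μ : Fin n → ℝ} (h0 : ∑ i, μ i = 0) :
    ∑ i, μ i ^ 3 ≤ ((n : ℝ) - 2) / Real.sqrt ((n : ℝ) * ((n : ℝ) - 1)) * (∑ i, μ i ^ 2)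
      * Real.sqrt (∑ i, μ i ^ 2) := by
  have hn2 : (2 : ℝ) ≤ n := by exact_mod_cast hn
  set R := Real.sqrt ((n : ℝ) * ((n : ℝ) - 1)) with hR
  have hR2 : R ^ 2 = n * ((n : ℝ) - 1) := Real.sq_sqrt (by nlinarith)
  have hRpos : 0 < R := Real.sqrt_pos.2 (by nlinarith)
  set β := Real.sqrt (∑ i, μ i ^ 2) with hβ
  have hsum : 0 ≤ ∑ i, μ i ^ 2 := Finset.sum_nonneg fun i _ => sq_nonneg _
  have hβ2 : ∑ i, μ i ^ 2 = β ^ 2 := (Real.sq_sqrt hsum).symm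
  have hβ0 : 0 ≤ β := Real.sqrt_nonneg _
  -- Cauchy–Schwarz for the other `n - 1` numbers, whose sum is `-μ i`.
  have hle : ∀ i, μ i ≤ ((n : ℝ) - 1) * β / R := by
    intro i
    have h1 : (∑ j ∈ Finset.univ.erase i, μ j) ^ 2
        ≤ ((Finset.univ.erase i).card : ℝ) * ∑ j ∈ Finset.univ.erase i, μ j ^ 2 :=
      sq_sum_le_card_mul_sum_sq
    have h2 := Finset.add_sum_erase Finset.univ μ (Finset.mem_univ i)
    have h3 := Finset.add_sum_erase Finset.univ (fun j => μ j ^ 2) (Finset.mem_univ i)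
    have h4 : ((Finset.univ.erase i).card : ℝ) = n - 1 := by
      rw [Finset.card_erase_of_mem (Finset.mem_univ i), Finset.card_univ, Fintype.card_fin,
        Nat.cast_sub (by omega), Nat.cast_one]
    have h5 : ∑ j ∈ Finset.univ.erase i, μ j = -μ i := by linarith
    have h6 : ∑ j ∈ Finset.univ.erase i, μ j ^ 2 = β ^ 2 - μ i ^ 2 := by linarith
    rw [h4, h5, h6] at h1
    rw [le_div_iff₀ hRpos]
    refine le_of_sq_le_sq ?_ (mul_nonneg (by linarith) hβ0)
    have : (μ i * R) ^ 2 = μ i ^ 2 * (n * ((n : ℝ) - 1)) := by rw [mul_pow, hR2]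
    rw [this]
    nlinarith
  -- Each factor vanishes in the extremal configuration: one entry `(n-1)β/R` and all the others
  -- `-β/R`. Expanding the sum gives the inequality.
  have hnonneg : 0 ≤ ∑ i, (μ i + β / R) ^ 2 * (((n : ℝ) - 1) * β / R - μ i) :=
    Finset.sum_nonneg fun i _ => mul_nonneg (sq_nonneg _) (by linarith [hle i])
  have hexp : ∑ i, (μ i + β / R) ^ 2 * (((n : ℝ) - 1) * β / R - μ i)
      = -∑ i, μ i ^ 3 + ((n : ℝ) - 3) * β / R * ∑ i, μ i ^ 2
        + (2 * (β / R) * (((n : ℝ) - 1) * β / R) - (β / R) ^ 2) * ∑ i, μ i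
        + n * ((β / R) ^ 2 * (((n : ℝ) - 1) * β / R)) := by
    have : ∀ i, (μ i + β / R) ^ 2 * (((n : ℝ) - 1) * β / R - μ i)
        = -μ i ^ 3 + ((n : ℝ) - 3) * β / R * μ i ^ 2
        + (2 * (β / R) * (((n : ℝ) - 1) * β / R) - (β / R) ^ 2) * μ i
        + (β / R) ^ 2 * (((n : ℝ) - 1) * β / R) := by intro i; ring
    simp only [this, Finset.sum_add_distrib, ← Finset.mul_sum, Finset.sum_neg_distrib,
      Finset.sum_const, Finset.card_univ, Fintype.card_fin, nsmul_eq_mul]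
    ring
  rw [hexp, h0, hβ2] at hnonneg
  have hlast : n * ((β / R) ^ 2 * (((n : ℝ) - 1) * β / R)) = β ^ 3 / R := by
    have : n * ((β / R) ^ 2 * (((n : ℝ) - 1) * β / R)) = (n * ((n : ℝ) - 1)) * β ^ 3 / R ^ 3 := by
      field_simp
    rw [this, ← hR2]; field_simp
  rw [hlast] at hnonneg
  rw [hβ2]
  have : ((n : ℝ) - 2) / R * β ^ 2 * β = ((n : ℝ) - 3) * β / R * β ^ 2 + β ^ 3 / R := by
    field_simp; ring
  rw [this]; linarith

theorem abs_sum_cube_le {n : ℕ} (hn : 2 ≤ n) {μ : Fin n → ℝ} (h0 : ∑ i, μ i = 0) :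
    |∑ i, μ i ^ 3| ≤ ((n : ℝ) - 2) / Real.sqrt ((n : ℝ) * ((n : ℝ) - 1)) * (∑ i, μ i ^ 2)
      * Real.sqrt (∑ i, μ i ^ 2) := by
  rw [abs_le]
  have h1 := sum_cube_le hn h0
  have h2 := sum_cube_le hn (μ := fun i => -μ i) (by simp [h0])
  simp only [even_two.neg_pow, (by decide : Odd 3).neg_pow, Finset.sum_neg_distrib] at h2
  exact ⟨by linarith, h1⟩

/-- The power sums of a symmetric matrix are those of its eigenvalues. -/
theorem exists_eigenvalues {n : ℕ} {h : Fin n → Fin n → ℝ} (hs : ∀ i k, h i k = h k i) :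
    ∃ μ : Fin n → ℝ, ∑ k, h k k = ∑ i, μ i ∧ ∑ i, ∑ k, h i k ^ 2 = ∑ i, μ i ^ 2 ∧
      ∑ i, ∑ k, h i k * ∑ m, h i m * h k m = ∑ i, μ i ^ 3 := by
  set A : Matrix (Fin n) (Fin n) ℝ := Matrix.of h with hA
  have hAh : A.IsHermitian := by ext i k; simp [hA, hs]
  set D := Matrix.diagonal hAh.eigenvalues with hD
  obtain ⟨C, C', hC, hACD⟩ : ∃ C C' : Matrix (Fin n) (Fin n) ℝ, C' * C = 1 ∧ A = C * D * C' := by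
    refine ⟨hAh.eigenvectorUnitary, star (hAh.eigenvectorUnitary : Matrix (Fin n) (Fin n) ℝ),
      Unitary.coe_star_mul_self _, ?_⟩
    have := hAh.spectral_theorem
    rw [Unitary.conjStarAlgAut_apply] at this
    simpa [hD] using this
  have hpow : ∀ X : Matrix (Fin n) (Fin n) ℝ, (C * X * C').trace = X.trace := fun X => by
    rw [Matrix.trace_mul_comm, ← mul_assoc, hC, one_mul]
  have hmul : ∀ X Y : Matrix (Fin n) (Fin n) ℝ, (C * X * C') * (C * Y * C') = C * (X * Y) * C' :=
    fun X Y => by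
      calc (C * X * C') * (C * Y * C') = C * X * (C' * C) * Y * C' := by simp only [mul_assoc]
        _ = _ := by rw [hC]; simp only [mul_assoc, mul_one]
  refine ⟨hAh.eigenvalues, ?_, ?_, ?_⟩
  · have : A.trace = D.trace := by rw [hACD, hpow]
    simpa [Matrix.trace, hA, hD] using this
  · have : (A * A).trace = (D * D).trace := by rw [hACD, hmul, hpow]
    simp only [Matrix.trace, hD, Matrix.diagonal_mul_diagonal, Matrix.diag_apply,
      Matrix.mul_apply, Matrix.diagonal_apply_eq, hA, Matrix.of_apply] at this
    simp only [sq]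
    rw [← this]
    exact Finset.sum_congr rfl fun i _ => Finset.sum_congr rfl fun k _ => by rw [hs k i]
  · have : (A * (A * A)).trace = (D * (D * D)).trace := by rw [hACD, hmul, hmul, hpow]
    simp only [Matrix.trace, hD, Matrix.diagonal_mul_diagonal, Matrix.diag_apply,
      Matrix.mul_apply, Matrix.diagonal_apply_eq, hA, Matrix.of_apply] at this
    simp only [pow_succ, pow_zero, one_mul, mul_assoc]
    rw [← this]
    refine Finset.sum_congr rfl fun i _ => Finset.sum_congr rfl fun k _ => ?_
    congr 1
    exact Finset.sum_congr rfl fun m _ => by rw [hs i m, mul_comm]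

/-- The expression is the squared norm of the trace-free part of `h`, so it is nonnegative and
vanishes exactly on multiples of the identity. -/
theorem sum_sq_sub_trace_eq {n : ℕ} (hn : 2 ≤ n) (h : Fin n → Fin n → ℝ) :
    ∑ i, ∑ k, h i k ^ 2 - (∑ k, h k k) ^ 2 / n
      = ∑ i, ∑ k, (h i k - if i = k then (∑ j, h j j) / n else 0) ^ 2 := by
  have hn0 : (n : ℝ) ≠ 0 := by positivity
  set T := ∑ j, h j j with hT
  have : ∀ i k, (h i k - if i = k then T / n else 0) ^ 2
      = h i k ^ 2 - (if i = k then 2 * (T / n) * h i i - (T / n) ^ 2 else 0) := by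
    intro i k
    split_ifs with hik
    · subst hik; ring
    · ring
  simp only [this, Finset.sum_sub_distrib, Finset.sum_ite_eq, Finset.mem_univ, if_true,
    ← Finset.mul_sum, ← hT, Finset.sum_const, Finset.card_univ, Fintype.card_fin, nsmul_eq_mul]
  field_simp; ring

theorem sum_sq_sub_trace_nonneg {n : ℕ} (hn : 2 ≤ n) (h : Fin n → Fin n → ℝ) :
    0 ≤ ∑ i, ∑ k, h i k ^ 2 - (∑ k, h k k) ^ 2 / n := by
  rw [sum_sq_sub_trace_eq hn]
  exact Finset.sum_nonneg fun i _ => Finset.sum_nonneg fun k _ => sq_nonneg _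

theorem eq_ite_of_sum_sq_sub_trace {n : ℕ} (hn : 2 ≤ n) {h : Fin n → Fin n → ℝ}
    (h0 : ∑ i, ∑ k, h i k ^ 2 - (∑ k, h k k) ^ 2 / n = 0) (i k : Fin n) :
    h i k = if i = k then (∑ j, h j j) / n else 0 := by
  rw [sum_sq_sub_trace_eq hn, Finset.sum_eq_zero_iff_of_nonneg fun i _ =>
    Finset.sum_nonneg fun k _ => sq_nonneg _] at h0
  have h1 := h0 i (Finset.mem_univ i)
  rw [Finset.sum_eq_zero_iff_of_nonneg fun k _ => sq_nonneg _] at h1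
  exact sub_eq_zero.1 (pow_eq_zero_iff two_ne_zero |>.1 (h1 k (Finset.mem_univ k)))

/-- This is `|∇h|² ≥ |∇H|²/n`: the previous inequality for each matrix `t l`. -/
theorem sum_sum_sq_sub_trace_nonneg {n : ℕ} (hn : 2 ≤ n) (t : Fin n → Fin n → Fin n → ℝ) :
    0 ≤ ∑ l, ∑ i, ∑ k, t l i k ^ 2 - (∑ m, (∑ k, t m k k) ^ 2) / n := by
  rw [Finset.sum_div, ← Finset.sum_sub_distrib]
  exact Finset.sum_nonneg fun l _ => sum_sq_sub_trace_nonneg hn (t l)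

/-- The zeroth-order term of the Simons-type formula is bounded below. -/
theorem simons_reaction_ge {n : ℕ} (hn : 2 ≤ n) {h : Fin n → Fin n → ℝ}
    (hs : ∀ i k, h i k = h k i) (s lam : ℝ) {H S B : ℝ} (hH : H = ∑ k, h k k)
    (hS : S = ∑ i, ∑ k, h i k ^ 2) (hB : B = S - H ^ 2 / n) :
    B * ((Real.sqrt B - |lam| * (((n : ℝ) - 2) / (2 * Real.sqrt ((n : ℝ) * ((n : ℝ) - 1))))) ^ 2
        + 1 / (n : ℝ) * (H - lam) ^ 2 - (n : ℝ) * lam ^ 2 / (4 * ((n : ℝ) - 1)) + s)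
      ≤ (S + s) * B - lam * (∑ i, ∑ k, h i k * ∑ m, h i m * h k m - H * S / n) := by
  have hn2 : (2 : ℝ) ≤ n := by exact_mod_cast hn
  have hn0 : (0 : ℝ) < n := by linarith
  have hn1 : (0 : ℝ) < n - 1 := by linarith
  have hB0 : 0 ≤ B := by rw [hB, hS, hH]; exact sum_sq_sub_trace_nonneg hn h
  obtain ⟨μ, h1, h2, h3⟩ := exists_eigenvalues hs
  set f3 := ∑ i, ∑ k, h i k * ∑ m, h i m * h k m
  rw [h1] at hH
  rw [h2] at hS
  have ht0 : ∑ i, (μ i - H / n) = 0 := by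
    rw [Finset.sum_sub_distrib, ← hH]; simp; field_simp; ring
  have ht2 : ∑ i, (μ i - H / n) ^ 2 = B := by
    have : ∀ i, (μ i - H / n) ^ 2 = μ i ^ 2 - 2 * (H / n) * μ i + (H / n) ^ 2 := fun i => by ring
    simp only [this, Finset.sum_add_distrib, Finset.sum_sub_distrib, ← Finset.mul_sum, ← hS, ← hH,
      Finset.sum_const, Finset.card_univ, Fintype.card_fin, nsmul_eq_mul]
    rw [hB]; field_simp; ring
  -- Okumura's bound concerns the trace-free eigenvalues; passing from `tr h³` to their cubes
  -- produces the extra term `2HB/n`.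
  have ht3 : ∑ i, (μ i - H / n) ^ 3 = f3 - H * S / n - 2 * H * B / n := by
    have : ∀ i, (μ i - H / n) ^ 3 = μ i ^ 3 - 3 * (H / n) * μ i ^ 2 + 3 * (H / n) ^ 2 * μ i
        - (H / n) ^ 3 := fun i => by ring
    simp only [this, Finset.sum_add_distrib, Finset.sum_sub_distrib, ← Finset.mul_sum, ← hS, ← hH,
      Finset.sum_const, Finset.card_univ, Fintype.card_fin, nsmul_eq_mul, ← h3]
    rw [hB]; field_simp; ring
  have hok := abs_sum_cube_le hn ht0
  rw [ht2, ht3] at hok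
  set R := Real.sqrt ((n : ℝ) * ((n : ℝ) - 1)) with hR
  have hR2 : R ^ 2 = n * ((n : ℝ) - 1) := Real.sq_sqrt (by nlinarith)
  have hRpos : 0 < R := Real.sqrt_pos.2 (by nlinarith)
  set b := Real.sqrt B with hb
  have hb2 : b ^ 2 = B := Real.sq_sqrt hB0
  have hlam : lam * (f3 - H * S / n - 2 * H * B / n) ≤ |lam| * (((n : ℝ) - 2) / R * B * b) := by
    refine (le_abs_self _).trans ?_
    rw [abs_mul]
    exact mul_le_mul_of_nonneg_left hok (abs_nonneg _)
  have hsq : (|lam| * (((n : ℝ) - 2) / (2 * R))) ^ 2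
      = lam ^ 2 * ((n : ℝ) - 2) ^ 2 / (4 * (n * ((n : ℝ) - 1))) := by
    rw [mul_pow, sq_abs, div_pow, mul_pow, hR2]; ring
  -- The `λ²` terms cancel because `(n-2)² + 4(n-1) = n²`.
  have hexp : (b - |lam| * (((n : ℝ) - 2) / (2 * R))) ^ 2
        + 1 / (n : ℝ) * (H - lam) ^ 2 - (n : ℝ) * lam ^ 2 / (4 * ((n : ℝ) - 1)) + s
      = B - |lam| * (((n : ℝ) - 2) / R * b) + H ^ 2 / n - 2 * H * lam / n + s := by
    rw [sub_sq, hsq, hb2]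
    field_simp
    ring
  rw [hexp]
  have hS' : S = B + H ^ 2 / n := by rw [hB]; ring
  have : (S + s) * B - lam * (f3 - H * S / n)
      = (B + H ^ 2 / n + s) * B - lam * (f3 - H * S / n - 2 * H * B / n)
        - lam * (2 * H * B / n) := by rw [← hS']; ring
  rw [this]
  have e : B * (B - |lam| * (((n : ℝ) - 2) / R * b) + H ^ 2 / n - 2 * H * lam / n + s)
      = (B + H ^ 2 / n + s) * B - |lam| * (((n : ℝ) - 2) / R * B * b) - lam * (2 * H * B / n) := by
    ring
  rw [e]; linarith

/-- A Codazzi tensor with pure-trace covariant derivative is parallel in dimension at least two. -/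
theorem eq_zero_of_sum_sq_sub_trace {n : ℕ} (hn : 2 ≤ n) {t : Fin n → Fin n → Fin n → ℝ}
    (h2 : ∀ l i k, t l i k = t i l k)
    (h0 : ∑ l, ∑ i, ∑ k, t l i k ^ 2 - (∑ m, (∑ k, t m k k) ^ 2) / n ≤ 0) (l i k : Fin n) :
    t l i k = 0 := by
  have hz : ∀ l i k, t l i k = if i = k then (∑ j, t l j j) / n else 0 := by
    intro l i k
    refine eq_ite_of_sum_sq_sub_trace hn ?_ i k
    rw [Finset.sum_div, ← Finset.sum_sub_distrib] at h0
    exact (Finset.sum_eq_zero_iff_of_nonneg fun l _ => sum_sq_sub_trace_nonneg hn (t l)).1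
      (le_antisymm h0 (Finset.sum_nonneg fun l _ => sum_sq_sub_trace_nonneg hn (t l))) l
      (Finset.mem_univ l)
  have htr : ∀ l, (∑ j, t l j j) / n = 0 := by
    intro l
    -- For `j ≠ l` the symmetry turns the diagonal entry `t l j j`, which is the trace over `n`,
    -- into the off-diagonal entry `t j l j`, which is zero.
    obtain ⟨j, hj⟩ : ∃ j : Fin n, j ≠ l := by
      have : Nontrivial (Fin n) := Fin.nontrivial_iff_two_le.2 hn
      exact exists_ne l
    have ha := hz l j j
    rw [if_pos rfl] at ha
    rw [← ha, h2, hz, if_neg hj.symm]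
  rw [hz, htr]; simp

end Okumura

/-! ### The Simons-type inequality on the hypersurface. -/

section PointwiseInequality

variable {n : ℕ} {M : Type*} [TopologicalSpace M] [ChartedSpace (EuclideanSpace ℝ (Fin n)) M]
  [IsManifold (𝓡 n) ∞ M] [T2Space M] [ConnectedSpace M] {x N : M → LorentzSpace n}
  (e : LorentzFrame n) (hx : IsSpacelikeImmersion x) (hN : IsUnitNormal x N)
  (hc : IsCompleteHypersurface x)

include hN in
-- With `U` the height in the direction of `T = e.time`, the tangent vector is `∂ₖx = eₖ + (∂ₖU)T`;
-- the identity is its orthogonality to `N`.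
theorem lorentz_normal_vec_eq (k : Fin n) (y : EuclideanSpace ℝ (Fin n)) :
    lorentz (N (graphMap e hx hc y)) (e.vec k)
      = (-lorentz (N (graphMap e hx hc y)) e.time) *
        pderiv k (fun y => -lorentz (x (graphMap e hx hc y)) e.time) y := by
  have hd := (contDiff_comp_graphMap e hx hc hx.1).diffAt y
  have h := (isPatch_graph e hx hN hc).orth_pderiv (Set.mem_univ y) k
  rw [e.parseval] at h
  have hk : ∀ m, lorentz (pderiv k (fun y => x (graphMap e hx hc y)) y) (e.vec m)
      = if m = k then 1 else 0 := by
    intro m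
    have := congrArg (fun w : EuclideanSpace ℝ (Fin n) => w m)
      (proj_fderiv_graphMap e hx hc y (EuclideanSpace.single k 1))
    simp only [LorentzFrame.proj_apply] at this
    refine this.trans ?_
    simp
  simp only [hk, mul_ite, mul_one, mul_zero, Finset.sum_ite_eq', Finset.mem_univ, if_true] at h
  have hneg : (fun y => -lorentz (x (graphMap e hx hc y)) e.time)
      = fun y => lorentz (x (graphMap e hx hc y)) (-e.time) := by
    funext y; rw [lorentz_neg_right]
  rw [hneg, pderiv_lorentz hd (differentiableAt_const _), pderiv_const, lorentz_zero_right, add_zero,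
    lorentz_neg_right]
  linarith

include hN in
theorem isAdaptedGraph {p : M} (he : e.time = N p) :
    IsAdaptedGraph (fun k y => lorentz (N (graphMap e hx hc y)) (e.vec k))
      (fun y => -lorentz (x (graphMap e hx hc y)) e.time)
      (fun y => -lorentz (N (graphMap e hx hc y)) e.time) (e.proj (x p)) where
  contDiff_nu k := (contDiff_comp_graphMap e hx hc hN.1).lorentz contDiff_const
  contDiff_U := ((contDiff_comp_graphMap e hx hc hx.1).lorentz contDiff_const).neg
  contDiff_V := ((contDiff_comp_graphMap e hx hc hN.1).lorentz contDiff_const).neg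
  nu_eq k y := lorentz_normal_vec_eq e hx hN hc k y
  V_sq y := by
    have := (hN.2 (graphMap e hx hc y)).1
    rw [e.parseval] at this
    linarith
  nu_zero k := by rw [graphMap_proj, ← he, lorentz_comm, e.vec_time]
  V_one := by rw [graphMap_proj, ← he, e.time_time, neg_neg]

theorem lorentz_position_normal_graphMap (y : EuclideanSpace ℝ (Fin n)) :
    lorentz (x (graphMap e hx hc y)) (N (graphMap e hx hc y))
      = ∑ m, y m * lorentz (N (graphMap e hx hc y)) (e.vec m)
        - (-lorentz (x (graphMap e hx hc y)) e.time) *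
          (-lorentz (N (graphMap e hx hc y)) e.time) := by
  rw [e.parseval]
  simp only [lorentz_graphMap_vec, neg_mul_neg]

include hx hN hc

variable {s lam : ℝ} (hlam : ∀ p, meanCurvature x N p - s * lorentz (x p) (N p) = lam)

/-- At the centre of an adapted frame `ν = 0`, so the second-order part is the flat Laplacian and
the term with `H` drops out. -/
theorem driftLaplacian_adapted {f : M → ℝ} (hf : ContDiff ℝ ∞ fun y => f (graphMap e hx hc y))
    {p : M} (he : e.time = N p) :
    driftLaplacian x s f p
      = ∑ l, pderiv l (pderiv l (fun y => f (graphMap e hx hc y))) (e.proj (x p))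
        - s * ∑ m, e.proj (x p) m * pderiv m (fun y => f (graphMap e hx hc y)) (e.proj (x p)) := by
  have hν : ∀ k, lorentz (N p) (e.vec k) = 0 := fun k => by rw [← he, lorentz_comm, e.vec_time]
  rw [driftLaplacian, inducedLaplacian_eq e hx hN hc hf, inducedGradient_eq e hx hN hc hf]
  simp only [hν, lorentz_sum_right, lorentz_smul_right, zero_smul, add_zero, zero_mul,
    Finset.sum_const_zero, mul_zero, ite_mul, one_mul, Finset.sum_ite_eq', Finset.mem_univ, if_true]
  congr 2
  exact Finset.sum_congr rfl fun m _ => mul_comm _ _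

include hlam

theorem meanCurvature_graph_eq (y : EuclideanSpace ℝ (Fin n)) :
    ∑ k, pderiv k (fun y => lorentz (N (graphMap e hx hc y)) (e.vec k)) y
      = lam + s * (∑ m, y m * lorentz (N (graphMap e hx hc y)) (e.vec m)
        - (-lorentz (x (graphMap e hx hc y)) e.time) *
          (-lorentz (N (graphMap e hx hc y)) e.time)) := by
  rw [← lorentz_position_normal_graphMap, ← hlam (graphMap e hx hc y), meanCurvature_eq e hx hN hc,
    proj_graphMap]
  ring

/-- The Simons-type inequality, in a frame adapted to the point `p`. -/
theorem driftLaplacian_umbilicityDefect_ge (hn : 2 ≤ n) {p : M} (he : e.time = N p) :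
    let t : Fin n → Fin n → Fin n → ℝ := fun i j k =>
      pderiv i (pderiv j (fun y => lorentz (N (graphMap e hx hc y)) (e.vec k))) (e.proj (x p))
    2 * (∑ l, ∑ i, ∑ k, t l i k ^ 2 - (∑ m, (∑ k, t m k k) ^ 2) / n) + 2 * (umbilicityDefect x N p *
      ((Real.sqrt (secondFormNormSq x N p - meanCurvature x N p ^ 2 / n)
          - |lam| * (((n : ℝ) - 2) / (2 * Real.sqrt ((n : ℝ) * ((n : ℝ) - 1))))) ^ 2
        + 1 / (n : ℝ) * (meanCurvature x N p - lam) ^ 2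
        - (n : ℝ) * lam ^ 2 / (4 * ((n : ℝ) - 1)) + s))
      ≤ driftLaplacian x s (umbilicityDefect x N) p := by
  intro t
  have hA := isAdaptedGraph e hx hN hc he
  have hH := meanCurvature_graph_eq e hx hN hc hlam
  have hsim := hA.simons hH
  simp only at hsim
  have hs := hA.pderiv_nu_symm
  have hB : (fun y => umbilicityDefect x N (graphMap e hx hc y)) = fun y =>
      ∑ i, ∑ k, pderiv i (fun y => lorentz (N (graphMap e hx hc y)) (e.vec k)) y *
        pderiv k (fun y => lorentz (N (graphMap e hx hc y)) (e.vec i)) y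
      - (∑ k, pderiv k (fun y => lorentz (N (graphMap e hx hc y)) (e.vec k)) y) ^ 2 / n := by
    funext y
    rw [umbilicityDefect, meanCurvature_eq e hx hN hc, secondFormNormSq_eq e hx hN hc, proj_graphMap]
  rw [driftLaplacian_adapted e hx hN hc (contDiff_umbilicityDefect e hx hN hc) he, hB, hsim]
  have hSp : secondFormNormSq x N p = ∑ i, ∑ k,
      pderiv i (fun y => lorentz (N (graphMap e hx hc y)) (e.vec k)) (e.proj (x p)) ^ 2 := by
    rw [secondFormNormSq_eq e hx hN hc]
    exact Finset.sum_congr rfl fun i _ => Finset.sum_congr rfl fun k _ => by rw [hs k i, sq]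
  have hre := simons_reaction_ge hn hs s lam (meanCurvature_eq e hx hN hc p) hSp rfl
  rw [← meanCurvature_eq e hx hN hc p, ← hSp] at *
  rw [umbilicityDefect]
  linarith

end PointwiseInequality

end SpacelikeHypersurface

namespace SpacelikeHypersurface

/-! ### Boundedness of balls for a complete length distance. -/

section HopfRinow

/-- The Hopf–Rinow–Cohn-Vossen theorem for a locally compact complete length distance `d` on a
proper space, dominated by the given distance: its balls are bounded. -/
theorem isBounded_lt_of_complete_length {E : Type*} [PseudoMetricSpace E] [ProperSpace E]
    (d : E → E → ℝ) (h0 : ∀ y z, 0 ≤ d y z) (hs : ∀ y z, d y z = d z y)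
    (ht : ∀ y z w, d y w ≤ d y z + d z w) (hle : ∀ y z, d y z ≤ dist y z)
    (hlength : ∀ y z r s, 0 ≤ s → s ≤ r → d y z < r → ∃ m, d y m ≤ s ∧ d m z ≤ r - s)
    (hloc : ∀ y, ∃ r > 0, Bornology.IsBounded {z | d y z < r})
    (hcomplete : ∀ u : ℕ → E, (∀ δ > 0, ∃ K, ∀ k ≥ K, ∀ l ≥ K, d (u k) (u l) < δ) →
      ∃ p, Tendsto u atTop (𝓝 p)) (y : E) (r : ℝ) : Bornology.IsBounded {z | d y z < r} := by
  by_contra hbad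
  have hr : 0 < r := by
    by_contra hr
    refine hbad (Bornology.isBounded_empty.subset fun z hz => ?_)
    have hz' : d y z < r := hz
    linarith [h0 y z]
  -- From an unbounded ball one passes to another unbounded ball of `3/4` the radius, with centre at
  -- most the old radius away. Iterating gives Cauchy centres whose limit has arbitrarily small
  -- unbounded balls, against `hloc`.
  have hstep : ∀ p : E, ∀ r : ℝ, 0 < r → ¬Bornology.IsBounded {z | d p z < r} →
      ∃ p', d p p' ≤ r ∧ ¬Bornology.IsBounded {z | d p' z < 3 / 4 * r} := by
    intro p r hr hbad
    by_cases hsmall : Bornology.IsBounded {z | d p z < 2 / 3 * r}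
    · have hex : ∀ k : ℕ, ∃ z, d p z < r ∧ (k : ℝ) < dist z p := by
        intro k
        by_contra hno
        push Not at hno
        exact hbad (Metric.isBounded_closedBall.subset fun z hz => hno z hz)
      choose q hq hqk using hex
      -- The points `q k` escape to infinity. Intermediate points at distance at most `3r/5 < 2r/3`
      -- stay in the bounded ball and subconverge to some `a`. Then `a` is within `3r/5 + r/10 ≤ r`
      -- of `p` and, infinitely often, within `2r/5 + r/10 < 3r/4` of `q k`.
      choose m hm hmq using fun k => hlength p (q k) r (3 / 5 * r) (by linarith) (by linarith) (hq k)
      obtain ⟨a, -, φ, hφ, hlim⟩ := tendsto_subseq_of_bounded hsmall (x := m) fun k =>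
        lt_of_le_of_lt (hm k) (by linarith)
      have hnear : ∀ᶠ k in atTop, dist a (m (φ k)) < r / 10 := by
        have := (Metric.tendsto_nhds.1 hlim) (r / 10) (by linarith)
        filter_upwards [this] with k hk
        rw [dist_comm]; exact hk
      refine ⟨a, ?_, fun hb => ?_⟩
      · obtain ⟨k, hk⟩ := hnear.exists
        linarith [ht p (m (φ k)) a, hm (φ k), hle (m (φ k)) a, dist_comm a (m (φ k))]
      · obtain ⟨R, hR⟩ := hb.subset_closedBall p
        obtain ⟨k, hk, hkR⟩ := (hnear.and ((tendsto_natCast_atTop_atTop (R := ℝ)).comp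
          hφ.tendsto_atTop |>.eventually_ge_atTop R)).exists
        have hin : d a (q (φ k)) < 3 / 4 * r := by
          linarith [ht a (m (φ k)) (q (φ k)), hmq (φ k), hle a (m (φ k))]
        have h1 := hR hin
        rw [Metric.mem_closedBall] at h1
        exact absurd (hqk (φ k)) (not_lt.2 (h1.trans hkR))
    · refine ⟨p, ?_, fun hb => hsmall (hb.subset fun z hz => lt_trans (b := 2 / 3 * r) hz (by linarith))⟩
      exact (hle p p).trans (by rw [dist_self]; exact hr.le)
  choose! F hF1 hF2 using hstep
  let P : ℕ → E := fun k => Nat.rec y (fun k p => F p ((3 / 4) ^ k * r)) k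
  have hpos : ∀ k : ℕ, 0 < (3 / 4 : ℝ) ^ k * r := fun k => by positivity
  have hP : ∀ k, ¬Bornology.IsBounded {z | d (P k) z < (3 / 4) ^ k * r} := by
    intro k
    induction k with
    | zero => simpa [P] using hbad
    | succ k ih =>
      have := hF2 (P k) _ (hpos k) ih
      rwa [← mul_assoc, ← pow_succ'] at this
  have hd : ∀ k, d (P k) (P (k + 1)) ≤ (3 / 4) ^ k * r := fun k => hF1 _ _ (hpos k) (hP k)
  have htail : ∀ k j, d (P k) (P (k + j)) ≤ 4 * ((3 / 4) ^ k * r) - 4 * ((3 / 4) ^ (k + j) * r) := by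
    intro k j
    induction j with
    | zero => simpa using hle (P k) (P k)
    | succ j ih =>
      have := ht (P k) (P (k + j)) (P (k + j + 1))
      have h2 := hd (k + j)
      rw [← add_assoc, pow_succ]
      linarith
  have hgeo : Tendsto (fun k : ℕ => (3 / 4 : ℝ) ^ k * r) atTop (𝓝 0) := by
    simpa using (tendsto_pow_atTop_nhds_zero_of_lt_one (by norm_num : (0 : ℝ) ≤ 3 / 4)
      (by norm_num)).mul_const r
  obtain ⟨a, ha⟩ := hcomplete P fun δ hδ => by
    obtain ⟨K, hK⟩ := (hgeo.eventually (gt_mem_nhds (by linarith : 0 < δ / 8))).exists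
    have hKd : ∀ k ≥ K, d (P K) (P k) < δ / 2 := fun k hk => by
      obtain ⟨j, rfl⟩ := Nat.exists_eq_add_of_le hk
      linarith [htail K j, hpos (K + j)]
    refine ⟨K, fun k hk l hl => ?_⟩
    linarith [ht (P k) (P K) (P l), hs (P k) (P K), hKd k hk, hKd l hl]
  obtain ⟨ρ, hρ, hb⟩ := hloc a
  have h1 := (Metric.tendsto_nhds.1 ha) (ρ / 2) (by linarith)
  obtain ⟨k, hk1, hk2⟩ := (h1.and (hgeo.eventually (gt_mem_nhds (by linarith : 0 < ρ / 2)))).exists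
  refine hP k (hb.subset fun z hz => ?_)
  have hz' : d (P k) z < (3 / 4) ^ k * r := hz
  change d a z < ρ
  linarith [ht a (P k) z, hle a (P k), dist_comm a (P k)]

end HopfRinow

/-! ### The Riemannian distance in graph coordinates, and a variational principle. -/

section GraphDistance

variable {n : ℕ} {M : Type*} [TopologicalSpace M] [ChartedSpace (EuclideanSpace ℝ (Fin n)) M]
  {x N : M → LorentzSpace n}

theorem inducedMetric_mfderiv_eq (hx : IsSpacelikeImmersion x) {γ : ℝ → M} {t : ℝ}
    (hγ : MDifferentiableAt 𝓘(ℝ, ℝ) (𝓡 n) γ t) :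
    inducedMetric x (γ t) (mfderiv 𝓘(ℝ, ℝ) (𝓡 n) γ t 1) (mfderiv 𝓘(ℝ, ℝ) (𝓡 n) γ t 1)
      = lorentz (deriv (fun s => x (γ s)) t) (deriv (fun s => x (γ s)) t) := by
  have hxd : MDifferentiableAt (𝓡 n) 𝓘(ℝ, LorentzSpace n) x (γ t) :=
    hx.1.mdifferentiableAt (by simp)
  have h2 := mfderiv_comp t hxd hγ
  rw [mfderiv_eq_fderiv] at h2
  have h3 : deriv (fun s => x (γ s)) t
      = mfderiv (𝓡 n) 𝓘(ℝ, LorentzSpace n) x (γ t) (mfderiv 𝓘(ℝ, ℝ) (𝓡 n) γ t 1) := by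
    rw [← fderiv_apply_one_eq_deriv]
    exact congrArg (fun A => A 1) h2
  rw [h3, inducedMetric]

variable [IsManifold (𝓡 n) ∞ M] [T2Space M] [ConnectedSpace M]
  (e : LorentzFrame n) (hx : IsSpacelikeImmersion x) (hN : IsUnitNormal x N)
  (hc : IsCompleteHypersurface x)

theorem inducedEDist_graphMap_add_le {y w : EuclideanSpace ℝ (Fin n)} {C : ℝ} (hC : 0 ≤ C)
    (h : ∀ t ∈ Set.Ioo (0 : ℝ) 1, lorentz (fderiv ℝ (fun y => x (graphMap e hx hc y)) (y + t • w) w)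
      (fderiv ℝ (fun y => x (graphMap e hx hc y)) (y + t • w) w) ≤ C ^ 2) :
    inducedEDist x (graphMap e hx hc y) (graphMap e hx hc (y + w)) ≤ ENNReal.ofReal C := by
  set γ : ℝ → M := fun t => graphMap e hx hc (y + t • w) with hγ
  have hl : ContMDiff 𝓘(ℝ, ℝ) 𝓘(ℝ, EuclideanSpace ℝ (Fin n)) 1 fun t : ℝ => y + t • w := by
    rw [contMDiff_iff_contDiff]; fun_prop
  have hγs : ContMDiff 𝓘(ℝ, ℝ) (𝓡 n) 1 γ :=
    ((contMDiff_graphMap e hx hc).of_le (by exact_mod_cast le_top)).comp hl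
  have h1 := inducedEDist_le_curveLength (x := x) hγs.contMDiffOn zero_le_one
  have h2 := curveLength_le (x := x) (γ := γ) (a := 0) (b := 1) hC fun t ht => by
    rw [inducedMetric_mfderiv_eq hx (hγs.mdifferentiableAt (by simp))]
    have hd : HasDerivAt (fun s => x (γ s))
        (fderiv ℝ (fun y => x (graphMap e hx hc y)) (y + t • w) w) t := by
      have h1 : HasDerivAt (fun s : ℝ => y + s • w) ((1 : ℝ) • w) t :=
        ((hasDerivAt_id t).smul_const w).const_add _
      rw [one_smul] at h1
      exact ((contDiff_comp_graphMap e hx hc hx.1).differentiable (by simp) _).hasFDerivAt.comp_hasDerivAt t h1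
    rw [hd.deriv]
    exact h t ht
  simpa [hγ] using h1.trans h2

theorem lorentz_fderiv_graphMap_le (y w : EuclideanSpace ℝ (Fin n)) :
    lorentz (fderiv ℝ (fun y => x (graphMap e hx hc y)) y w)
      (fderiv ℝ (fun y => x (graphMap e hx hc y)) y w) ≤ ‖w‖ ^ 2 := by
  have := e.norm_proj_sq (fderiv ℝ (fun y => x (graphMap e hx hc y)) y w)
  rw [proj_fderiv_graphMap] at this
  rw [this]
  exact le_add_of_nonneg_right (sq_nonneg _)

theorem inducedEDist_graphMap_le (y z : EuclideanSpace ℝ (Fin n)) :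
    inducedEDist x (graphMap e hx hc y) (graphMap e hx hc z) ≤ ENNReal.ofReal (dist y z) := by
  have := inducedEDist_graphMap_add_le e hx hc (y := y) (w := z - y) (norm_nonneg (z - y))
    fun t _ => lorentz_fderiv_graphMap_le e hx hc _ _
  rwa [add_sub_cancel, ← dist_eq_norm, dist_comm] at this

/-- The Riemannian distance in graph coordinates. -/
noncomputable def graphDist (y z : EuclideanSpace ℝ (Fin n)) : ℝ :=
  (inducedEDist x (graphMap e hx hc y) (graphMap e hx hc z)).toReal

theorem ofReal_graphDist (y z : EuclideanSpace ℝ (Fin n)) :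
    ENNReal.ofReal (graphDist e hx hc y z)
      = inducedEDist x (graphMap e hx hc y) (graphMap e hx hc z) :=
  ENNReal.ofReal_toReal ((inducedEDist_graphMap_le e hx hc y z).trans_lt ENNReal.ofReal_lt_top).ne

theorem graphDist_nonneg (y z : EuclideanSpace ℝ (Fin n)) : 0 ≤ graphDist e hx hc y z :=
  ENNReal.toReal_nonneg

theorem graphDist_comm (y z : EuclideanSpace ℝ (Fin n)) :
    graphDist e hx hc y z = graphDist e hx hc z y := by
  rw [graphDist, graphDist, inducedEDist_comm]

theorem graphDist_self (y : EuclideanSpace ℝ (Fin n)) : graphDist e hx hc y y = 0 := by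
  rw [graphDist, inducedEDist_self, ENNReal.toReal_zero]

theorem graphDist_triangle (y z w : EuclideanSpace ℝ (Fin n)) :
    graphDist e hx hc y w ≤ graphDist e hx hc y z + graphDist e hx hc z w := by
  have h := graphDist_nonneg e hx hc
  rw [← ENNReal.ofReal_le_ofReal_iff (add_nonneg (h _ _) (h _ _)),
    ENNReal.ofReal_add (h _ _) (h _ _), ofReal_graphDist, ofReal_graphDist, ofReal_graphDist]
  exact inducedEDist_triangle _ _ _

theorem graphDist_le_dist (y z : EuclideanSpace ℝ (Fin n)) : graphDist e hx hc y z ≤ dist y z :=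
  ENNReal.toReal_le_of_le_ofReal dist_nonneg (inducedEDist_graphMap_le e hx hc y z)

theorem lipschitzWith_graphDist (p : EuclideanSpace ℝ (Fin n)) :
    LipschitzWith 1 (graphDist e hx hc p) :=
  LipschitzWith.of_le_add fun y z => (graphDist_triangle e hx hc p z y).trans
    (by linarith [graphDist_le_dist e hx hc z y, dist_comm y z])

include hx hc in
theorem exists_contDiffOn_of_graphDist_lt {y z : EuclideanSpace ℝ (Fin n)} {r : ℝ}
    (h : graphDist e hx hc y z < r) :
    ∃ γ : ℝ → M, γ 0 = graphMap e hx hc y ∧ γ 1 = graphMap e hx hc z ∧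
      ContMDiffOn 𝓘(ℝ, ℝ) (𝓡 n) 1 γ (Set.Icc 0 1) ∧ curveLength x γ 0 1 < ENNReal.ofReal r := by
  refine exists_curve_of_inducedEDist_lt ?_
  rw [← ofReal_graphDist]
  exact (ENNReal.ofReal_lt_ofReal_iff (lt_of_le_of_lt (graphDist_nonneg _ _ _ _ _) h)).2 h

/-- The intermediate point lies on an almost minimizing curve, where the distance from `y` equals
`s`; the rest of the curve is then shorter than `r - s`. -/
theorem exists_graphDist_le_of_lt (y z : EuclideanSpace ℝ (Fin n)) (r s : ℝ) (hs : 0 ≤ s)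
    (hsr : s ≤ r) (h : graphDist e hx hc y z < r) :
    ∃ m, graphDist e hx hc y m ≤ s ∧ graphDist e hx hc m z ≤ r - s := by
  by_cases hle : graphDist e hx hc y z ≤ s
  · exact ⟨z, hle, by rw [graphDist_self]; linarith⟩
  obtain ⟨γ, h0, h1, hγ, hlen⟩ := exists_contDiffOn_of_graphDist_lt e hx hc h
  have hcont : ContinuousOn (fun t => graphDist e hx hc y (e.proj (x (γ t)))) (Set.Icc 0 1) :=
    (lipschitzWith_graphDist e hx hc y).continuous.comp_continuousOn
      ((e.proj.continuous.comp hx.1.continuous).comp_continuousOn hγ.continuousOn)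
  obtain ⟨t, ht, hts⟩ := intermediate_value_Icc zero_le_one hcont (show s ∈ Set.Icc _ _ by
    simp only [h0, h1, proj_graphMap, graphDist_self]
    exact ⟨hs, (not_le.1 hle).le⟩)
  simp only at hts
  refine ⟨e.proj (x (γ t)), hts.le, ?_⟩
  have ha : ENNReal.ofReal s ≤ curveLength x γ 0 t := by
    rw [← hts, ofReal_graphDist, graphMap_proj, ← h0]
    exact inducedEDist_le_curveLength (hγ.mono (Set.Icc_subset_Icc_right ht.2)) ht.1
  have hb : ENNReal.ofReal (graphDist e hx hc (e.proj (x (γ t))) z) ≤ curveLength x γ t 1 := by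
    rw [ofReal_graphDist, graphMap_proj, ← h1]
    exact inducedEDist_le_curveLength (hγ.mono (Set.Icc_subset_Icc_left ht.1)) ht.2
  have hsum := (add_le_add ha hb).trans_eq (curveLength_add ht.1 ht.2) |>.trans hlen.le
  rw [← ENNReal.ofReal_add hs (graphDist_nonneg _ _ _ _ _),
    ENNReal.ofReal_le_ofReal_iff (by linarith)] at hsum
  linarith

include hN in
/-- Small balls of the Riemannian distance are bounded in graph coordinates. -/
theorem exists_isBounded_graphDist_lt (y : EuclideanSpace ℝ (Fin n)) :
    ∃ r > 0, Bornology.IsBounded {z | graphDist e hx hc y z < r} := by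
  set X := fun y => x (graphMap e hx hc y) with hX
  have hXs : ContDiff ℝ ∞ X := contDiff_comp_graphMap e hx hc hx.1
  have hcompact : IsCompact (Metric.closedBall y 1 ×ˢ
      Metric.sphere (0 : EuclideanSpace ℝ (Fin n)) 1) :=
    (isCompact_closedBall y 1).prod (isCompact_sphere 0 1)
  have hcont : Continuous fun a : EuclideanSpace ℝ (Fin n) × EuclideanSpace ℝ (Fin n) =>
      lorentz (fderiv ℝ X a.1 a.2) (fderiv ℝ X a.1 a.2) := by
    have : Continuous fun a : EuclideanSpace ℝ (Fin n) × EuclideanSpace ℝ (Fin n) =>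
        fderiv ℝ X a.1 a.2 :=
      ((hXs.continuous_fderiv (by simp)).comp continuous_fst).clm_apply continuous_snd
    exact continuous_lorentz this this
  -- By compactness the metric is at least `c` times the Euclidean one over the unit ball, so a
  -- curve leaving that ball has length at least `√c`.
  obtain ⟨c, hc0, hcl⟩ := hcompact.exists_forall_le' hcont.continuousOn (a := 0) fun a ha => by
    refine (isPatch_graph e hx hN hc).pos a.1 (Set.mem_univ _) a.2 ?_
    have := ha.2
    rintro h0
    simp [h0] at this
  have hlow : ∀ u ∈ Metric.closedBall y 1, ∀ v,
      Real.sqrt c * ‖v‖ ≤ Real.sqrt (lorentz (fderiv ℝ X u v) (fderiv ℝ X u v)) := by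
    intro u hu v
    rcases eq_or_ne v 0 with rfl | hv
    · simp
    have h1 := hcl (u, ‖v‖⁻¹ • v) ⟨hu, by simp [norm_smul, hv]⟩
    simp only [map_smul, lorentz_smul_left, lorentz_smul_right] at h1
    have hvp : 0 < ‖v‖ := norm_pos_iff.2 hv
    refine Real.le_sqrt_of_sq_le ?_
    rw [mul_pow, Real.sq_sqrt hc0.le]
    calc c * ‖v‖ ^ 2 ≤ (‖v‖⁻¹ * (‖v‖⁻¹ * lorentz (fderiv ℝ X u v) (fderiv ℝ X u v))) * ‖v‖ ^ 2 := by
          gcongr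
      _ = _ := by field_simp
  have hsc : 0 < Real.sqrt c := Real.sqrt_pos.2 hc0
  refine ⟨Real.sqrt c, hsc, (Metric.isBounded_closedBall (x := y) (r := 1)).subset fun z hz => ?_⟩
  by_contra hzout
  obtain ⟨γ, h0, h1, hγ, hlen⟩ := exists_contDiffOn_of_graphDist_lt e hx hc hz
  set c' : ℝ → EuclideanSpace ℝ (Fin n) := fun t => e.proj (x (γ t)) with hc'
  have hc's : ContDiffOn ℝ 1 c' (Set.Icc 0 1) := by
    rw [← contMDiffOn_iff_contDiffOn]
    exact ((isLocalDiffeomorph_proj e hx).contMDiff.of_le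
      (by exact_mod_cast le_top)).comp_contMDiffOn hγ
  have hc'0 : c' 0 = y := by simp [hc', h0]
  have hc'1 : c' 1 = z := by simp [hc', h1]
  -- the first exit time from the unit ball
  set A : Set ℝ := Set.Icc 0 1 ∩ {t | 1 ≤ dist (c' t) y} with hA
  have hdc : ContinuousOn (fun t => dist (c' t) y) (Set.Icc 0 1) :=
    (continuous_id.dist continuous_const).comp_continuousOn hc's.continuousOn
  have hAcl : IsClosed A := hdc.preimage_isClosed_of_isClosed isClosed_Icc isClosed_Ici
  have hAne : A.Nonempty := ⟨1, ⟨by simp, by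
    simp only [Set.mem_ofPred_eq, hc'1]
    rw [Metric.mem_closedBall] at hzout
    exact (not_le.1 hzout).le⟩⟩
  have hAcomp : IsCompact A := isCompact_Icc.of_isClosed_subset hAcl Set.inter_subset_left
  obtain ⟨τ, hτA, hτ⟩ := hAcomp.exists_isLeast hAne
  have hbefore : ∀ t ∈ Set.Ioo 0 τ, c' t ∈ Metric.closedBall y 1 := by
    intro t ht
    rw [Metric.mem_closedBall]
    by_contra hno
    exact absurd (hτ ⟨⟨ht.1.le, ht.2.le.trans hτA.1.2⟩, (not_le.1 hno).le⟩) (not_le.2 ht.2)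
  have hsub : Set.Icc 0 τ ⊆ Set.Icc 0 1 := Set.Icc_subset_Icc_right hτA.1.2
  have hE := enorm_sub_le_lintegral_deriv_of_contDiffOn_Icc (hc's.mono hsub) hτA.1.1
  have hone : 1 ≤ ‖c' τ - c' 0‖ₑ := by
    rw [hc'0, ← ofReal_norm, ← dist_eq_norm, ← ENNReal.ofReal_one]
    exact ENNReal.ofReal_le_ofReal hτA.2
  have hbound : ENNReal.ofReal (Real.sqrt c) ≤ curveLength x γ 0 τ := by
    calc ENNReal.ofReal (Real.sqrt c) = ENNReal.ofReal (Real.sqrt c) * 1 := (mul_one _).symm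
      _ ≤ ENNReal.ofReal (Real.sqrt c) * ∫⁻ t in Set.Icc 0 τ, ‖deriv c' t‖ₑ := by
          gcongr; exact hone.trans hE
      _ = ∫⁻ t in Set.Ioo 0 τ, ENNReal.ofReal (Real.sqrt c) * ‖deriv c' t‖ₑ := by
          rw [restrict_Ioo_eq_restrict_Icc, lintegral_const_mul' _ _ ENNReal.ofReal_ne_top]
      _ ≤ _ := by
          rw [curveLength_eq_lintegral]
          refine setLIntegral_mono' measurableSet_Ioo fun t ht => ?_
          have hmem : Set.Icc (0 : ℝ) 1 ∈ 𝓝 t :=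
            Icc_mem_nhds ht.1 (ht.2.trans_le hτA.1.2)
          rw [inducedMetric_mfderiv_eq hx ((hγ.contMDiffAt hmem).mdifferentiableAt (by simp))]
          have hcd : HasDerivAt c' (deriv c' t) t :=
            ((hc's.contDiffAt hmem).differentiableAt (by simp)).hasDerivAt
          have hd : HasDerivAt (fun s => X (c' s)) (fderiv ℝ X (c' t) (deriv c' t)) t :=
            (hXs.differentiable (by simp) _).hasFDerivAt.comp_hasDerivAt t hcd
          simp only [hX, hc', graphMap_proj] at hd
          rw [hd.deriv, ← ofReal_norm, ← ENNReal.ofReal_mul hsc.le]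
          exact ENNReal.ofReal_le_ofReal (hlow _ (hbefore t ht) _)
  have hmono : curveLength x γ 0 τ ≤ curveLength x γ 0 1 := by
    rw [← curveLength_add hτA.1.1 hτA.1.2]; exact le_self_add
  exact absurd hlen (not_lt.2 (hbound.trans hmono))

include hN in
/-- Balls of the Riemannian distance are bounded in graph coordinates. -/
theorem isBounded_graphDist_lt (y : EuclideanSpace ℝ (Fin n)) (r : ℝ) :
    Bornology.IsBounded {z | graphDist e hx hc y z < r} := by
  refine isBounded_lt_of_complete_length (graphDist e hx hc) (graphDist_nonneg e hx hc)
    (graphDist_comm e hx hc) (graphDist_triangle e hx hc) (graphDist_le_dist e hx hc)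
    (exists_graphDist_le_of_lt e hx hc) (exists_isBounded_graphDist_lt e hx hN hc) ?_ y r
  intro u hu
  obtain ⟨p, hp⟩ := hc (fun k => graphMap e hx hc (u k)) fun δ hδ => by
    obtain ⟨δ', h1, h2⟩ := ENNReal.lt_iff_exists_real_btwn.1 hδ
    obtain ⟨K, hK⟩ := hu δ' (by simpa using h2.1)
    refine ⟨K, fun k hk l hl => lt_of_le_of_lt ?_ h2.2⟩
    rw [← ofReal_graphDist]
    exact ENNReal.ofReal_le_ofReal (hK k hk l hl).le
  refine ⟨e.proj (x p), ?_⟩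
  have := ((e.proj.continuous.comp hx.1.continuous).tendsto p).comp hp
  simpa [Function.comp_def] using this

/-- By continuity of the metric, a short segment in the direction `v` has length at most `C|t|` for
any `C` above the metric norm of `v`. -/
theorem eventually_graphDist_add_smul_le {y v : EuclideanSpace ℝ (Fin n)} {C : ℝ}
    (hC : Real.sqrt (lorentz (fderiv ℝ (fun y => x (graphMap e hx hc y)) y v)
      (fderiv ℝ (fun y => x (graphMap e hx hc y)) y v)) < C) :
    ∀ᶠ t in 𝓝 (0 : ℝ), graphDist e hx hc y (y + t • v) ≤ C * |t| := by
  set X := fun y => x (graphMap e hx hc y) with hX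
  have hXs : ContDiff ℝ ∞ X := contDiff_comp_graphMap e hx hc hx.1
  have hC0 : 0 < C := lt_of_le_of_lt (Real.sqrt_nonneg _) hC
  set G : ℝ → ℝ := fun t => lorentz (fderiv ℝ X (y + t • v) v) (fderiv ℝ X (y + t • v) v) with hG
  have hGc : Continuous G := by
    have : Continuous fun t : ℝ => fderiv ℝ X (y + t • v) v :=
      ((hXs.continuous_fderiv (by simp)).comp (by fun_prop)).clm_apply continuous_const
    exact continuous_lorentz this this
  have hlt : G 0 < C ^ 2 := by
    rw [← Real.sqrt_lt' hC0]
    simpa [hG] using hC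
  obtain ⟨δ, hδ, hball⟩ := Metric.eventually_nhds_iff.1
    (hGc.continuousAt.eventually (gt_mem_nhds hlt))
  filter_upwards [Metric.ball_mem_nhds (0 : ℝ) hδ] with t ht
  refine ENNReal.toReal_le_of_le_ofReal (by positivity)
    (inducedEDist_graphMap_add_le e hx hc (by positivity) fun r hr => ?_)
  rw [map_smul, lorentz_smul_left, lorentz_smul_right, smul_smul]
  have : G (r * t) < C ^ 2 := hball (by
    rw [Metric.mem_ball] at ht
    rw [Real.dist_eq, sub_zero] at ht ⊢
    rw [abs_mul, abs_of_pos hr.1]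
    calc r * |t| ≤ 1 * |t| := by gcongr; exact hr.2.le
      _ < δ := by rwa [one_mul])
  calc _ = t ^ 2 * G (r * t) := by rw [hG]; ring
    _ ≤ t ^ 2 * C ^ 2 := by gcongr
    _ = (C * |t|) ^ 2 := by rw [mul_pow, sq_abs]; ring

/-- Directional derivatives of the distance function are bounded by the norm of the induced
metric. -/
theorem abs_le_of_hasDerivAt_graphDist {p y v : EuclideanSpace ℝ (Fin n)} {D : ℝ}
    (h : HasDerivAt (fun t : ℝ => graphDist e hx hc p (y + t • v)) D 0) :
    |D| ≤ Real.sqrt (lorentz (fderiv ℝ (fun y => x (graphMap e hx hc y)) y v)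
      (fderiv ℝ (fun y => x (graphMap e hx hc y)) y v)) := by
  refine le_of_forall_gt_imp_ge_of_dense fun C hC => ?_
  have hC0 : 0 < C := lt_of_le_of_lt (Real.sqrt_nonneg _) hC
  have hlip : ∀ᶠ t in 𝓝 (0 : ℝ), ‖graphDist e hx hc p (y + t • v)
      - graphDist e hx hc p (y + (0 : ℝ) • v)‖ ≤ C * ‖t - 0‖ := by
    filter_upwards [eventually_graphDist_add_smul_le e hx hc hC] with t h1
    rw [zero_smul, add_zero, sub_zero, Real.norm_eq_abs, Real.norm_eq_abs, abs_le]
    have h2 := graphDist_triangle e hx hc p y (y + t • v)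
    have h3 := graphDist_triangle e hx hc p (y + t • v) y
    rw [graphDist_comm e hx hc (y + t • v) y] at h3
    constructor <;> linarith
  have := h.hasFDerivAt.le_of_lip' hC0.le hlip
  simpa using this

include hN in
/-- A continuous function bounded below has a point in each of its sublevel sets `{f ≤ f(q)}` at
which its rate of descent, measured in the complete metric, is less than one in every direction. -/
theorem exists_descent_rate_lt {f : EuclideanSpace ℝ (Fin n) → ℝ} (hf : Continuous f) {m : ℝ}
    (hm : ∀ y, m ≤ f y) (q : EuclideanSpace ℝ (Fin n)) :
    ∃ y, f y ≤ f q ∧ ∀ v D, HasDerivAt (fun t : ℝ => f (y + t • v)) D 0 → D < 0 →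
      -D < Real.sqrt (lorentz (fderiv ℝ (fun y => x (graphMap e hx hc y)) y v)
        (fderiv ℝ (fun y => x (graphMap e hx hc y)) y v)) := by
  -- As in Ekeland's principle, adding half the distance to `q` makes the sublevel set compact; at a
  -- minimum of `Φ` the slope of `f` is at most `1/2`.
  set Φ : EuclideanSpace ℝ (Fin n) → ℝ := fun y => f y + graphDist e hx hc q y / 2 with hΦ
  have hΦc : Continuous Φ :=
    hf.add ((lipschitzWith_graphDist e hx hc q).continuous.div_const 2)
  have hΦq : Φ q = f q := by simp [hΦ, graphDist_self]
  have hK : IsCompact {y | Φ y ≤ f q} := by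
    refine Metric.isCompact_of_isClosed_isBounded (isClosed_le hΦc continuous_const)
      ((isBounded_graphDist_lt e hx hN hc q (2 * (f q - m) + 1)).subset fun y hy => ?_)
    have hy' : f y + graphDist e hx hc q y / 2 ≤ f q := hy
    change graphDist e hx hc q y < _
    linarith [hm y]
  obtain ⟨y, hyK, hmin⟩ := hK.exists_isMinOn ⟨q, hΦq.le⟩ hΦc.continuousOn
  have hglob : ∀ z, Φ y ≤ Φ z := fun z => by
    by_cases hz : Φ z ≤ f q
    · exact hmin hz
    · exact le_trans hyK (not_le.1 hz).le
  refine ⟨y, ?_, fun v D hD hD0 => ?_⟩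
  · have hy' : f y + graphDist e hx hc q y / 2 ≤ f q := hyK
    linarith [graphDist_nonneg e hx hc q y]
  by_contra hno
  -- The factors `3/2` and `7/8` leave room: along `v` the function `f` changes by less than
  -- `(7/8)Dt` and half the distance by at most `-(3/4)Dt`, so `Φ` would decrease strictly.
  have hlt : Real.sqrt (lorentz (fderiv ℝ (fun y => x (graphMap e hx hc y)) y v)
        (fderiv ℝ (fun y => x (graphMap e hx hc y)) y v)) < -(3 / 2) * D := by
    linarith [not_lt.1 hno]
  have h1 := (eventually_graphDist_add_smul_le e hx hc hlt).filter_mono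
    (nhdsWithin_le_nhds (s := Set.Ioi (0 : ℝ)))
  have h2 : ∀ᶠ t in 𝓝[>] (0 : ℝ), slope (fun t : ℝ => f (y + t • v)) 0 t < 7 / 8 * D :=
    (hD.tendsto_slope.mono_left (nhdsWithin_mono _ fun t ht => ne_of_gt ht)).eventually
      (gt_mem_nhds (by linarith))
  obtain ⟨t, ⟨ht1, ht2⟩, ht0⟩ := ((h1.and h2).and self_mem_nhdsWithin).exists
  have ht0' : (0 : ℝ) < t := ht0
  rw [slope_def_field, zero_smul, add_zero, sub_zero, div_lt_iff₀ ht0'] at ht2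
  rw [abs_of_pos ht0'] at ht1
  have h3 := hglob (y + t • v)
  have h4 := graphDist_triangle e hx hc q y (y + t • v)
  simp only [hΦ] at h3
  have : D * t < 0 := mul_neg_of_neg_of_pos hD0 ht0'
  linarith

end GraphDistance

end SpacelikeHypersurface

namespace SpacelikeHypersurface

/-! ### Divergence theorem with Lipschitz cutoffs. -/

section Divergence

variable {n : ℕ}

/-- The cutoff function `1` on `{ρ ≤ R}`, `0` outside `{ρ < 2R}`. -/
noncomputable def cutoff (ρ : EuclideanSpace ℝ (Fin n) → ℝ) (R : ℝ)
    (y : EuclideanSpace ℝ (Fin n)) : ℝ :=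
  max 0 (min 1 (2 - ρ y / R))

variable {ρ : EuclideanSpace ℝ (Fin n) → ℝ} {R : ℝ}

theorem cutoff_nonneg (y : EuclideanSpace ℝ (Fin n)) : 0 ≤ cutoff ρ R y := le_max_left _ _

theorem abs_cutoff_sub_le (hR : 0 < R) (y z : EuclideanSpace ℝ (Fin n)) :
    |cutoff ρ R y - cutoff ρ R z| ≤ |ρ y - ρ z| / R := by
  have h1 := abs_max_sub_max_le_abs (min 1 (2 - ρ y / R)) (min 1 (2 - ρ z / R)) 0
  have h2 := abs_min_sub_min_le_max 1 (2 - ρ y / R) 1 (2 - ρ z / R)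
  have h3 : |2 - ρ y / R - (2 - ρ z / R)| = |ρ y - ρ z| / R := by
    rw [← abs_of_pos hR, ← abs_div, abs_of_pos hR, ← abs_neg]
    congr 1; ring
  rw [h3, sub_self, abs_zero, max_eq_right (by positivity)] at h2
  rw [max_comm _ 0, max_comm _ 0] at h1
  exact h1.trans h2

theorem cutoff_eq_zero (hR : 0 < R) {y : EuclideanSpace ℝ (Fin n)} (h : 2 * R ≤ ρ y) :
    cutoff ρ R y = 0 := by
  refine max_eq_left ((min_le_right _ _).trans ?_)
  rw [sub_nonpos, le_div_iff₀ hR]; exact h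

theorem cutoff_eq_one (hR : 0 < R) {y : EuclideanSpace ℝ (Fin n)} (h : ρ y ≤ R) :
    cutoff ρ R y = 1 := by
  have : ρ y / R ≤ 1 := by rw [div_le_one hR]; exact h
  rw [cutoff, min_eq_left (by linarith), max_eq_right zero_le_one]

theorem cutoff_mono {R' : ℝ} (hR : 0 < R) (hRR' : R ≤ R') {y : EuclideanSpace ℝ (Fin n)}
    (h : 0 ≤ ρ y) : cutoff ρ R y ≤ cutoff ρ R' y := by
  unfold cutoff
  gcongr

theorem lipschitzWith_cutoff (hρ : LipschitzWith 1 ρ) (hR : 1 ≤ R) :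
    LipschitzWith 1 (cutoff ρ R) := by
  refine LipschitzWith.of_dist_le_mul fun y z => ?_
  have h1 := abs_cutoff_sub_le (ρ := ρ) (by linarith : 0 < R) y z
  have h2 := hρ.dist_le_mul y z
  rw [Real.dist_eq] at h2 ⊢
  exact h1.trans ((div_le_self (abs_nonneg _) hR).trans h2)

theorem hasCompactSupport_cutoff (hb : ∀ R, Bornology.IsBounded {y | ρ y < R}) (hR : 0 < R) :
    HasCompactSupport (cutoff ρ R) := by
  obtain ⟨r, hr⟩ := (hb (2 * R)).subset_closedBall 0
  refine HasCompactSupport.of_support_subset_isCompact (isCompact_closedBall 0 r) fun y hy => hr ?_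
  by_contra hno
  exact hy (cutoff_eq_zero hR (not_lt.1 hno))

variable {Y : EuclideanSpace ℝ (Fin n) → EuclideanSpace ℝ (Fin n)}
  {G : EuclideanSpace ℝ (Fin n) → ℝ}

/-- Integration by parts against the cutoff functions of a distance-like function. -/
theorem integral_cutoff_mul_div_le (hρ : LipschitzWith 1 ρ)
    (hb : ∀ R, Bornology.IsBounded {y | ρ y < R}) (hY : ContDiff ℝ ∞ Y)
    (hG : Integrable G) (hbound : ∀ y D, HasDerivAt (fun t : ℝ => ρ (y + t • Y y)) D 0 → |D| ≤ G y)
    (hR : 1 ≤ R) :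
    ∫ y, cutoff ρ R y * ∑ i, pderiv i (fun y => Y y i) y ≤ (∫ y, G y) / R := by
  have hR0 : 0 < R := by linarith
  have hψ := lipschitzWith_cutoff hρ hR
  obtain ⟨r, hr⟩ := (hb (2 * R)).subset_closedBall 0
  set r' := max r 0 + 1 with hr'
  -- A smooth bump equal to `1` near `{ρ < 2R}` replaces `Y` by a compactly supported field without
  -- changing it where the cutoff is nonzero.
  let χ : ContDiffBump (0 : EuclideanSpace ℝ (Fin n)) :=
    ⟨r', r' + 1, by positivity, by linarith⟩
  have hYi : ∀ i, ContDiff ℝ ∞ fun y => Y y i := fun i => by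
    exact (EuclideanSpace.proj (𝕜 := ℝ) i).contDiff.comp hY
  let g : Fin n → EuclideanSpace ℝ (Fin n) → ℝ := fun i y => χ y * Y y i
  have hg : ∀ i, ContDiff ℝ ∞ (g i) := fun i => χ.contDiff.mul (hYi i)
  have hgc : ∀ i, HasCompactSupport (g i) := fun i => χ.hasCompactSupport.mul_right
  have hinside : ∀ y, ρ y < 2 * R → ∀ i, g i =ᶠ[𝓝 y] fun y => Y y i := by
    intro y hy i
    have hmem : Metric.closedBall (0 : EuclideanSpace ℝ (Fin n)) r' ∈ 𝓝 y := by
      refine mem_of_superset (Metric.isOpen_ball.mem_nhds ?_) Metric.ball_subset_closedBall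
      have := hr hy
      rw [Metric.mem_closedBall] at this
      rw [Metric.mem_ball]
      linarith [le_max_left r 0]
    filter_upwards [hmem] with z hz
    simp only [g, χ.one_of_mem_closedBall hz, one_mul]
  have hIBP : ∀ i, ∫ y, lineDeriv ℝ (cutoff ρ R) y (EuclideanSpace.single i 1) * g i y
      = ∫ y, lineDeriv ℝ (g i) y (-EuclideanSpace.single i 1) * cutoff ρ R y := fun i => by
    obtain ⟨C, hC⟩ := (hg i).lipschitzWith_of_hasCompactSupport (hgc i) (by simp)
    exact hψ.integral_lineDeriv_mul_eq hC (hgc i) _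
  have hA : ∀ i, Integrable fun y =>
      lineDeriv ℝ (cutoff ρ R) y (EuclideanSpace.single i 1) * g i y := fun i =>
    (((hg i).continuous.integrable_of_hasCompactSupport (hgc i)).mul_of_top_right
      (hψ.memLp_lineDeriv _))
  have hBeq : ∀ i y, lineDeriv ℝ (g i) y (-EuclideanSpace.single i 1) * cutoff ρ R y
      = -(cutoff ρ R y * pderiv i (fun y => Y y i) y) := by
    intro i y
    by_cases hy : ρ y < 2 * R
    · rw [((hg i).differentiable (by simp) y).lineDeriv_eq_fderiv, map_neg,
        ← pderiv_congr (hinside y hy i) i, pderiv]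
      ring
    · rw [cutoff_eq_zero hR0 (not_lt.1 hy)]; ring
  have hBint : ∀ i, Integrable fun y => cutoff ρ R y * pderiv i (fun y => Y y i) y := fun i =>
    (hψ.continuous.mul ((hYi i).pderiv i).continuous).integrable_of_hasCompactSupport
      (hasCompactSupport_cutoff hb hR0).mul_right
  have hlhs : ∫ y, cutoff ρ R y * ∑ i, pderiv i (fun y => Y y i) y
      = -∫ y, ∑ i, lineDeriv ℝ (cutoff ρ R) y (EuclideanSpace.single i 1) * g i y := by
    simp only [Finset.mul_sum]
    rw [integral_finsetSum _ fun i _ => hBint i, integral_finsetSum _ fun i _ => hA i,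
      ← Finset.sum_neg_distrib]
    refine Finset.sum_congr rfl fun i _ => ?_
    rw [hIBP i]
    simp only [hBeq, integral_neg, neg_neg]
  rw [hlhs, ← integral_neg, ← integral_div]
  refine integral_mono_ae (integrable_finsetSum _ fun i _ => hA i).neg (hG.div_const R) ?_
  -- Rademacher's theorem: `ρ` and its cutoff are differentiable almost everywhere, and comparing
  -- difference quotients gains the factor `1/R`.
  filter_upwards [hψ.ae_differentiableAt (μ := volume), hρ.ae_differentiableAt (μ := volume)] with y hy1 hy2
  have hsum : ∑ i, lineDeriv ℝ (cutoff ρ R) y (EuclideanSpace.single i 1) * g i y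
      = χ y * fderiv ℝ (cutoff ρ R) y (Y y) := by
    rw [fderiv_eq_sum_pderiv, Finset.mul_sum]
    refine Finset.sum_congr rfl fun i _ => ?_
    rw [hy1.lineDeriv_eq_fderiv, pderiv, smul_eq_mul]; ring
  have hline : HasDerivAt (fun t : ℝ => y + t • Y y) (Y y) 0 := by
    have := ((hasDerivAt_id (0 : ℝ)).smul_const (Y y)).const_add y
    rwa [one_smul] at this
  have hd1 : HasDerivAt (fun t : ℝ => cutoff ρ R (y + t • Y y))
      (fderiv ℝ (cutoff ρ R) y (Y y)) 0 := by
    have h : HasFDerivAt (cutoff ρ R) (fderiv ℝ (cutoff ρ R) y) (y + (0 : ℝ) • Y y) := by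
      rw [zero_smul, add_zero]; exact hy1.hasFDerivAt
    exact h.comp_hasDerivAt (0 : ℝ) hline
  have hd2 : HasDerivAt (fun t : ℝ => ρ (y + t • Y y)) (fderiv ℝ ρ y (Y y)) 0 := by
    have h : HasFDerivAt (ρ) (fderiv ℝ (ρ) y) (y + (0 : ℝ) • Y y) := by
      rw [zero_smul, add_zero]; exact hy2.hasFDerivAt
    exact h.comp_hasDerivAt (0 : ℝ) hline
  have hle : |fderiv ℝ (cutoff ρ R) y (Y y)| ≤ |fderiv ℝ ρ y (Y y)| / R := by
    have h1 := hd1.tendsto_slope.abs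
    have h2 := hd2.tendsto_slope.abs.div_const R
    refine le_of_tendsto_of_tendsto' h1 h2 fun t => ?_
    simp only [slope_def_field, abs_div]
    rw [div_right_comm]
    gcongr
    exact abs_cutoff_sub_le hR0 _ _
  have hG0 := hbound y _ hd2
  simp only [hsum]
  have h1 : |χ y * fderiv ℝ (cutoff ρ R) y (Y y)| ≤ |fderiv ℝ (cutoff ρ R) y (Y y)| := by
    rw [abs_mul, abs_of_nonneg χ.nonneg]
    exact mul_le_of_le_one_left (abs_nonneg _) χ.le_one
  calc -(χ y * fderiv ℝ (cutoff ρ R) y (Y y)) ≤ |χ y * fderiv ℝ (cutoff ρ R) y (Y y)| :=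
        neg_le_abs _
    _ ≤ |fderiv ℝ ρ y (Y y)| / R := h1.trans hle
    _ ≤ G y / R := by gcongr

/-- A vector field of nonnegative divergence which is integrable in the sense of a complete metric
is divergence-free. -/
theorem div_eq_zero_of_nonneg (hρ : LipschitzWith 1 ρ) (hρ0 : ∀ y, 0 ≤ ρ y)
    (hb : ∀ R, Bornology.IsBounded {y | ρ y < R}) (hY : ContDiff ℝ ∞ Y)
    (hG : Integrable G) (hbound : ∀ y D, HasDerivAt (fun t : ℝ => ρ (y + t • Y y)) D 0 → |D| ≤ G y)
    (hdiv : ∀ y, 0 ≤ ∑ i, pderiv i (fun y => Y y i) y) (y : EuclideanSpace ℝ (Fin n)) :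
    ∑ i, pderiv i (fun y => Y y i) y = 0 := by
  by_contra hne
  set R₀ := ρ y + 1 with hR₀
  have hR1 : 1 ≤ R₀ := by linarith [hρ0 y]
  have hYi : ∀ i, ContDiff ℝ ∞ fun y => Y y i := fun i => by
    exact (EuclideanSpace.proj (𝕜 := ℝ) i).contDiff.comp hY
  have hint : ∀ R, 1 ≤ R →
      (Continuous fun y => cutoff ρ R y * ∑ i, pderiv i (fun y => Y y i) y) ∧
      HasCompactSupport fun y => cutoff ρ R y * ∑ i, pderiv i (fun y => Y y i) y := fun R hR =>
    ⟨(lipschitzWith_cutoff hρ hR).continuous.mul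
      (continuous_finsetSum _ fun i _ => ((hYi i).pderiv i).continuous),
      (hasCompactSupport_cutoff hb (by linarith)).mul_right⟩
  have hpos : 0 < ∫ y, cutoff ρ R₀ y * ∑ i, pderiv i (fun y => Y y i) y := by
    refine (hint R₀ hR1).1.integral_pos_of_hasCompactSupport_nonneg_nonzero (x := y)
      (hint R₀ hR1).2 (fun z => mul_nonneg (cutoff_nonneg z) (hdiv z)) ?_
    rw [cutoff_eq_one (by linarith) (by linarith), one_mul]
    exact hne
  -- The cutoffs increase with `R` and the divergence is nonnegative, so the fixed positive integral
  -- at `R₀` is bounded by quantities tending to zero.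
  have hle : ∀ R, R₀ ≤ R →
      ∫ y, cutoff ρ R₀ y * ∑ i, pderiv i (fun y => Y y i) y ≤ (∫ y, G y) / R := fun R hR => by
    refine le_trans (integral_mono ?_ ?_ fun z => ?_)
      (integral_cutoff_mul_div_le hρ hb hY hG hbound (hR1.trans hR))
    · exact (hint R₀ hR1).1.integrable_of_hasCompactSupport (hint R₀ hR1).2
    · exact (hint R (hR1.trans hR)).1.integrable_of_hasCompactSupport (hint R (hR1.trans hR)).2
    · exact mul_le_mul_of_nonneg_right (cutoff_mono (by linarith) hR (hρ0 z)) (hdiv z)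
  have hlim : Tendsto (fun R : ℝ => (∫ y, G y) / R) atTop (𝓝 0) := tendsto_const_nhds.div_atTop
    tendsto_id
  have := ge_of_tendsto hlim (by filter_upwards [eventually_ge_atTop R₀] with R hR using hle R hR)
  linarith

end Divergence

end SpacelikeHypersurface

namespace SpacelikeHypersurface

theorem measure_le_of_countable_cover {α : Type*} [MeasurableSpace α] {μ ν : Measure α}
    {U : ℕ → Set α} (hU : ∀ k, MeasurableSet (U k)) (hcover : ⋃ k, U k = Set.univ)
    (h : ∀ k A, MeasurableSet A → A ⊆ U k → μ A ≤ ν A) : μ ≤ ν := by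
  refine Measure.le_iff.2 fun A hA => ?_
  have hm : ∀ k, MeasurableSet (A ∩ disjointed U k) := fun k =>
    hA.inter (MeasurableSet.disjointed hU k)
  have hd : Pairwise (Function.onFun Disjoint fun k => A ∩ disjointed U k) := fun i j hij =>
    (disjoint_disjointed U hij).mono Set.inter_subset_right Set.inter_subset_right
  have hA' : A = ⋃ k, A ∩ disjointed U k := by
    rw [← Set.inter_iUnion, iUnion_disjointed, hcover, Set.inter_univ]
  rw [hA', measure_iUnion hd hm, measure_iUnion hd hm]
  exact ENNReal.tsum_le_tsum fun k =>
    h k _ (hm k) (Set.inter_subset_right.trans (disjointed_subset U k))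

/-! ### The Riemannian volume in graph coordinates, and vanishing of the drift Laplacian. -/

section Volume

variable {n : ℕ} {M : Type*} [TopologicalSpace M] [ChartedSpace (EuclideanSpace ℝ (Fin n)) M]
  [IsManifold (𝓡 n) ∞ M] [T2Space M] [ConnectedSpace M] {x N : M → LorentzSpace n}
  (e : LorentzFrame n) (hx : IsSpacelikeImmersion x) (hN : IsUnitNormal x N)
  (hc : IsCompleteHypersurface x)

theorem patchDensity_comp {X : EuclideanSpace ℝ (Fin n) → LorentzSpace n}
    {τ : EuclideanSpace ℝ (Fin n) → EuclideanSpace ℝ (Fin n)} {u : EuclideanSpace ℝ (Fin n)}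
    (hX : DifferentiableAt ℝ X (τ u)) (hτ : DifferentiableAt ℝ τ u) :
    patchDensity (fun v => X (τ v)) u = |(fderiv ℝ τ u).det| * patchDensity X (τ u) := by
  set J := LinearMap.toMatrix (EuclideanSpace.basisFun (Fin n) ℝ).toBasis
    (EuclideanSpace.basisFun (Fin n) ℝ).toBasis (fderiv ℝ τ u : _ →ₗ[ℝ] _) with hJ
  have hJa : ∀ k j, J k j = fderiv ℝ τ u (EuclideanSpace.single j 1) k := fun k j => by
    simp [hJ, LinearMap.toMatrix_apply]
  have hp : ∀ j, pderiv j (fun v => X (τ v)) u = ∑ k, J k j • pderiv k X (τ u) := fun j => by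
    simp only [hJa]
    rw [← fderiv_eq_sum_pderiv X]
    exact congrArg (fun A => A (EuclideanSpace.single j 1)) (fderiv_comp u hX hτ)
  have hg : patchMetric (fun v => X (τ v)) u = Jᵀ * patchMetric X (τ u) * J := by
    ext i j
    simp only [patchMetric, Matrix.of_apply, hp, lorentz_sum_left, lorentz_sum_right,
      lorentz_smul_left, lorentz_smul_right, Matrix.mul_apply, Matrix.transpose_apply,
      Finset.sum_mul, Finset.mul_sum]
    exact Finset.sum_congr rfl fun k _ => Finset.sum_congr rfl fun l _ => by ring
  have hdet : (fderiv ℝ τ u).det = J.det := by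
    rw [hJ, LinearMap.det_toMatrix]
  rw [patchDensity, patchDensity, hg, Matrix.det_mul, Matrix.det_mul, Matrix.det_transpose, hdet,
    mul_right_comm, ← sq, Real.sqrt_mul (sq_nonneg _), Real.sqrt_sq_eq_abs]

variable [MeasurableSpace M] [BorelSpace M]

theorem measurableEmbedding_graphMap : MeasurableEmbedding (graphMap e hx hc) :=
  (graphDiffeo e hx hc).symm.toHomeomorph.measurableEmbedding

include hN in
-- Change of variables by the transition map `τ` from the chart to graph coordinates, under which
-- the density transforms with `|det dτ|`.
theorem map_graphMap_apply_le_chartVolume (c : M) {A : Set M} (hA : MeasurableSet A)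
    (hAc : A ⊆ (chartAt (EuclideanSpace ℝ (Fin n)) c).source) :
    ((volume.withDensity fun y => ENNReal.ofReal
      (patchDensity (fun y => x (graphMap e hx hc y)) y)).map (graphMap e hx hc)) A
      ≤ chartVolume x c A := by
  classical
  set X := fun y => x (graphMap e hx hc y) with hX
  have hXs : ContDiff ℝ ∞ X := contDiff_comp_graphMap e hx hc hx.1
  set T := (extChartAt (𝓡 n) c).target with hT
  have hTo : IsOpen T := isOpen_extChartAt_target c
  set φ := (extChartAt (𝓡 n) c).symm with hφ
  have hφc : ContinuousOn φ T := continuousOn_extChartAt_symm c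
  set τ : EuclideanSpace ℝ (Fin n) → EuclideanSpace ℝ (Fin n) := fun u => e.proj (inChart c x u)
    with hτ
  have hτs : ContDiffOn ℝ ∞ τ T := e.proj.contDiff.comp_contDiffOn (contDiffOn_inChart hx.1 c)
  have hστ : ∀ u, graphMap e hx hc (τ u) = φ u := fun u => graphMap_proj e hx hc _
  have hXτ : (fun v => X (τ v)) = inChart c x := by
    funext v; simp only [hX, hστ]; rfl
  set S := φ ⁻¹' A ∩ T with hS
  -- The inverse chart is continuous only on its target, so it is first extended by a constant to a
  -- globally measurable map.
  have hSm : MeasurableSet S := by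
    have hpw : Measurable (T.piecewise φ fun _ => c) :=
      hφc.measurable_piecewise continuousOn_const hTo.measurableSet
    have : S = T.piecewise φ (fun _ => c) ⁻¹' A ∩ T := by
      ext u
      simp only [hS, Set.mem_inter_iff, Set.mem_preimage]
      constructor <;> rintro ⟨h1, h2⟩ <;> refine ⟨?_, h2⟩
      · rwa [Set.piecewise_eq_of_mem _ _ _ h2]
      · rwa [Set.piecewise_eq_of_mem _ _ _ h2] at h1
    rw [this]
    exact (hpw hA).inter hTo.measurableSet
  have hSimg : τ '' S = graphMap e hx hc ⁻¹' A := by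
    ext y
    constructor
    · rintro ⟨u, hu, rfl⟩
      rw [Set.mem_preimage, hστ]; exact hu.1
    · intro hy
      have hsrc : graphMap e hx hc y ∈ (extChartAt (𝓡 n) c).source := by
        rw [extChartAt_source]; exact hAc hy
      refine ⟨extChartAt (𝓡 n) c (graphMap e hx hc y), ⟨?_, (extChartAt (𝓡 n) c).map_source hsrc⟩,
        ?_⟩
      · rw [Set.mem_preimage, hφ, (extChartAt (𝓡 n) c).left_inv hsrc]; exact hy
      · simp only [hτ, inChart, Function.comp_apply, (extChartAt (𝓡 n) c).left_inv hsrc,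
          proj_graphMap]
  have hinj : Set.InjOn τ S := fun u hu v hv huv => by
    have := congrArg (graphMap e hx hc) huv
    rw [hστ, hστ] at this
    exact (extChartAt (𝓡 n) c).symm.injOn hu.2 hv.2 this
  have hder : ∀ u ∈ S, HasFDerivWithinAt τ (fderiv ℝ τ u) S u := fun u hu =>
    (hτs.differentiableAt_of_isOpen hTo hu.2).hasFDerivAt.hasFDerivWithinAt
  have hL : ((volume.withDensity fun y => ENNReal.ofReal (patchDensity X y)).map
      (graphMap e hx hc)) A = ∫⁻ u in S, ENNReal.ofReal (Real.sqrt (metricMatrix x c u).det) := by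
    have hdens : Measurable fun y => ENNReal.ofReal (patchDensity X y) := by
      have : ContDiff ℝ ∞ (patchDensity X) := by
        rw [← contDiffOn_univ]; exact (isPatch_graph e hx hN hc).contDiffOn_density
      exact this.continuous.measurable.ennreal_ofReal
    rw [(measurableEmbedding_graphMap e hx hc).map_apply, withDensity_apply', ← hSimg,
      lintegral_image_eq_lintegral_abs_det_fderiv_mul volume hSm hder hinj]
    refine setLIntegral_congr_fun hSm fun u hu => ?_
    rw [← ENNReal.ofReal_mul (abs_nonneg _), ← patchDensity_comp
      (hXs.differentiable (by simp) _) (hτs.differentiableAt_of_isOpen hTo hu.2), hXτ]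
    rfl
  have hmeas : AEMeasurable φ ((volume.restrict T).withDensity fun u =>
      ENNReal.ofReal (Real.sqrt (metricMatrix x c u).det)) :=
    (hφc.aemeasurable hTo.measurableSet).mono_ac (withDensity_absolutelyContinuous _ _)
  rw [hL, chartVolume, Measure.map_apply_of_aemeasurable hmeas hA, withDensity_apply',
    Measure.restrict_restrict' hTo.measurableSet]

variable [SecondCountableTopology M]

include hN in
theorem map_graphMap_le_riemannianVolume :
    (volume.withDensity fun y => ENNReal.ofReal
      (patchDensity (fun y => x (graphMap e hx hc y)) y)).map (graphMap e hx hc)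
      ≤ riemannianVolume x := by
  obtain ⟨s, hs, hcover⟩ := TopologicalSpace.countable_cover_nhds fun c : M =>
    (chart_source_mem_nhds (EuclideanSpace ℝ (Fin n)) c)
  have hne : s.Nonempty := by
    by_contra h
    rw [Set.not_nonempty_iff_eq_empty] at h
    obtain ⟨p⟩ := (inferInstance : Nonempty M)
    have : p ∈ (Set.univ : Set M) := trivial
    rw [← hcover, h] at this
    simp at this
  obtain ⟨f, rfl⟩ := hs.exists_eq_range hne
  refine measure_le_of_countable_cover
    (U := fun k => (chartAt (EuclideanSpace ℝ (Fin n)) (f k)).source)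
    (fun k => (chartAt _ (f k)).open_source.measurableSet) ?_ fun k A hA hAk => ?_
  · rw [← hcover, Set.biUnion_range]
  · exact (map_graphMap_apply_le_chartVolume e hx hN hc (f k) hA hAk).trans
      (le_iSup (fun c => chartVolume x c) (f k) A)

include hN in
-- One inequality is enough to transfer finiteness of the integral. `F` may be arbitrary because
-- `graphMap` is a measurable embedding.
theorem lintegral_graphMap_le (F : M → ℝ≥0∞) :
    ∫⁻ y, ENNReal.ofReal (patchDensity (fun y => x (graphMap e hx hc y)) y)
        * F (graphMap e hx hc y) ≤ ∫⁻ p, F p ∂(riemannianVolume x) := by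
  have hdens : Measurable fun y =>
      ENNReal.ofReal (patchDensity (fun y => x (graphMap e hx hc y)) y) := by
    have : ContDiff ℝ ∞ (patchDensity (fun y => x (graphMap e hx hc y))) := by
      rw [← contDiffOn_univ]; exact (isPatch_graph e hx hN hc).contDiffOn_density
    exact this.continuous.measurable.ennreal_ofReal
  refine le_trans (le_of_eq ?_) (lintegral_mono' (map_graphMap_le_riemannianVolume e hx hN hc)
    le_rfl)
  rw [(measurableEmbedding_graphMap e hx hc).lintegral_map,
    lintegral_withDensity_eq_lintegral_mul_non_measurable _ hdens (by simp)]
  rfl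

include hN in
/-- On a complete space-like hypersurface, a function `f` with `𝓛f ≥ 0` and weighted-integrable
gradient satisfies `𝓛f = 0`. -/
theorem driftLaplacian_eq_zero {f : M → ℝ} (hf : ContDiff ℝ ∞ fun y => f (graphMap e hx hc y))
    {s : ℝ} (hnonneg : ∀ p, 0 ≤ driftLaplacian x s f p)
    (hint : ∫⁻ p, ENNReal.ofReal (Real.sqrt (lorentz (inducedGradient x f p) (inducedGradient x f p))
      * Real.exp (-(s * lorentz (x p) (x p)) / 2)) ∂(riemannianVolume x) < ⊤) (p : M) :
    driftLaplacian x s f p = 0 := by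
  set X := fun y => x (graphMap e hx hc y) with hX
  set F := fun y => f (graphMap e hx hc y) with hF
  have hP := isPatch_graph e hx hN hc
  have hXs : ContDiff ℝ ∞ X := contDiff_comp_graphMap e hx hc hx.1
  set w : EuclideanSpace ℝ (Fin n) → ℝ := fun y => Real.exp (-(s * lorentz (X y) (X y)) / 2) with hw
  have hws : ContDiff ℝ ∞ w := ((contDiff_const.mul (hXs.lorentz hXs)).neg.div_const 2).exp
  have hwp : ∀ i y, pderiv i w y = w y * (-s * lorentz (X y) (pderiv i X y)) := by
    intro i y
    have hq : DifferentiableAt ℝ (fun y => lorentz (X y) (X y)) y :=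
      (hXs.lorentz hXs).differentiable (by simp) y
    have h1 : HasFDerivAt w (w y • ((-s / 2) • fderiv ℝ (fun y => lorentz (X y) (X y)) y)) y := by
      have := (hq.hasFDerivAt.const_mul (-s / 2)).exp
      refine (this.congr_of_eventuallyEq (Eventually.of_forall fun y => ?_)).congr_fderiv ?_
      · simp only [hw]; congr 1; ring
      · simp only [hw]; congr 2; ring
    have h2 := pderiv_lorentz (hXs.differentiable (by simp) y) (hXs.differentiable (by simp) y) i
    rw [pderiv] at h2
    rw [pderiv, h1.fderiv]
    simp only [smul_apply, smul_eq_mul, h2]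
    rw [lorentz_comm (pderiv i X y)]; ring
  have hdg : ∀ i, ContDiff ℝ ∞ fun y => patchDensity X y * patchGrad X F y i := by
    intro i
    have : (fun y => patchDensity X y * patchGrad X F y i)
        = fun y => ∑ j, (patchDensity X y * (patchMetric X y)⁻¹ i j) * pderiv j F y := by
      funext y
      simp only [patchGrad, Matrix.mulVec, dotProduct, Finset.mul_sum, mul_assoc]
    rw [this]
    refine ContDiff.sum fun j _ => ContDiff.mul ?_ (hf.pderiv j)
    rw [← contDiffOn_univ]; exact hP.contDiffOn_densityInv i j
  -- `Y = w √g ∇F` with weight `w = exp(-s⟨x,x⟩/2)`. Its coordinate divergence is `w √g 𝓛f`, because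
  -- `∂w` produces exactly the drift term.
  set Y : EuclideanSpace ℝ (Fin n) → EuclideanSpace ℝ (Fin n) := fun y =>
    WithLp.toLp 2 fun i => w y * (patchDensity X y * patchGrad X F y i) with hY
  have hYs : ContDiff ℝ ∞ Y := by
    rw [contDiff_euclidean]
    exact fun i => hws.mul (hdg i)
  have hdpos : ∀ y, 0 < patchDensity X y := fun y => hP.density_pos (Set.mem_univ y)
  have hgrad : ∀ y, ∑ i, patchGrad X F y i • pderiv i X y
      = inducedGradient x f (graphMap e hx hc y) := fun y =>
    (inducedGradient_graphMap e hx hN hc hf y).symm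
  have hdiv : ∀ y, ∑ i, pderiv i (fun y => Y y i) y
      = w y * patchDensity X y * driftLaplacian x s f (graphMap e hx hc y) := by
    intro y
    have h1 : ∀ i, pderiv i (fun y => Y y i) y
        = -(s * w y * patchDensity X y * (patchGrad X F y i * lorentz (X y) (pderiv i X y)))
          + w y * pderiv i (fun y => patchDensity X y * patchGrad X F y i) y := fun i => by
      have := pderiv_mul (hws.differentiable (by simp) y) ((hdg i).differentiable (by simp) y) i
      refine this.trans ?_
      rw [hwp]; ring
    simp only [h1, Finset.sum_add_distrib, Finset.sum_neg_distrib, ← Finset.mul_sum]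
    rw [driftLaplacian, inducedLaplacian_graphMap e hx hN hc hf, patchLaplacian, ← hgrad]
    simp only [lorentz_sum_right, lorentz_smul_right]
    change _ = w y * patchDensity X y * ((patchDensity X y)⁻¹ *
      ∑ i, pderiv i (fun v => patchDensity X v * patchGrad X F v i) y
      - s * ∑ i, patchGrad X F y i * lorentz (X y) (pderiv i X y))
    have := (hdpos y).ne'
    field_simp
    ring
  have hfd : ∀ y, fderiv ℝ X y (Y y)
      = (w y * patchDensity X y) • inducedGradient x f (graphMap e hx hc y) := fun y => by
    rw [fderiv_eq_sum_pderiv, ← hgrad, Finset.smul_sum]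
    refine Finset.sum_congr rfl fun i _ => ?_
    rw [smul_smul]; simp only [hY]; ring_nf
  -- The length of `Y` in the induced metric: it bounds the derivative of the distance along `Y`,
  -- and its Lebesgue integral is controlled by the weighted integral of `|∇f|`.
  set G : EuclideanSpace ℝ (Fin n) → ℝ := fun y =>
    Real.sqrt (lorentz (fderiv ℝ X y (Y y)) (fderiv ℝ X y (Y y))) with hG
  have hGc : Continuous G := by
    have : Continuous fun y => fderiv ℝ X y (Y y) :=
      (hXs.continuous_fderiv (by simp)).clm_apply hYs.continuous
    exact (continuous_lorentz this this).sqrt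
  have hGeq : ∀ y, ENNReal.ofReal (G y) = ENNReal.ofReal (patchDensity X y) * ENNReal.ofReal
      (Real.sqrt (lorentz (inducedGradient x f (graphMap e hx hc y))
        (inducedGradient x f (graphMap e hx hc y)))
      * Real.exp (-(s * lorentz (x (graphMap e hx hc y)) (x (graphMap e hx hc y))) / 2)) := by
    intro y
    have hwd : 0 ≤ w y * patchDensity X y := mul_nonneg (Real.exp_nonneg _) (hdpos y).le
    simp only [hG, hfd, lorentz_smul_left, lorentz_smul_right]
    rw [← ENNReal.ofReal_mul (hdpos y).le, ← mul_assoc, ← sq, Real.sqrt_mul (sq_nonneg _),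
      Real.sqrt_sq hwd]
    congr 1
    simp only [hw, hX]; ring
  have hGint : Integrable G := by
    refine ⟨hGc.aestronglyMeasurable, ?_⟩
    rw [hasFiniteIntegral_iff_ofReal (Eventually.of_forall fun y => Real.sqrt_nonneg _)]
    exact (lintegral_congr hGeq).trans_lt ((lintegral_graphMap_le e hx hN hc _).trans_lt hint)
  have hz := div_eq_zero_of_nonneg (lipschitzWith_graphDist e hx hc 0) (graphDist_nonneg e hx hc 0)
    (isBounded_graphDist_lt e hx hN hc 0) hYs hGint
    (fun y D hD => abs_le_of_hasDerivAt_graphDist e hx hc hD)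
    (fun y => by
      rw [hdiv]
      exact mul_nonneg (mul_nonneg (Real.exp_nonneg _) (hdpos y).le) (hnonneg _))
    (e.proj (x p))
  rw [hdiv, graphMap_proj] at hz
  exact (mul_eq_zero.1 hz).resolve_left
    (mul_pos (Real.exp_pos _) (hdpos _)).ne'

end Volume

end SpacelikeHypersurface

namespace SpacelikeHypersurface

/-! ### Parallel second fundamental form implies umbilicity. -/

section Rigidity

variable {n : ℕ} {M : Type*} [TopologicalSpace M] [ChartedSpace (EuclideanSpace ℝ (Fin n)) M]
  [IsManifold (𝓡 n) ∞ M] [T2Space M] [ConnectedSpace M] {x N : M → LorentzSpace n}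
  (e : LorentzFrame n) (hx : IsSpacelikeImmersion x) (hN : IsUnitNormal x N)
  (hc : IsCompleteHypersurface x)

include hx hN hc

/-- A function whose differential vanishes in adapted graph coordinates is constant. -/
theorem eq_of_pderiv_adapted_eq_zero {F : Type*} [NormedAddCommGroup F] [NormedSpace ℝ F]
    {f : M → F}
    (hf : ∀ e : LorentzFrame n, ContDiff ℝ ∞ fun y => f (graphMap e hx hc y))
    (h : ∀ (p : M) (e : LorentzFrame n), e.time = N p →
      ∀ i, pderiv i (fun y => f (graphMap e hx hc y)) (e.proj (x p)) = 0) (p q : M) :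
    f p = f q := by
  set e₀ := LorentzFrame.std n
  suffices hconst : ∀ y, fderiv ℝ (fun y => f (graphMap e₀ hx hc y)) y = 0 by
    have := is_const_of_fderiv_eq_zero ((hf e₀).differentiable (by simp)) hconst
      (e₀.proj (x p)) (e₀.proj (x q))
    simpa using this
  intro y
  set p := graphMap e₀ hx hc y with hp
  obtain ⟨e, he⟩ := LorentzFrame.exists_time_eq (N p) (hN.2 p).1
  have hcomp : (fun y => f (graphMap e₀ hx hc y))
      = fun y => (fun z => f (graphMap e hx hc z)) (e.proj (x (graphMap e₀ hx hc y))) := by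
    funext y; simp only [graphMap_proj]
  have h0 : fderiv ℝ (fun z => f (graphMap e hx hc z)) (e.proj (x p)) = 0 := by
    refine ContinuousLinearMap.ext fun v => ?_
    rw [fderiv_eq_sum_pderiv]
    simp [h p e he]
  have hd : HasFDerivAt (fun z => f (graphMap e hx hc z))
      (0 : EuclideanSpace ℝ (Fin n) →L[ℝ] F) (e.proj (x p)) := by
    rw [← h0]
    exact ((hf e).differentiable (by simp) _).hasFDerivAt
  have hτ : DifferentiableAt ℝ (fun y => e.proj (x (graphMap e₀ hx hc y))) y :=
    (e.proj.contDiff.comp (contDiff_comp_graphMap e₀ hx hc hx.1)).differentiable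
      (by simp : (∞ : WithTop ℕ∞) ≠ 0) y
  rw [hcomp]
  have := hd.comp y hτ.hasFDerivAt
  rw [ContinuousLinearMap.zero_comp] at this
  exact this.fderiv

/-- The position vector of a complete space-like hypersurface is not everywhere light-like. -/
theorem exists_lorentz_position_ne_zero (hn : 2 ≤ n) :
    ∃ p, lorentz (x p) (x p) ≠ 0 := by
  by_contra! hnull
  set e := LorentzFrame.std n
  set X := fun y => x (graphMap e hx hc y) with hX
  have hXs : ContDiff ℝ ∞ X := contDiff_comp_graphMap e hx hc hx.1
  have hzero : ∀ y, X y = 0 := by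
    intro y
    have hd : ∀ i, lorentz (pderiv i X y) (X y) = 0 := fun i => by
      have h1 := pderiv_lorentz (hXs.differentiable (by simp) y) (hXs.differentiable (by simp) y) i
      have h2 : (fun y => lorentz (X y) (X y)) = fun _ => 0 := funext fun y => hnull _
      rw [h2, pderiv_const, lorentz_comm (X y)] at h1
      linarith
    have h3 := (isPatch_graph e hx hN hc).tangent_projection (Set.mem_univ y) (X y)
    change ∑ j, ((patchMetric X y)⁻¹ *ᵥ fun k => lorentz (pderiv k X y) (X y)) j • pderiv j X y
      = X y + lorentz (X y) (N (graphMap e hx hc y)) • N (graphMap e hx hc y) at h3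
    simp only [hd] at h3
    -- If `⟨x,x⟩ = 0` identically, then `x` is orthogonal to all `∂ᵢx`, hence a multiple of the
    -- time-like `N`; being null it vanishes, which contradicts surjectivity of the projection.
    have h4 : X y = -lorentz (X y) (N (graphMap e hx hc y)) • N (graphMap e hx hc y) := by
      have : ((patchMetric X y)⁻¹ *ᵥ fun _ => (0 : ℝ)) = 0 := Matrix.mulVec_zero _
      rw [this] at h3
      simp only [Pi.zero_apply, zero_smul, Finset.sum_const_zero] at h3
      rw [neg_smul]
      exact eq_neg_of_add_eq_zero_left h3.symm
    have h5 : lorentz (X y) (X y) = 0 := hnull _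
    rw [h4, lorentz_smul_left, lorentz_smul_right, (hN.2 _).1] at h5
    have h6 : lorentz (X y) (N (graphMap e hx hc y)) = 0 := by
      simpa using h5
    rw [h4, h6]; simp
  have h7 := lorentz_graphMap_vec e hx hc (EuclideanSpace.single ⟨0, by omega⟩ 1) ⟨0, by omega⟩
  have h8 : x (graphMap e hx hc (EuclideanSpace.single ⟨0, by omega⟩ 1)) = 0 := hzero _
  rw [h8, lorentz_zero_left] at h7
  simp at h7

theorem umbilicityDefect_eq {p : M} (he : e.time = N p) :
    umbilicityDefect x N p
      = ∑ i, ∑ k, pderiv i (fun y => lorentz (N (graphMap e hx hc y)) (e.vec k)) (e.proj (x p)) ^ 2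
        - (∑ k, pderiv k (fun y => lorentz (N (graphMap e hx hc y)) (e.vec k)) (e.proj (x p))) ^ 2
          / n := by
  rw [umbilicityDefect, meanCurvature_eq e hx hN hc, secondFormNormSq_eq e hx hN hc]
  congr 1
  refine Finset.sum_congr rfl fun i _ => Finset.sum_congr rfl fun k _ => ?_
  rw [(isAdaptedGraph e hx hN hc he).pderiv_nu_symm k i, sq]

theorem umbilicityDefect_nonneg (hn : 2 ≤ n) (p : M) : 0 ≤ umbilicityDefect x N p := by
  obtain ⟨e, he⟩ := LorentzFrame.exists_time_eq (N p) (hN.2 p).1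
  rw [umbilicityDefect_eq e hx hN hc he]
  exact sum_sq_sub_trace_nonneg hn _

/-- The derivative of `H` is the trace of `∇h`. -/
theorem meanCurvature_eq_of_parallel
    (hpar : ∀ (p : M) (e : LorentzFrame n), e.time = N p → ∀ i j k,
      pderiv i (pderiv j (fun y => lorentz (N (graphMap e hx hc y)) (e.vec k))) (e.proj (x p)) = 0)
    (p q : M) : meanCurvature x N p = meanCurvature x N q := by
  refine eq_of_pderiv_adapted_eq_zero hx hN hc (fun e => contDiff_meanCurvature e hx hN hc)
    (fun p e he i => ?_) p q
  have hHe : (fun y => meanCurvature x N (graphMap e hx hc y))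
      = fun y => ∑ k, pderiv k (fun y => lorentz (N (graphMap e hx hc y)) (e.vec k)) y := by
    funext y; rw [meanCurvature_eq e hx hN hc, proj_graphMap]
  rw [hHe, pderiv_sum_fun fun k =>
    ((contDiff_comp_graphMap e hx hc hN.1).lorentz contDiff_const).pderiv k]
  exact Finset.sum_eq_zero fun k _ => hpar p e he i k k

variable {s lam : ℝ} (hlam : ∀ p, meanCurvature x N p - s * lorentz (x p) (N p) = lam)

include hlam

theorem driftLaplacian_umbilicityDefect_nonneg (hn : 2 ≤ n)
    (hQ : ∀ p : M, 0 ≤ (Real.sqrt (secondFormNormSq x N p - meanCurvature x N p ^ 2 / n)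
          - |lam| * (((n : ℝ) - 2) / (2 * Real.sqrt ((n : ℝ) * ((n : ℝ) - 1))))) ^ 2
        + 1 / (n : ℝ) * (meanCurvature x N p - lam) ^ 2
        - (n : ℝ) * lam ^ 2 / (4 * ((n : ℝ) - 1)) + s) (p : M) :
    0 ≤ driftLaplacian x s (umbilicityDefect x N) p := by
  obtain ⟨e, he⟩ := LorentzFrame.exists_time_eq (N p) (hN.2 p).1
  refine le_trans ?_ (driftLaplacian_umbilicityDefect_ge e hx hN hc hlam hn he)
  have h1 := mul_nonneg (umbilicityDefect_nonneg hx hN hc hn p) (hQ p)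
  exact add_nonneg (mul_nonneg zero_le_two (sum_sum_sq_sub_trace_nonneg hn _))
    (mul_nonneg zero_le_two h1)

/-- If `𝓛B` vanishes then the second fundamental form is parallel. -/
theorem pderiv_pderiv_normal_eq_zero (hn : 2 ≤ n)
    (hQ : ∀ p : M, 0 ≤ (Real.sqrt (secondFormNormSq x N p - meanCurvature x N p ^ 2 / n)
          - |lam| * (((n : ℝ) - 2) / (2 * Real.sqrt ((n : ℝ) * ((n : ℝ) - 1))))) ^ 2
        + 1 / (n : ℝ) * (meanCurvature x N p - lam) ^ 2
        - (n : ℝ) * lam ^ 2 / (4 * ((n : ℝ) - 1)) + s)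
    {p : M} (h0 : driftLaplacian x s (umbilicityDefect x N) p = 0) (he : e.time = N p)
    (i j k : Fin n) :
    pderiv i (pderiv j (fun y => lorentz (N (graphMap e hx hc y)) (e.vec k))) (e.proj (x p)) = 0 := by
  have h := driftLaplacian_umbilicityDefect_ge e hx hN hc hlam hn he
  have h1 := mul_nonneg (umbilicityDefect_nonneg hx hN hc hn p) (hQ p)
  have hA := isAdaptedGraph e hx hN hc he
  refine eq_zero_of_sum_sq_sub_trace hn (t := fun i j k =>
    pderiv i (pderiv j (fun y => lorentz (N (graphMap e hx hc y)) (e.vec k))) (e.proj (x p)))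
    (fun l i k => by rw [pderiv_swap (hA.contDiff_nu k)]) ?_ i j k
  rw [h0] at h
  linarith

/-- A complete space-like `λ`-hypersurface with parallel second fundamental form and
`⟨x, x⟩` of one sign is umbilical. -/
theorem umbilicityDefect_eq_zero_of_parallel (hn : 2 ≤ n) (hs : s ≠ 0)
    (hsign : (∀ p, 0 ≤ lorentz (x p) (x p)) ∨ (∀ p, lorentz (x p) (x p) ≤ 0))
    (hpar : ∀ (p : M) (e : LorentzFrame n), e.time = N p → ∀ i j k,
      pderiv i (pderiv j (fun y => lorentz (N (graphMap e hx hc y)) (e.vec k))) (e.proj (x p)) = 0)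
    (p₀ : M) : umbilicityDefect x N p₀ = 0 := by
  by_contra hB
  have hHe : ∀ (e : LorentzFrame n), (fun y => meanCurvature x N (graphMap e hx hc y))
      = fun y => ∑ k, pderiv k (fun y => lorentz (N (graphMap e hx hc y)) (e.vec k)) y := fun e => by
    funext y; rw [meanCurvature_eq e hx hN hc, proj_graphMap]
  have hνs : ∀ (e : LorentzFrame n) k,
      ContDiff ℝ ∞ fun y => lorentz (N (graphMap e hx hc y)) (e.vec k) := fun e k =>
    (contDiff_comp_graphMap e hx hc hN.1).lorentz contDiff_const
  have hHconst := meanCurvature_eq_of_parallel hx hN hc hpar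
  set c := lorentz (x p₀) (N p₀) with hcdef
  have hcc : ∀ p, lorentz (x p) (N p) = c := fun p => by
    have h1 := hlam p
    have h2 := hlam p₀
    rw [hHconst p p₀] at h1
    exact mul_left_cancel₀ hs (by rw [hcdef]; linarith)
  -- `h + c h² = 0`
  have hquad : ∀ (p : M) (e : LorentzFrame n), e.time = N p → ∀ i j,
      pderiv j (fun y => lorentz (N (graphMap e hx hc y)) (e.vec i)) (e.proj (x p))
      + c * ∑ k, pderiv j (fun y => lorentz (N (graphMap e hx hc y)) (e.vec k)) (e.proj (x p)) *
        pderiv i (fun y => lorentz (N (graphMap e hx hc y)) (e.vec k)) (e.proj (x p)) = 0 := by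
    intro p e he i j
    have h := (isAdaptedGraph e hx hN hc he).hessian_meanCurvature
      (meanCurvature_graph_eq e hx hN hc hlam) j i
    have hzero : ∑ k, pderiv j (pderiv i (pderiv k
        (fun y => lorentz (N (graphMap e hx hc y)) (e.vec k)))) (e.proj (x p)) = 0 := by
      have hconst : (fun y => ∑ k, pderiv k (fun y => lorentz (N (graphMap e hx hc y)) (e.vec k)) y)
          = fun _ => meanCurvature x N p₀ := by
        rw [← hHe]; funext y; exact hHconst _ _
      have h1 := congrFun (congrArg (fun f => pderiv j (pderiv i f)) hconst) (e.proj (x p))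
      rw [pderiv_sum_fun fun k => (hνs e k).pderiv k,
        pderiv_sum_fun fun k => ((hνs e k).pderiv k).pderiv i] at h1
      refine h1.trans ?_
      have h2 : pderiv i (fun _ : EuclideanSpace ℝ (Fin n) => meanCurvature x N p₀)
          = fun _ => 0 := funext fun y => pderiv_const _ i
      rw [h2, pderiv_const]
    rw [hzero] at h
    simp only [hpar p e he, mul_zero, Finset.sum_const_zero, add_zero, graphMap_proj, he, hcc] at h
    have h' := (mul_eq_zero.1 h.symm).resolve_left hs
    linarith
  have hc0 : c ≠ 0 := by
    rintro hc0
    obtain ⟨e, he⟩ := LorentzFrame.exists_time_eq (N p₀) (hN.2 p₀).1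
    refine hB ?_
    rw [umbilicityDefect_eq e hx hN hc he]
    have : ∀ i j, pderiv j (fun y => lorentz (N (graphMap e hx hc y)) (e.vec i)) (e.proj (x p₀)) = 0 :=
      fun i j => by have := hquad p₀ e he i j; rwa [hc0, zero_mul, add_zero] at this
    simp [this]
  set e := LorentzFrame.std n
  set X := fun y => x (graphMap e hx hc y) with hX
  have hXs : ContDiff ℝ ∞ X := contDiff_comp_graphMap e hx hc hx.1
  -- Since `⟨x, N⟩ = c`, this is the squared length of the tangential part `ξ` of `x`, and its
  -- gradient is `2ξ`.
  set W : EuclideanSpace ℝ (Fin n) → ℝ := fun y => lorentz (X y) (X y) + c ^ 2 with hW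
  have hWc : Continuous W := (continuous_lorentz hXs.continuous hXs.continuous).add continuous_const
  -- the tangential part of the position vector
  set ξ : EuclideanSpace ℝ (Fin n) → EuclideanSpace ℝ (Fin n) := fun y =>
    WithLp.toLp 2 ((patchMetric X y)⁻¹ *ᵥ fun k => lorentz (pderiv k X y) (X y)) with hξ
  have hξX : ∀ y, fderiv ℝ X y (ξ y) = X y + c • N (graphMap e hx hc y) := fun y => by
    rw [fderiv_eq_sum_pderiv]
    have := (isPatch_graph e hx hN hc).tangent_projection (Set.mem_univ y) (X y)
    rw [← hcc (graphMap e hx hc y)]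
    exact this
  have hξn : ∀ y, lorentz (fderiv ℝ X y (ξ y)) (fderiv ℝ X y (ξ y)) = W y := fun y => by
    have h1 := hcc (graphMap e hx hc y)
    have h2 := (hN.2 (graphMap e hx hc y)).1
    rw [hξX]
    simp only [lorentz_add_left, lorentz_add_right, lorentz_smul_left, lorentz_smul_right, h2,
      lorentz_comm (N (graphMap e hx hc y)), hW]
    rw [show lorentz (X y) (N (graphMap e hx hc y)) = c from h1]
    ring
  have hWd : ∀ (y : EuclideanSpace ℝ (Fin n)) (σ : ℝ),
      HasDerivAt (fun t : ℝ => W (y + t • σ • ξ y)) (σ * (2 * W y)) 0 := by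
    intro y σ
    have hXd : HasDerivAt (fun t : ℝ => X (y + t • σ • ξ y)) (fderiv ℝ X y (σ • ξ y)) 0 := by
      have hline : HasDerivAt (fun t : ℝ => y + t • σ • ξ y) (σ • ξ y) 0 := by
        have := ((hasDerivAt_id (0 : ℝ)).smul_const (σ • ξ y)).const_add y
        rwa [one_smul] at this
      have h : HasFDerivAt X (fderiv ℝ X y) (y + (0 : ℝ) • σ • ξ y) := by
        rw [zero_smul, add_zero]; exact (hXs.differentiable (by simp) y).hasFDerivAt
      exact h.comp_hasDerivAt (0 : ℝ) hline
    have h1 : HasDerivAt (fun t : ℝ => lorentz (X (y + t • σ • ξ y)) (X (y + t • σ • ξ y)))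
        (lorentz (fderiv ℝ X y (σ • ξ y)) (X y) + lorentz (X y) (fderiv ℝ X y (σ • ξ y))) 0 := by
      have := ((lorentzForm n).hasFDerivAt.comp_hasDerivAt (0 : ℝ) hXd).clm_apply hXd
      simp only [Function.comp_apply, zero_smul, add_zero] at this
      exact this
    refine (h1.add_const (c ^ 2)).congr_deriv ?_
    rw [lorentz_comm _ (X y), map_smul, hξX]
    simp only [lorentz_add_right, lorentz_smul_right, hW]
    rw [show lorentz (X y) (N (graphMap e hx hc y)) = c from hcc _]
    ring
  -- Along `±ξ`, a vector of length `√W`, the function `√W` changes at rate `±√W`: its slope is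
  -- exactly one wherever `W > 0`.
  have hsqrt : ∀ (y : EuclideanSpace ℝ (Fin n)) (σ : ℝ), 0 < W y →
      HasDerivAt (fun t : ℝ => Real.sqrt (W (y + t • σ • ξ y))) (σ * Real.sqrt (W y)) 0 := by
    intro y σ hy
    have h1 := (hWd y σ).sqrt (by simpa using hy.ne')
    refine h1.congr_deriv ?_
    rw [zero_smul, add_zero]
    have h2 := Real.sq_sqrt hy.le
    have h3 : Real.sqrt (W y) ≠ 0 := (Real.sqrt_pos.2 hy).ne'
    field_simp
    rw [h2]
  have hnormξ : ∀ (y : EuclideanSpace ℝ (Fin n)) (σ : ℝ), σ ^ 2 = 1 →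
      Real.sqrt (lorentz (fderiv ℝ X y (σ • ξ y)) (fderiv ℝ X y (σ • ξ y))) = Real.sqrt (W y) := by
    intro y σ hσ
    rw [map_smul, lorentz_smul_left, lorentz_smul_right, hξn, ← mul_assoc, ← sq, hσ, one_mul]
  -- If `⟨x,x⟩ ≥ 0`, then `W ≥ c² > 0` everywhere, and `√W`, bounded below by zero, descends at unit
  -- rate at every point: a contradiction.
  rcases hsign with hpos | hneg
  · have hWpos : ∀ y, 0 < W y := fun y =>
      add_pos_of_nonneg_of_pos (hpos _) (by positivity)
    obtain ⟨y, -, hy⟩ := exists_descent_rate_lt e hx hN hc hWc.sqrt (fun y => Real.sqrt_nonneg _) 0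
    have h1 := hy _ _ (hsqrt y (-1) (hWpos y)) (by linarith [Real.sqrt_pos.2 (hWpos y)])
    have h2 := hnormξ y (-1) (by norm_num)
    rw [show Real.sqrt _ = _ from h2] at h1
    linarith
  -- If `⟨x,x⟩ ≤ 0`, then `W ≤ c²`. Either `W = 0` identically and `x = -cN`, so that `h` is a
  -- multiple of the metric, or `-√W`, started at a point with `W > 0`, contradicts the descent
  -- principle.
  · by_cases hW0 : ∀ y, W y ≤ 0
    · have hWz : ∀ y, W y = 0 := fun y => by
        refine le_antisymm (hW0 y) ?_
        rw [← hξn]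
        by_cases hz : ξ y = 0
        · rw [hz, map_zero, lorentz_zero_left]
        · exact ((isPatch_graph e hx hN hc).pos y (Set.mem_univ y) _ hz).le
      have hξz : ∀ y, ξ y = 0 := fun y => by
        by_contra hz
        have := (isPatch_graph e hx hN hc).pos y (Set.mem_univ y) _ hz
        rw [show lorentz _ _ = _ from hξn y, hWz] at this
        exact lt_irrefl _ this
      have hxN : ∀ p, x p = -c • N p := fun p => by
        have := hξX (e.proj (x p))
        rw [hξz, map_zero] at this
        simp only [hX, graphMap_proj] at this
        rw [neg_smul]
        exact eq_neg_of_add_eq_zero_left this.symm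
      obtain ⟨e', he'⟩ := LorentzFrame.exists_time_eq (N p₀) (hN.2 p₀).1
      have hν : ∀ k, (fun y => lorentz (N (graphMap e' hx hc y)) (e'.vec k))
          = fun y => (-c⁻¹) * y k := fun k => by
        funext y
        have := lorentz_graphMap_vec e' hx hc y k
        rw [hxN, lorentz_smul_left] at this
        rw [← this]; field_simp
      have hdν : ∀ i k, pderiv i (fun y => lorentz (N (graphMap e' hx hc y)) (e'.vec k))
          (e'.proj (x p₀)) = if i = k then -c⁻¹ else 0 := fun i k => by
        rw [hν, pderiv_const_mul_fun _ (contDiff_coord k)]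
        simp only [pderiv_coord, mul_ite, mul_one, mul_zero]
      refine hB ?_
      rw [umbilicityDefect_eq e' hx hN hc he']
      simp only [hdν]
      have hn0 : (n : ℝ) ≠ 0 := by positivity
      simp only [ite_pow, if_true, Finset.sum_const, Finset.card_univ, Fintype.card_fin,
        nsmul_eq_mul, Finset.sum_ite_eq, Finset.mem_univ, ne_eq, OfNat.ofNat_ne_zero,
        not_false_eq_true, zero_pow]
      field_simp
      ring
    · push Not at hW0
      obtain ⟨q, hq⟩ := hW0
      have hWle : ∀ y, W y ≤ c ^ 2 := fun y => by
        simp only [hW]; linarith [hneg (graphMap e hx hc y)]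
      obtain ⟨y, hyq, hy⟩ := exists_descent_rate_lt e hx hN hc hWc.sqrt.neg (m := -Real.sqrt (c ^ 2))
        (fun y => neg_le_neg (Real.sqrt_le_sqrt (hWle y))) q
      have hyq' : Real.sqrt (W q) ≤ Real.sqrt (W y) := neg_le_neg_iff.1 hyq
      have hWy : 0 < Real.sqrt (W y) := (Real.sqrt_pos.2 hq).trans_le hyq'
      have h1 := hy _ _ (hsqrt y 1 (Real.sqrt_pos.1 hWy)).neg (by linarith)
      have h2 := hnormξ y 1 (by norm_num)
      rw [show Real.sqrt _ = _ from h2] at h1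
      linarith

end Rigidity

end SpacelikeHypersurface

namespace SpacelikeHypersurface

/-- The Lorentzian isometry that takes the point `m` to the origin and the frame `e` to the
standard frame. -/
noncomputable def LorentzFrame.affineEquiv {n : ℕ} (e : LorentzFrame n) (m : LorentzSpace n) :
    LorentzSpace n ≃ᵃ[ℝ] LorentzSpace n :=
  (AffineEquiv.constVAdd ℝ (LorentzSpace n) (-m)).trans e.toStd.toAffineEquiv

theorem LorentzFrame.affineEquiv_apply {n : ℕ} (e : LorentzFrame n) (m X : LorentzSpace n) :
    e.affineEquiv m X = e.toStd (X - m) := by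
  simp [LorentzFrame.affineEquiv, sub_eq_neg_add]

theorem LorentzFrame.affineEquiv_linear {n : ℕ} (e : LorentzFrame n) (m v : LorentzSpace n) :
    (e.affineEquiv m).linear v = e.toStd v := rfl

theorem eq_of_mem_hyperbolicSpace {n : ℕ} {c : ℝ} {Y Z : LorentzSpace n} (hY : Y ∈ hyperbolicSpace n c)
    (hZ : Z ∈ hyperbolicSpace n c) (h : ∀ i : Fin n, Y i.castSucc = Z i.castSucc) :
    Y (Fin.last n) = Z (Fin.last n) := by
  have h1 := hY.1.trans hZ.1.symm
  simp only [lorentz, h] at h1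
  have h2 := hY.2
  have h3 := hZ.2
  nlinarith

/-! ### Complete umbilical hypersurfaces of constant mean curvature. -/

section Classification

variable {n : ℕ} {M : Type*} [TopologicalSpace M] [ChartedSpace (EuclideanSpace ℝ (Fin n)) M]
  [IsManifold (𝓡 n) ∞ M] [T2Space M] [ConnectedSpace M] {x N : M → LorentzSpace n}
  (e : LorentzFrame n) (hx : IsSpacelikeImmersion x) (hN : IsUnitNormal x N)
  (hc : IsCompleteHypersurface x)

include hx hc

/-- The projection followed by the graph parametrization is a continuous left inverse of `x`. -/
theorem isEmbedding_of_complete : Topology.IsEmbedding x :=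
  Function.LeftInverse.isEmbedding
    (f := fun X => graphMap (LorentzFrame.std n) hx hc ((LorentzFrame.std n).proj X))
    (fun p => graphMap_proj _ hx hc p)
    ((continuous_graphMap _ hx hc).comp (LorentzFrame.std n).proj.continuous) hx.1.continuous

/-- To identify the image of a complete space-like hypersurface up to isometry it suffices to know
that it is contained in a set `Q` whose points are determined by their space-like coordinates. -/
theorem isIsometricToHypersurface_of_forall_mem {Q : Set (LorentzSpace n)} (m : LorentzSpace n)
    (hmem : ∀ p, e.toStd (x p - m) ∈ Q)
    (hQ : ∀ Y ∈ Q, ∀ Z ∈ Q, (∀ i : Fin n, Y i.castSucc = Z i.castSucc) →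
      Y (Fin.last n) = Z (Fin.last n)) : IsIsometricToHypersurface x Q := by
  refine ⟨isEmbedding_of_complete hx hc, e.affineEquiv m, fun v w => ?_, ?_⟩
  · simp only [LorentzFrame.affineEquiv_linear, e.lorentz_toStd]
  · ext Z
    simp only [Set.mem_image, Set.mem_range, exists_exists_eq_and, LorentzFrame.affineEquiv_apply]
    constructor
    · rintro ⟨p, rfl⟩; exact hmem p
    · intro hZ
      -- Surjectivity onto `Q`: the point of the entire graph lying over the same space-like
      -- coordinates as `Z`.
      refine ⟨graphMap e hx hc (e.proj (e.toStd.symm Z + m)), ?_⟩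
      set p := graphMap e hx hc (e.proj (e.toStd.symm Z + m)) with hp
      have hi : ∀ i : Fin n, e.toStd (x p - m) i.castSucc = Z i.castSucc := fun i => by
        rw [e.toStd_castSucc, lorentz_sub_left, hp, lorentz_graphMap_vec, e.proj_apply,
          lorentz_add_left, add_sub_cancel_right, ← e.toStd_castSucc, LinearEquiv.apply_symm_apply]
      ext j
      induction j using Fin.lastCases with
      | last => exact hQ _ (hmem p) _ hZ hi
      | cast i => exact hi i

include hN

theorem pderiv_normal_of_umbilicityDefect_eq_zero (hn : 2 ≤ n) {p : M}
    (hB : umbilicityDefect x N p = 0) (he : e.time = N p) (i k : Fin n) :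
    pderiv i (fun y => lorentz (N (graphMap e hx hc y)) (e.vec k)) (e.proj (x p))
      = if i = k then meanCurvature x N p / n else 0 := by
  rw [umbilicityDefect_eq e hx hN hc he] at hB
  rw [meanCurvature_eq e hx hN hc]
  exact eq_ite_of_sum_sq_sub_trace hn (h := fun i k =>
    pderiv i (fun y => lorentz (N (graphMap e hx hc y)) (e.vec k)) (e.proj (x p))) hB i k

theorem isTotallyUmbilical_of_umbilicityDefect_eq_zero (hn : 2 ≤ n)
    (hB : ∀ p, umbilicityDefect x N p = 0) : IsTotallyUmbilical x N := by
  intro p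
  obtain ⟨e, he⟩ := LorentzFrame.exists_time_eq (N p) (hN.2 p).1
  refine ⟨meanCurvature x N p / n, secondFormAt_eq_smul e hx hN hc fun k l => ?_⟩
  rw [pderiv_normal_of_umbilicityDefect_eq_zero e hx hN hc hn (hB p) he]
  exact if_congr eq_comm rfl rfl

/-- On an umbilical hypersurface of constant mean curvature `nκ`, `N - κ x` is constant. -/
theorem exists_normal_eq (hn : 2 ≤ n) (hB : ∀ p, umbilicityDefect x N p = 0) {κ : ℝ}
    (hκ : ∀ p, meanCurvature x N p / n = κ) : ∃ b, ∀ p, N p = κ • x p + b := by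
  obtain ⟨p₀⟩ := (inferInstance : Nonempty M)
  have hXs := fun e : LorentzFrame n => contDiff_comp_graphMap e hx hc hx.1
  have hNs := fun e : LorentzFrame n => contDiff_comp_graphMap e hx hc hN.1
  have hconst := eq_of_pderiv_adapted_eq_zero hx hN hc (f := fun p => N p - κ • x p)
    (fun e => (hNs e).sub ((hXs e).const_smul κ)) fun p e he i => by
      have hd1 := (hNs e).differentiable (by simp) (e.proj (x p))
      have hd2 := (hXs e).differentiable (by simp) (e.proj (x p))
      rw [pderiv_sub (g := fun y => κ • x (graphMap e hx hc y)) hd1 (hd2.const_smul κ),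
        pderiv_smul (differentiableAt_const κ) hd2, pderiv_const, zero_smul, add_zero, sub_eq_zero]
      have hP := isPatch_graph e hx hN hc
      -- Paired with tangent vectors, `dN = κ dx` is umbilicity; paired with `e.time = N p`, both
      -- sides vanish.
      refine e.ext_of_lorentz (fun k => ?_) ?_
      · have h1 := pderiv_lorentz hd1 (differentiableAt_const (e.vec k)) i
        rw [pderiv_const, lorentz_zero_right, add_zero] at h1
        rw [← h1, pderiv_normal_of_umbilicityDefect_eq_zero e hx hN hc hn (hB p) he, hκ,
          lorentz_smul_left]
        have h2 := congrArg (fun w : EuclideanSpace ℝ (Fin n) => w k)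
          (proj_fderiv_graphMap e hx hc (e.proj (x p)) (EuclideanSpace.single i 1))
        simp only [LorentzFrame.proj_apply] at h2
        rw [pderiv, h2]
        simp [eq_comm]
      · have h1 := hP.lorentz_pderiv_normal (Set.mem_univ (e.proj (x p))) i
        have h2 := hP.orth_pderiv (Set.mem_univ (e.proj (x p))) i
        rw [graphMap_proj] at h1 h2
        rw [he, h1, lorentz_smul_left, lorentz_comm, h2, mul_zero]
  refine ⟨N p₀ - κ • x p₀, fun p => ?_⟩
  have := hconst p p₀
  rw [← this]; abel

/-- `⟨x, b⟩` has derivative `⟨∂ᵢx, N⟩ = 0`, so `x` stays in the hyperplane through `x p₀` orthogonal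
to `b`. -/
theorem isIsometric_euclideanHyperplane {b : LorentzSpace n} (hb : ∀ p, N p = b) :
    IsIsometricToHypersurface x (euclideanHyperplane n) := by
  obtain ⟨p₀⟩ := (inferInstance : Nonempty M)
  obtain ⟨e, he⟩ := LorentzFrame.exists_time_eq (N p₀) (hN.2 p₀).1
  have hconst := eq_of_pderiv_adapted_eq_zero hx hN hc (f := fun p => lorentz (x p) b)
    (fun e => (contDiff_comp_graphMap e hx hc hx.1).lorentz contDiff_const) fun p e _ i => by
      have h2 := (isPatch_graph e hx hN hc).orth_pderiv (Set.mem_univ (e.proj (x p))) i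
      rw [pderiv_lorentz ((contDiff_comp_graphMap e hx hc hx.1).diffAt _)
        (differentiableAt_const _), pderiv_const, lorentz_zero_right, add_zero, lorentz_comm,
        ← hb (graphMap e hx hc (e.proj (x p)))]
      exact h2
  refine isIsometricToHypersurface_of_forall_mem e hx hc (x p₀) (fun p => ?_) fun Y hY Z hZ _ =>
    (show Y _ = 0 from hY).trans (show Z _ = 0 from hZ).symm
  change e.toStd (x p - x p₀) (Fin.last n) = 0
  rw [e.toStd_last, he, hb, lorentz_sub_left, hconst p p₀, sub_self, neg_zero]

theorem isIsometric_hyperbolicSpace {κ : ℝ} (hκ : κ ≠ 0) {b : LorentzSpace n}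
    (hb : ∀ p, N p = κ • x p + b) :
    IsIsometricToHypersurface x (hyperbolicSpace n (-κ ^ 2)) := by
  obtain ⟨p₀⟩ := (inferInstance : Nonempty M)
  -- The centre of the hyperboloid: `x - m = κ⁻¹N` has constant square `-1/κ²`.
  set m := -κ⁻¹ • b with hm
  have hxm : ∀ p, x p - m = κ⁻¹ • N p := fun p => by
    rw [hb, smul_add, smul_smul, inv_mul_cancel₀ hκ, one_smul, hm, neg_smul, sub_neg_eq_add]
  have hquad : ∀ p, lorentz (x p - m) (x p - m) = 1 / (-κ ^ 2) := fun p => by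
    rw [hxm, lorentz_smul_left, lorentz_smul_right, (hN.2 p).1]; field_simp
  have habs : |κ| ≠ 0 := abs_ne_zero.2 hκ
  -- The sign of `κ` is absorbed in the time direction, so that `x p₀ - m` is a positive multiple of
  -- `e.time` and lands on the upper sheet.
  obtain ⟨e, he⟩ := LorentzFrame.exists_time_eq ((κ / |κ|) • N p₀) (by
    rw [lorentz_smul_left, lorentz_smul_right, (hN.2 p₀).1, ← mul_assoc, div_mul_div_comm,
      abs_mul_abs_self, div_self (mul_ne_zero hκ hκ), one_mul])
  refine isIsometricToHypersurface_of_forall_mem e hx hc m (fun p => ⟨?_, ?_⟩)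
    fun Y hY Z hZ h => eq_of_mem_hyperbolicSpace hY hZ h
  · rw [e.lorentz_toStd, hquad]
  · rw [e.toStd_last]
    have hcont : Continuous fun p => -lorentz (x p - m) e.time :=
      (continuous_lorentz (hx.1.continuous.sub continuous_const) continuous_const).neg
    have h0 : 0 ≤ -lorentz (x p₀ - m) e.time := by
      rw [hxm, he, lorentz_smul_left, lorentz_smul_right, (hN.2 p₀).1]
      have : -(κ⁻¹ * (κ / |κ| * -1)) = |κ|⁻¹ := by field_simp
      rw [this]; positivity
    -- By connectedness, leaving the sheet would give a point with `x - m` orthogonal to `e.time`,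
    -- hence of nonnegative square, although the square is negative.
    by_contra hneg
    obtain ⟨q, hq⟩ := mem_range_of_exists_le_of_exists_ge hcont ⟨p, not_lt.1 hneg⟩ ⟨p₀, h0⟩
    have h1 := hquad q
    have h2 : lorentz (x q - m) e.time = 0 := neg_eq_zero.1 hq
    rw [e.parseval, h2, mul_zero, sub_zero] at h1
    have h3 : 0 ≤ ∑ i, lorentz (x q - m) (e.vec i) * lorentz (x q - m) (e.vec i) :=
      Finset.sum_nonneg fun i _ => mul_self_nonneg _
    have h4 : 1 / (-κ ^ 2) < 0 := one_div_neg.2 (neg_neg_of_pos (by positivity))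
    linarith

end Classification

end SpacelikeHypersurface
-- The main theorem.
theorem theorem1p2 {n : ℕ} (hn : 2 ≤ n)
    {M : Type*} [TopologicalSpace M] [T2Space M] [SecondCountableTopology M] [ConnectedSpace M]
    [ChartedSpace (EuclideanSpace ℝ (Fin n)) M] [IsManifold (𝓡 n) ∞ M]
    [MeasurableSpace M] [BorelSpace M]
    (x N : M → LorentzSpace n)
    (hx : IsSpacelikeImmersion x) (hN : IsUnitNormal x N) (hcomplete : IsCompleteHypersurface x)
    (a ε lam : ℝ) (ha : a ≠ 0)
    -- `⟨x, x⟩` does not change sign, and `ε = ±1` is the sign of `a⟨x, x⟩`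
    (hsign : (∀ p, 0 ≤ lorentz (x p) (x p)) ∨ (∀ p, lorentz (x p) (x p) ≤ 0))
    (hε : ∀ p, lorentz (x p) (x p) ≠ 0 → ε = Real.sign (a * lorentz (x p) (x p)))
    -- `x` is a `λ`-hypersurface with weight `s = εa`
    (hlam : ∀ p, meanCurvature x N p - (ε * a) * lorentz (x p) (N p) = lam)
    (hint : ∫⁻ p, ENNReal.ofReal
      ((Real.sqrt (lorentz (inducedGradient x (umbilicityDefect x N) p)
            (inducedGradient x (umbilicityDefect x N) p))
          + |driftLaplacian x (ε * a) (umbilicityDefect x N) p|)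
        * Real.exp (-(ε * a * lorentz (x p) (x p)) / 2)) ∂(riemannianVolume x) < ⊤) :
    (IsTotallyUmbilical x N ∧
      ((∃ c : ℝ, c < 0 ∧ IsIsometricToHypersurface x (hyperbolicSpace n c)) ∨
        IsIsometricToHypersurface x (euclideanHyperplane n))) ∨
    ∃ p : M,
      (Real.sqrt (secondFormNormSq x N p - meanCurvature x N p ^ 2 / n)
          - |lam| * (((n : ℝ) - 2) / (2 * Real.sqrt ((n : ℝ) * ((n : ℝ) - 1))))) ^ 2
        + 1 / (n : ℝ) * (meanCurvature x N p - lam) ^ 2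
        - (n : ℝ) * lam ^ 2 / (4 * ((n : ℝ) - 1)) + ε * a < 0 := by
  by_contra hcon
  rw [not_or, not_exists] at hcon
  obtain ⟨hclass, hno⟩ := hcon
  have hQ := fun p => not_lt.1 (hno p)
  -- The condition on `ε` fixes its value only where `⟨x,x⟩ ≠ 0`; a point where this holds shows
  -- that `ε` is nonzero.
  have hs : ε * a ≠ 0 := by
    obtain ⟨p, hp⟩ := exists_lorentz_position_ne_zero hx hN hcomplete hn
    refine mul_ne_zero ?_ ha
    rw [hε p hp]
    exact fun h => mul_ne_zero ha hp (Real.sign_eq_zero_iff.1 h)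
  have hint' : ∫⁻ p, ENNReal.ofReal
      (Real.sqrt (lorentz (inducedGradient x (umbilicityDefect x N) p)
          (inducedGradient x (umbilicityDefect x N) p))
        * Real.exp (-(ε * a * lorentz (x p) (x p)) / 2)) ∂(riemannianVolume x) < ⊤ := by
    refine lt_of_le_of_lt (lintegral_mono fun p => ENNReal.ofReal_le_ofReal ?_) hint
    gcongr
    exact le_add_of_nonneg_right (abs_nonneg _)
  have hdrift := driftLaplacian_eq_zero (LorentzFrame.std n) hx hN hcomplete
    (contDiff_umbilicityDefect _ hx hN hcomplete)
    (driftLaplacian_umbilicityDefect_nonneg hx hN hcomplete hlam hn hQ) hint'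
  have hpar := fun (p : M) (e : LorentzFrame n) (he : e.time = N p) =>
    pderiv_pderiv_normal_eq_zero e hx hN hcomplete hlam hn hQ (hdrift p) he
  have hB := umbilicityDefect_eq_zero_of_parallel hx hN hcomplete hlam hn hs hsign hpar
  obtain ⟨p₀⟩ := (inferInstance : Nonempty M)
  obtain ⟨b, hb⟩ := exists_normal_eq hx hN hcomplete hn hB
    (κ := meanCurvature x N p₀ / n) fun p => by
      rw [meanCurvature_eq_of_parallel hx hN hcomplete hpar p p₀]
  refine hclass ⟨isTotallyUmbilical_of_umbilicityDefect_eq_zero hx hN hcomplete hn hB, ?_⟩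
  by_cases hκ : meanCurvature x N p₀ / n = 0
  · right
    refine isIsometric_euclideanHyperplane hx hN hcomplete (b := b) fun p => ?_
    rw [hb, hκ, zero_smul, zero_add]
  · left
    exact ⟨_, neg_neg_of_pos (by positivity), isIsometric_hyperbolicSpace hx hN hcomplete hκ hb⟩
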